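/- Let $d\ge 2$, $m>0$, $L>0$, $\lambda\in\mathbb R$, $\eta\in\mathbb R$, let $B=[-L/2,L/2]^d$ with volume $|B|$, and let $V:\mathbb R\to\mathbb R$ be bounded and measurable. For $\Lambda\ge e$ put $$C_\Lambda(x)=\int_{\mathbb R^d}\frac{dp}{(2\pi)^d}\,e^{ipx}\,\frac{e^{-(p^2+m^2)/\Lambda^2}}{p^2+m^2},\qquad C(x)=\lim_{\Lambda\to\infty}C_\Lambda(x)\quad(x\ne 0),$$ $Z_\Lambda=C_\Lambda(0)^{\eta}$ and $\tilde C_\Lambda=Z_\Lambda C_\Lambda$. Let $\nu_\Lambda$ be the Gaussian measure on $S'(\mathbb R^d;\mathbb R)$ (with its cylinder $\sigma$-algebra) with mean zero and covariance $\tilde C_\Lambda$, i.e. the probability measure under which every $\phi(J)$, $J\in S(\mathbb R^d;\mathbb R)$, is a centred normal variable of variance $\langle J,\tilde C_\Lambda J\rangle_{L^2}=\int\!\int J(x)\tilde C_\Lambda(x-y)J(y)\,dx\,dy$. For $J\in S(\mathbb R^d;\mathbb R)$ let $$S_{0,\Lambda}(J)=\int e^{\phi(J)}\,d\nu_\Lambda(\phi),\qquad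 S_\Lambda(J)=\int e^{\phi(J)}\,e^{-\lambda\int_B V(\phi(x))\,dx}\,d\nu_\Lambda(\phi),\qquad \Sigma^{c}_\Lambda(J)=\log\frac{S_\Lambda(J)}{S_{0,\Lambda}(J)},$$ and write $\langle\delta_x,CJ\rangle=\int C(x-y)J(y)\,dy$. These quantities are well defined: for every $\Lambda\ge e$, $\nu_\Lambda$-almost every $\phi$ is given on $B$ by an integrable function (unique up to null sets), which gives $\int_B V(\phi(x))\,dx$ its meaning, and both integrals converge and are positive. Write $V_\pm=\lim_{w\to0^\pm}V(w)$ and $V^\pm=\lim_{w\to\pm\infty}V(w)$, when these limits exist. Then for every $J\in S(\mathbb R^d;\mathbb R)$ the limit $\Sigma^{c}(J)=\lim_{\Lambda\to\infty}\Sigma^{c}_\Lambda(J)$ exists under the following assumptions, and has the following form. (a) If $\eta<-1$ and $V_\pm$ exist, then $\Sigma^c(J)=-\lambda|B|\,\frac{V_++V_-}{2}$. (b) If $\eta=-1$, then $\Sigma^c(J)=-\lambda|B|\,\frac{1}{(2\pi)^{1/2}}\int_{\mathbb R}V(w)\,e^{-\frac12w^2}\,dw$. (c) If $-1<\eta<1$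 and $V^\pm$ exist, then $\Sigma^c(J)=-\lambda|B|\,\frac{V^++V^-}{2}$. (d) If $\eta=1$ and $V^\pm$ exist, then $$\Sigma^c(J)=-\lambda|B|\,\frac{V^++V^-}{2}-\lambda\,\frac{V^+-V^-}{2}\,\frac{1}{(2\pi)^{1/2}}\int_B dx\int_{\mathbb R}dw\,\mathrm{sgn}(w)\,e^{-\frac12(w-\langle\delta_x,CJ\rangle)^2}.$$ (e) If $\eta>1$, $V^\pm$ exist and the Fourier transform of $J$ has compact support, then $$\Sigma^c(J)=-\lambda|B|\,\frac{V^++V^-}{2}-\lambda\,\frac{V^+-V^-}{2}\,\mathbb 1(J\ne0)\int_B dx\,\mathrm{sgn}(\langle\delta_x,CJ\rangle).$$ Here $\mathrm{sgn}(0)=0$. -/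

import Mathlib

open MeasureTheory Filter Topology SchwartzMap
open scoped FourierTransform NNReal

noncomputable section

namespace ScalarField

/-- Euclidean spacetime `ℝ^d`. -/
abbrev Space (d : ℕ) := EuclideanSpace ℝ (Fin d)

/-- Real Schwartz functions `S(ℝ^d; ℝ)`. -/
abbrev TestFn (d : ℕ) := 𝓢(Space d, ℝ)

/-- Real tempered distributions `S'(ℝ^d; ℝ)`: continuous linear functionals on real Schwartz
functions. -/
abbrev Distr (d : ℕ) := TestFn d →L[ℝ] ℝ

/-- The cylinder σ-algebra on `S'(ℝ^d; ℝ)`, generated by the evaluations `φ ↦ φ(J)`. -/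
instance instMeasurableSpaceDistr (d : ℕ) : MeasurableSpace (Distr d) :=
  ⨆ J : TestFn d, MeasurableSpace.comap (fun φ : Distr d => φ J) inferInstance

/-- The box `B = [-L/2, L/2]^d`. -/
def box (d : ℕ) (L : ℝ) : Set (Space d) :=
  {x | ∀ i, x i ∈ Set.Icc (-(L / 2)) (L / 2)}

/-- The regularized covariance
`C_Λ(x) = ∫ dp/(2π)^d e^{ipx} e^{-(p² + m²)/Λ²} / (p² + m²)`.
The integral is real, because the integrand is even in `p` up to complex conjugation. -/
def cutoffCov (d : ℕ) (m Λ : ℝ) (x : Space d) : ℝ :=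
  (∫ p : Space d, ((1 / (2 * Real.pi) ^ d : ℝ) : ℂ) *
    Complex.exp (Complex.I * ((inner ℝ p x : ℝ) : ℂ)) *
    ((Real.exp (-(‖p‖ ^ 2 + m ^ 2) / Λ ^ 2) / (‖p‖ ^ 2 + m ^ 2) : ℝ) : ℂ)).re

/-- The covariance `C(x) = lim_{Λ → ∞} C_Λ(x)` (the limit exists for `x ≠ 0`; the value at the
single point `0`, where `C_Λ` diverges for `d ≥ 2`, plays no role below). -/
def freeCov (d : ℕ) (m : ℝ) (x : Space d) : ℝ :=
  limUnder atTop (fun Λ : ℝ => cutoffCov d m Λ x)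

/-- `⟨δ_x, K J⟩ = ∫ dy K(x - y) J(y)` for a translation invariant kernel `K`. -/
def applyCov {d : ℕ} (K : Space d → ℝ) (J : TestFn d) (x : Space d) : ℝ :=
  ∫ y, K (x - y) * J y

/-- `⟨J, K J⟩`, the scalar product being that of `L²(ℝ^d; ℝ)`. -/
def covForm {d : ℕ} (K : Space d → ℝ) (J : TestFn d) : ℝ :=
  ∫ x, J x * applyCov K J x

/-- The field renormalization `Z_Λ = C_Λ(0)^η`. -/
def fieldRenorm (d : ℕ) (m η Λ : ℝ) : ℝ := cutoffCov d m Λ 0 ^ η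

/-- The renormalized covariance `Z_Λ C_Λ`. -/
def renormCov (d : ℕ) (m η Λ : ℝ) (x : Space d) : ℝ :=
  fieldRenorm d m η Λ * cutoffCov d m Λ x

/-- `ν` is the Gaussian measure on `S'(ℝ^d; ℝ)` with mean zero and covariance `K`: under `ν`
every `φ(J)` is a centred normal variable of variance `⟨J, K J⟩`. -/
structure IsGaussianField {d : ℕ} (K : Space d → ℝ) (ν : Measure (Distr d)) : Prop where
  isProbabilityMeasure : IsProbabilityMeasure ν
  map_eval : ∀ J : TestFn d,
    ν.map (fun φ => φ J) = ProbabilityTheory.gaussianReal 0 (covForm K J).toNNReal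

/-- On the box `B` the distribution `φ` is given by the function `u`. -/
def IsFunctionOnBox {d : ℕ} (L : ℝ) (φ : Distr d) (u : Space d → ℝ) : Prop :=
  IntegrableOn u (box d L) ∧
    ∀ f : TestFn d, tsupport f ⊆ box d L → φ f = ∫ x, u x * f x

open Classical in
/-- The interaction term `∫_B dx V(φ(x))`, for `φ` given on `B` by a function. That function is
unique up to a null set, so the integral does not depend on the chosen representative. For the
other `φ` the value `0` is a convention. -/
def interaction {d : ℕ} (V : ℝ → ℝ) (L : ℝ) (φ : Distr d) : ℝ :=
  if h : ∃ u, IsFunctionOnBox L φ u then ∫ x in box d L, V (h.choose x) else 0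

/-- The free generating functional `⟨e^{φ(J)}⟩` with respect to `ν`. -/
def freeGen {d : ℕ} (ν : Measure (Distr d)) (J : TestFn d) : ℝ :=
  ∫ φ, Real.exp (φ J) ∂ν

/-- The interacting generating functional `⟨e^{φ(J)} e^{-λ ∫_B V(φ(x)) dx}⟩`. -/
def intGen {d : ℕ} (V : ℝ → ℝ) (L lam : ℝ) (ν : Measure (Distr d)) (J : TestFn d) : ℝ :=
  ∫ φ, Real.exp (φ J) * Real.exp (-lam * interaction V L φ) ∂ν

/-- The modified connected generating functional: the logarithm of the quotient of the
interacting and the free generating functional. -/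
def connGen {d : ℕ} (V : ℝ → ℝ) (L lam : ℝ) (ν : Measure (Distr d)) (J : TestFn d) : ℝ :=
  Real.log (intGen V L lam ν J / freeGen ν J)

/-- The volume `|B|`. -/
def boxVol (d : ℕ) (L : ℝ) : ℝ := volume.real (box d L)

end ScalarField

end

open ScalarField

/-! Dividing by the free functional tilts the Gaussian measure by `exp (φ J)`. As in the
Cameron–Martin formula, tilting keeps the covariance K and shifts the mean by K J. Hence the
quotient S_Λ(J)/S_{0,Λ}(J) is the expectation of exp(-λ U), where U = ∫_B V(φ(x)) dx is taken for
the shifted field (`intGen_div_freeGen`, `IsPointField.map_tilted_pair`).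

The correlation coefficient of the field at x and y is C_Λ(x-y)/C_Λ(0), from which Z_Λ cancels. For
d ≥ 2 the denominator diverges, while the numerator has a finite limit for almost every y, so the
field values decouple. Since V is bounded, the mean of U tends to a number c and its second moment
to c², so U concentrates at c. The exponential is Lipschitz on bounded sets, and the logarithm of
the quotient tends to -λc. This law of large numbers is `tendsto_connGen`; its analytic core is
`tendsto_integral_gaussianReal_pair_sub`, which needs no regularity of V because it uses convergence
of Gaussian densities.

It remains to find the limit of the one-point mean, the expectation of V(σ(g + h)) for a standard
normal g, with σ = C_Λ(0)^((η+1)/2) and h = C_Λ(0)^((η-1)/2) ⟨δ_x, C_Λ J⟩ (`tiltMean_renormCov`).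
The scale σ tends to 0, equals 1, or tends to ∞ according as η is below, equal to, or above -1. The
shift h tends to 0 for η < 1 and to ⟨δ_x, CJ⟩ for η = 1. For η > 1 it tends to ±∞ with the sign of
⟨δ_x, CJ⟩, provided this number is not zero. A band limited J ≠ 0 makes CJ analytic on lines, so its
zeros form a null set (`ae_applyCov_freeCov_ne_zero`).

Point values have no meaning for a distribution. They are built as almost sure limits of φ along
mollifiers, jointly measurable in φ and x (`exists_isPointField`), and are then shown to represent φ
on the box (`IsPointField.ae_isFunctionOnBox`), which links them to `interaction`. The limits of the
covariances come from the heat kernel representation. -/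

namespace ScalarField

/-! ### Positive definite kernels given by cosine transforms -/

/-- The properties of a covariance kernel used below: the cosine transform of a nonnegative
integrable function has them. -/
structure IsCovKernel {d : ℕ} (K : Space d → ℝ) : Prop where
  continuous : Continuous K
  even : ∀ x, K (-x) = K x
  abs_le : ∀ x, |K x| ≤ K 0
  covForm_nonneg : ∀ f : TestFn d, 0 ≤ covForm K f

/-- The cosine transform of a weight. -/
noncomputable def cosKernel {d : ℕ} (w : Space d → ℝ) (x : Space d) : ℝ :=
  ∫ p, w p * Real.cos (inner ℝ p x)

section CosKernel

variable {d : ℕ} {w : Space d → ℝ}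

lemma integrable_mul_cos (hw : Integrable w) (x : Space d) :
    Integrable fun p => w p * Real.cos (inner ℝ p x) :=
  hw.mul_bdd (c := 1) (by fun_prop) (.of_forall fun p => Real.abs_cos_le_one _)

lemma integrable_schwartz_mul_cos (f : TestFn d) (p : Space d) :
    Integrable fun x => f x * Real.cos (inner ℝ p x) :=
  f.integrable.mul_bdd (c := 1) (by fun_prop) (.of_forall fun p => Real.abs_cos_le_one _)

lemma integrable_schwartz_mul_sin (f : TestFn d) (p : Space d) :
    Integrable fun x => f x * Real.sin (inner ℝ p x) :=
  f.integrable.mul_bdd (c := 1) (by fun_prop) (.of_forall fun p => Real.abs_sin_le_one _)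

lemma continuous_cosKernel (hw : Integrable w) : Continuous (cosKernel w) := by
  refine continuous_of_dominated (bound := fun p => ‖w p‖) ?_ ?_ hw.norm ?_
  · exact fun x => (integrable_mul_cos hw x).aestronglyMeasurable
  · refine fun x => .of_forall fun p => ?_
    rw [norm_mul]
    exact mul_le_of_le_one_right (norm_nonneg _) (Real.abs_cos_le_one _)
  · exact .of_forall fun p => by fun_prop

lemma cosKernel_neg (x : Space d) : cosKernel w (-x) = cosKernel w x := by
  simp [cosKernel, inner_neg_right]

lemma cosKernel_zero : cosKernel w 0 = ∫ p, w p := by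
  simp [cosKernel]

lemma abs_cosKernel_le (hw : Integrable w) (h0 : ∀ p, 0 ≤ w p) (x : Space d) :
    |cosKernel w x| ≤ cosKernel w 0 := by
  rw [cosKernel_zero]
  refine (norm_integral_le_integral_norm _).trans (integral_mono
    (integrable_mul_cos hw x).norm hw fun p => ?_)
  simp only [norm_mul, Real.norm_eq_abs, abs_of_nonneg (h0 p)]
  exact mul_le_of_le_one_right (h0 p) (Real.abs_cos_le_one _)

/-- Fubini and the addition formula for cos(p·(x-y)). Working with real cosine and sine transforms
avoids complex Fourier analysis for the covariance. -/
lemma applyCov_cosKernel (hw : Integrable w) (f : TestFn d) (x : Space d) :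
    applyCov (cosKernel w) f x = ∫ p, w p * (Real.cos (inner ℝ p x) *
      (∫ y, f y * Real.cos (inner ℝ p y)) + Real.sin (inner ℝ p x) *
      (∫ y, f y * Real.sin (inner ℝ p y))) := by
  have hint : Integrable (Function.uncurry fun (y p : Space d) =>
      w p * Real.cos (inner ℝ p (x - y)) * f y) (volume.prod volume) := by
    have h := (f.integrable (μ := volume)).mul_prod hw
    refine (h.mul_bdd (c := 1)
      (g := fun z : Space d × Space d => Real.cos (inner ℝ z.2 (x - z.1)))
      (by fun_prop) (.of_forall fun p => Real.abs_cos_le_one _)).congr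
      (.of_forall fun z => ?_)
    simp only [Function.uncurry]; ring
  calc applyCov (cosKernel w) f x
      = ∫ y, ∫ p, w p * Real.cos (inner ℝ p (x - y)) * f y := by
        simp only [applyCov, cosKernel, integral_mul_const]
    _ = ∫ p, ∫ y, w p * Real.cos (inner ℝ p (x - y)) * f y :=
        integral_integral_swap hint
    _ = _ := by
        refine integral_congr_ae (.of_forall fun p => ?_)
        simp only
        rw [← integral_const_mul, ← integral_const_mul, ← integral_add, ← integral_const_mul]
        · refine integral_congr_ae (.of_forall fun y => ?_)
          simp only [inner_sub_right, Real.cos_sub]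
          ring
        · exact (integrable_schwartz_mul_cos f p).const_mul _
        · exact (integrable_schwartz_mul_sin f p).const_mul _

lemma abs_integral_schwartz_cos_le (f : TestFn d) (p : Space d) :
    |∫ y, f y * Real.cos (inner ℝ p y)| ≤ ∫ y, ‖f y‖ := by
  rw [← Real.norm_eq_abs]
  refine norm_integral_le_of_norm_le (f.integrable (μ := volume)).norm (.of_forall fun y => ?_)
  rw [norm_mul]
  exact mul_le_of_le_one_right (norm_nonneg _) (Real.abs_cos_le_one _)

lemma abs_integral_schwartz_sin_le (f : TestFn d) (p : Space d) :
    |∫ y, f y * Real.sin (inner ℝ p y)| ≤ ∫ y, ‖f y‖ := by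
  rw [← Real.norm_eq_abs]
  refine norm_integral_le_of_norm_le (f.integrable (μ := volume)).norm (.of_forall fun y => ?_)
  rw [norm_mul]
  exact mul_le_of_le_one_right (norm_nonneg _) (Real.abs_sin_le_one _)

lemma continuous_integral_schwartz_cos (f : TestFn d) :
    Continuous fun p : Space d => ∫ y, f y * Real.cos (inner ℝ p y) := by
  refine continuous_of_dominated (bound := fun p => ‖f p‖) ?_ ?_ f.integrable.norm ?_
  · exact fun p => (integrable_schwartz_mul_cos f p).aestronglyMeasurable
  · refine fun x => .of_forall fun p => ?_
    rw [norm_mul]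
    exact mul_le_of_le_one_right (norm_nonneg _) (Real.abs_cos_le_one _)
  · exact .of_forall fun p => by fun_prop

lemma continuous_integral_schwartz_sin (f : TestFn d) :
    Continuous fun p : Space d => ∫ y, f y * Real.sin (inner ℝ p y) := by
  refine continuous_of_dominated (bound := fun p => ‖f p‖) ?_ ?_ f.integrable.norm ?_
  · exact fun p => (integrable_schwartz_mul_sin f p).aestronglyMeasurable
  · refine fun x => .of_forall fun p => ?_
    rw [norm_mul]
    exact mul_le_of_le_one_right (norm_nonneg _) (Real.abs_sin_le_one _)
  · exact .of_forall fun p => by fun_prop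

/-- The real form of Plancherel: the bracket is |Ĵ(p)|². It gives positivity of the form, and later
its strict positivity for a nonzero band limited function. -/
lemma covForm_cosKernel (hw : Integrable w) (f : TestFn d) :
    covForm (cosKernel w) f = ∫ p, w p * ((∫ y, f y * Real.cos (inner ℝ p y)) ^ 2 +
      (∫ y, f y * Real.sin (inner ℝ p y)) ^ 2) := by
  set A := fun p : Space d => ∫ y, f y * Real.cos (inner ℝ p y) with hA
  set B := fun p : Space d => ∫ y, f y * Real.sin (inner ℝ p y) with hB
  have hAc : Continuous A := continuous_integral_schwartz_cos f
  have hBc : Continuous B := continuous_integral_schwartz_sin f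
  set I := ∫ y, ‖f y‖
  have hint : Integrable (Function.uncurry fun (x p : Space d) =>
      f x * (w p * (Real.cos (inner ℝ p x) * A p + Real.sin (inner ℝ p x) * B p)))
      (volume.prod volume) := by
    have h := (f.integrable (μ := volume)).mul_prod hw
    refine (h.mul_bdd (c := I + I)
      (g := fun z : Space d × Space d =>
        Real.cos (inner ℝ z.2 z.1) * A z.2 + Real.sin (inner ℝ z.2 z.1) * B z.2)
      (by fun_prop) (.of_forall fun z => ?_)).congr (.of_forall fun z => ?_)
    · refine (norm_add_le _ _).trans (add_le_add ?_ ?_)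
      · rw [norm_mul]
        exact (mul_le_of_le_one_left (norm_nonneg _) (Real.abs_cos_le_one _)).trans
          (abs_integral_schwartz_cos_le f _)
      · rw [norm_mul]
        exact (mul_le_of_le_one_left (norm_nonneg _) (Real.abs_sin_le_one _)).trans
          (abs_integral_schwartz_sin_le f _)
    · simp only [Function.uncurry]; ring
  calc covForm (cosKernel w) f
      = ∫ x, ∫ p, f x * (w p * (Real.cos (inner ℝ p x) * A p + Real.sin (inner ℝ p x) * B p)) := by
        simp only [covForm, applyCov_cosKernel hw, integral_const_mul, hA, hB]
    _ = ∫ p, ∫ x, f x * (w p * (Real.cos (inner ℝ p x) * A p + Real.sin (inner ℝ p x) * B p)) :=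
        integral_integral_swap hint
    _ = _ := by
        refine integral_congr_ae (.of_forall fun p => ?_)
        simp only
        have h1 : A p ^ 2 + B p ^ 2 = ∫ x, (A p * (f x * Real.cos (inner ℝ p x)) +
            B p * (f x * Real.sin (inner ℝ p x))) := by
          rw [integral_add ((integrable_schwartz_mul_cos f p).const_mul _)
            ((integrable_schwartz_mul_sin f p).const_mul _), integral_const_mul,
            integral_const_mul, sq, sq]
        rw [h1, ← integral_const_mul]
        refine integral_congr_ae (.of_forall fun y => ?_)
        simp only
        ring

lemma isCovKernel_cosKernel (hw : Integrable w) (h0 : ∀ p, 0 ≤ w p) :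
    IsCovKernel (cosKernel w) where
  continuous := continuous_cosKernel hw
  even := cosKernel_neg
  abs_le := abs_cosKernel_le hw h0
  covForm_nonneg f := by
    rw [covForm_cosKernel hw]
    exact integral_nonneg fun p => mul_nonneg (h0 p) (by positivity)

end CosKernel

/-! ### The regularized covariance -/

/-- The spectral density of the regularized covariance. -/
noncomputable def spectralWeight (d : ℕ) (m Λ : ℝ) (p : Space d) : ℝ :=
  (1 / (2 * Real.pi) ^ d) * (Real.exp (-(‖p‖ ^ 2 + m ^ 2) / Λ ^ 2) / (‖p‖ ^ 2 + m ^ 2))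

section Weight

variable {d : ℕ} {m Λ : ℝ}

lemma spectralWeight_pos (hm : 0 < m) (p : Space d) : 0 < spectralWeight d m Λ p := by
  unfold spectralWeight; positivity

lemma continuous_spectralWeight (hm : 0 < m) : Continuous (spectralWeight d m Λ) := by
  unfold spectralWeight
  have : ∀ p : Space d, ‖p‖ ^ 2 + m ^ 2 ≠ 0 := fun p => by positivity
  fun_prop (disch := assumption)

lemma integrable_exp_neg_mul_norm_sq {b : ℝ} (hb : 0 < b) :
    Integrable fun p : Space d => Real.exp (-b * ‖p‖ ^ 2) := by
  have h := (GaussianFourier.integrable_cexp_neg_mul_sq_norm_add (V := Space d)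
    (b := (b : ℂ)) (by simpa using hb) 0 0).re
  refine h.congr (.of_forall fun p => ?_)
  simp only [zero_mul, add_zero]
  rw [show -(b : ℂ) * (‖p‖ : ℂ) ^ 2 = ((-b * ‖p‖ ^ 2 : ℝ) : ℂ) by push_cast; ring,
    ← Complex.ofReal_exp]
  rfl

lemma integrable_spectralWeight (hm : 0 < m) (hΛ : 0 < Λ) :
    Integrable (spectralWeight d m Λ) := by
  refine ((integrable_exp_neg_mul_norm_sq (d := d) (b := 1 / Λ ^ 2)
    (by positivity)).const_mul (1 / (2 * Real.pi) ^ d * (1 / m ^ 2))).mono'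
    (continuous_spectralWeight hm).aestronglyMeasurable (.of_forall fun p => ?_)
  rw [Real.norm_of_nonneg (spectralWeight_pos hm p).le, spectralWeight, mul_assoc]
  gcongr
  rw [one_div, inv_mul_eq_div]
  gcongr
  · rw [neg_div, neg_mul, neg_le_neg_iff, one_div, inv_mul_eq_div]
    gcongr
    nlinarith
  · nlinarith [norm_nonneg p]

lemma cutoffCov_eq_cosKernel (hm : 0 < m) (hΛ : 0 < Λ) :
    cutoffCov d m Λ = cosKernel (spectralWeight d m Λ) := by
  ext x
  have hint : Integrable fun p : Space d => ((1 / (2 * Real.pi) ^ d : ℝ) : ℂ) *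
    Complex.exp (Complex.I * ((inner ℝ p x : ℝ) : ℂ)) *
    ((Real.exp (-(‖p‖ ^ 2 + m ^ 2) / Λ ^ 2) / (‖p‖ ^ 2 + m ^ 2) : ℝ) : ℂ) := by
    refine ((integrable_spectralWeight (d := d) hm hΛ).ofReal (𝕜 := ℂ)).mul_bdd (c := 1)
      (g := fun p : Space d => Complex.exp (Complex.I * ((inner ℝ p x : ℝ) : ℂ))) (by fun_prop)
      (.of_forall fun p => ?_) |>.congr (.of_forall fun p => ?_)
    · rw [mul_comm, Complex.norm_exp_ofReal_mul_I]
    · simp only [spectralWeight]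
      push_cast
      simp
      ring
  unfold cutoffCov cosKernel
  refine (integral_re hint).symm.trans (integral_congr_ae (.of_forall fun p => ?_))
  simp only [RCLike.re_eq_complex_re, Complex.re_mul_ofReal, Complex.re_ofReal_mul]
  rw [mul_comm Complex.I, Complex.exp_ofReal_mul_I_re, spectralWeight]
  ring

lemma isCovKernel_cutoffCov (hm : 0 < m) (hΛ : 0 < Λ) : IsCovKernel (cutoffCov d m Λ) := by
  rw [cutoffCov_eq_cosKernel hm hΛ]
  exact isCovKernel_cosKernel (integrable_spectralWeight hm hΛ)
    fun p => (spectralWeight_pos hm p).le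

lemma cutoffCov_zero_pos (hm : 0 < m) (hΛ : 0 < Λ) : 0 < cutoffCov d m Λ 0 := by
  rw [cutoffCov_eq_cosKernel hm hΛ, cosKernel_zero]
  refine (integral_pos_iff_support_of_nonneg (fun p => (spectralWeight_pos hm p).le)
    (integrable_spectralWeight hm hΛ)).2 ?_
  have : Function.support (spectralWeight d m Λ) = Set.univ :=
    Set.eq_univ_of_forall fun p => (spectralWeight_pos hm p).ne'
  rw [this]
  exact isOpen_univ.measure_pos volume Set.univ_nonempty

lemma applyCov_const_mul (c : ℝ) (K : Space d → ℝ) (f : TestFn d) (x : Space d) :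
    applyCov (fun z => c * K z) f x = c * applyCov K f x := by
  simp only [applyCov, mul_assoc, integral_const_mul]

lemma IsCovKernel.const_mul {K : Space d → ℝ} (hK : IsCovKernel K) {c : ℝ} (hc : 0 ≤ c) :
    IsCovKernel fun x => c * K x where
  continuous := hK.continuous.const_mul c
  even x := by rw [hK.even]
  abs_le x := by
    rw [abs_mul, abs_of_nonneg hc]
    exact mul_le_mul_of_nonneg_left (hK.abs_le x) hc
  covForm_nonneg f := by
    have : covForm (fun x => c * K x) f = c * covForm K f := by
      simp only [covForm, applyCov_const_mul, ← integral_const_mul]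
      congr with x
      ring
    rw [this]
    exact mul_nonneg hc (hK.covForm_nonneg f)

lemma isCovKernel_renormCov (hm : 0 < m) (hΛ : 0 < Λ) (η : ℝ) :
    IsCovKernel (renormCov d m η Λ) :=
  (isCovKernel_cutoffCov hm hΛ).const_mul (Real.rpow_nonneg (cutoffCov_zero_pos hm hΛ).le η)

end Weight

/-! ### Heat kernel representation of the covariances -/

/-- The massive heat kernel, the inverse Fourier transform of `exp (-s (p² + m²))`. -/
noncomputable def heatKernel (d : ℕ) (m s : ℝ) (x : Space d) : ℝ :=
  1 / (2 * Real.pi) ^ d * (Real.exp (-m ^ 2 * s) *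
    ((Real.pi / s) ^ ((d : ℝ) / 2) * Real.exp (-(1 / (4 * s)) * ‖x‖ ^ 2)))

/-- The integral of the heat kernel over all times. -/
noncomputable def heatCov (d : ℕ) (m : ℝ) (x : Space d) : ℝ :=
  ∫ s in Set.Ioi (0 : ℝ), heatKernel d m s x

section Heat

variable {d : ℕ} {m Λ : ℝ}

lemma integral_gaussian_mul_cos {b : ℝ} (hb : 0 < b) (x : Space d) :
    ∫ p : Space d, Real.exp (-b * ‖p‖ ^ 2) * Real.cos (inner ℝ p x) =
      (Real.pi / b) ^ ((d : ℝ) / 2) * Real.exp (-(1 / (4 * b)) * ‖x‖ ^ 2) := by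
  have hint := GaussianFourier.integrable_cexp_neg_mul_sq_norm_add (V := Space d)
    (b := (b : ℂ)) (by simpa using hb) Complex.I x
  have h := GaussianFourier.integral_cexp_neg_mul_sq_norm_add (V := Space d)
    (b := (b : ℂ)) (by simpa using hb) Complex.I x
  have h1 := (integral_re hint).trans (congrArg RCLike.re h)
  have h2 : ((Real.pi : ℂ) / b) ^ ((Module.finrank ℝ (Space d) : ℂ) / 2) *
      Complex.exp (Complex.I ^ 2 * (‖x‖ : ℂ) ^ 2 / (4 * b)) =
      (((Real.pi / b) ^ ((d : ℝ) / 2) * Real.exp (-(1 / (4 * b)) * ‖x‖ ^ 2) : ℝ) : ℂ) := by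
    rw [Complex.ofReal_mul, Complex.ofReal_cpow (by positivity), Complex.ofReal_exp,
      Complex.I_sq]
    push_cast
    rw [finrank_euclideanSpace_fin]
    congr 2
    ring
  rw [h2] at h1
  refine Eq.trans (integral_congr_ae (.of_forall fun p => ?_)) h1
  simp only [RCLike.re_eq_complex_re]
  rw [show -(b : ℂ) * (‖p‖ : ℂ) ^ 2 + Complex.I * (inner ℝ x p : ℝ) =
    ((-b * ‖p‖ ^ 2 : ℝ) : ℂ) + ((inner ℝ x p : ℝ) : ℂ) * Complex.I by push_cast; ring,
    Complex.exp_add, ← Complex.ofReal_exp, Complex.re_ofReal_mul,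
    Complex.exp_ofReal_mul_I_re, real_inner_comm]

lemma heatKernel_nonneg {s : ℝ} (hs : 0 < s) (x : Space d) : 0 ≤ heatKernel d m s x := by
  unfold heatKernel; positivity

lemma measurable_heatKernel :
    Measurable fun z : Space d × ℝ => heatKernel d m z.2 z.1 := by
  unfold heatKernel
  fun_prop

lemma integral_exp_mul_Ioi_eq {b a : ℝ} (hb : 0 < b) :
    ∫ s in Set.Ioi a, Real.exp (-b * s) = Real.exp (-b * a) / b := by
  rw [integral_exp_mul_Ioi (by linarith)]
  rw [neg_div_neg_eq]

/-- The regularized propagator e^{-aE}/E with E = p² + m² is the integral of e^{-sE} over s > a,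
here with a = 1/Λ². The cutoff thus becomes a lower limit of integration for a positive integrand,
and dependence on Λ becomes monotone. -/
lemma cutoffCov_eq_integral_heatKernel (hm : 0 < m) (hΛ : 0 < Λ) (x : Space d) :
    cutoffCov d m Λ x = ∫ s in Set.Ioi (1 / Λ ^ 2), heatKernel d m s x := by
  set a := 1 / Λ ^ 2 with ha
  have ha0 : 0 < a := by positivity
  set c := 1 / (2 * Real.pi) ^ d with hc
  have hint : Integrable (Function.uncurry fun (p : Space d) (s : ℝ) =>
      c * Real.exp (-(‖p‖ ^ 2 + m ^ 2) * s) * Real.cos (inner ℝ p x))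
      (volume.prod (volume.restrict (Set.Ioi a))) := by
    have h1 : Integrable (fun p : Space d => c * Real.exp (-a * ‖p‖ ^ 2)) :=
      (integrable_exp_neg_mul_norm_sq ha0).const_mul c
    have h2 : Integrable (fun s : ℝ => Real.exp (-m ^ 2 * s)) (volume.restrict (Set.Ioi a)) :=
      exp_neg_integrableOn_Ioi a (by positivity)
    refine (h1.mul_prod h2).mono' (Measurable.aestronglyMeasurable ?_) ?_
    · unfold Function.uncurry
      fun_prop
    · have hs : ∀ᵐ z : Space d × ℝ ∂(volume.prod (volume.restrict (Set.Ioi a))), a < z.2 :=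
        Measure.quasiMeasurePreserving_snd.ae (ae_restrict_mem measurableSet_Ioi)
      filter_upwards [hs] with z hz
      simp only [Function.uncurry, norm_mul, Real.norm_eq_abs, Real.abs_exp]
      rw [abs_of_nonneg (by positivity : 0 ≤ c), mul_assoc c, mul_assoc c]
      refine mul_le_mul_of_nonneg_left ?_ (by positivity)
      refine (mul_le_of_le_one_right (Real.exp_nonneg _) (Real.abs_cos_le_one _)).trans ?_
      rw [← Real.exp_add, Real.exp_le_exp]
      nlinarith [sq_nonneg ‖z.1‖]
  rw [cutoffCov_eq_cosKernel hm hΛ, cosKernel]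
  calc ∫ p, spectralWeight d m Λ p * Real.cos (inner ℝ p x)
      = ∫ p : Space d, ∫ s in Set.Ioi a,
          c * Real.exp (-(‖p‖ ^ 2 + m ^ 2) * s) * Real.cos (inner ℝ p x) := by
        refine integral_congr_ae (.of_forall fun p => ?_)
        simp only
        rw [integral_mul_const, integral_const_mul, integral_exp_mul_Ioi_eq (by positivity),
          spectralWeight, ha, hc]
        ring_nf
    _ = ∫ s in Set.Ioi a, ∫ p : Space d,
          c * Real.exp (-(‖p‖ ^ 2 + m ^ 2) * s) * Real.cos (inner ℝ p x) :=
        integral_integral_swap hint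
    _ = _ := by
        refine setIntegral_congr_fun measurableSet_Ioi fun s hs => ?_
        have hs0 : 0 < s := ha0.trans hs
        rw [heatKernel, ← integral_gaussian_mul_cos hs0, ← integral_const_mul,
          ← integral_const_mul]
        refine integral_congr_ae (.of_forall fun p => ?_)
        simp only
        rw [show -(‖p‖ ^ 2 + m ^ 2) * s = -m ^ 2 * s + -s * ‖p‖ ^ 2 by ring, Real.exp_add]
        ring

lemma integral_heatKernel {s : ℝ} (hs : 0 < s) :
    ∫ x, heatKernel d m s x =
      1 / (2 * Real.pi) ^ d * (4 * Real.pi ^ 2) ^ ((d : ℝ) / 2) * Real.exp (-m ^ 2 * s) := by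
  unfold heatKernel
  rw [integral_const_mul, integral_const_mul, integral_const_mul,
    GaussianFourier.integral_rexp_neg_mul_sq_norm (by positivity), finrank_euclideanSpace_fin,
    ← Real.mul_rpow (by positivity) (by positivity)]
  rw [show Real.pi / s * (Real.pi / (1 / (4 * s))) = 4 * Real.pi ^ 2 by field_simp]
  ring

/-- By Tonelli, integrating over x first leaves a constant times e^{-m²s}. Finiteness of C almost
everywhere follows at once, so no pointwise estimate of the heat integral near the origin is needed.
-/
lemma integrable_uncurry_heatKernel (hm : 0 < m) :
    Integrable (fun z : Space d × ℝ => heatKernel d m z.2 z.1)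
      (volume.prod (volume.restrict (Set.Ioi 0))) := by
  rw [integrable_prod_iff' measurable_heatKernel.aestronglyMeasurable]
  constructor
  · filter_upwards [ae_restrict_mem measurableSet_Ioi] with s hs
    have hs : 0 < s := hs
    exact ((((integrable_exp_neg_mul_norm_sq (by positivity)).const_mul _).const_mul _).const_mul _)
  · have h2 : Integrable (fun s : ℝ => Real.exp (-m ^ 2 * s)) (volume.restrict (Set.Ioi 0)) :=
      exp_neg_integrableOn_Ioi 0 (by positivity)
    refine (h2.const_mul
      (1 / (2 * Real.pi) ^ d * (4 * Real.pi ^ 2) ^ ((d : ℝ) / 2))).congr ?_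
    filter_upwards [ae_restrict_mem measurableSet_Ioi] with s hs
    rw [← integral_heatKernel hs]
    refine integral_congr_ae (.of_forall fun x => ?_)
    simp only
    rw [Real.norm_of_nonneg (heatKernel_nonneg hs x)]

lemma integrable_heatCov (hm : 0 < m) : Integrable (heatCov d m) :=
  (integrable_uncurry_heatKernel hm).integral_prod_left

lemma ae_integrableOn_heatKernel (hm : 0 < m) :
    ∀ᵐ x : Space d, IntegrableOn (fun s => heatKernel d m s x) (Set.Ioi 0) :=
  (integrable_uncurry_heatKernel hm).prod_right_ae

lemma cutoffCov_nonneg (hm : 0 < m) (hΛ : 0 < Λ) (x : Space d) : 0 ≤ cutoffCov d m Λ x := by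
  rw [cutoffCov_eq_integral_heatKernel hm hΛ]
  exact setIntegral_nonneg measurableSet_Ioi fun s hs =>
    heatKernel_nonneg (lt_trans (by positivity) hs) x

/-- The heat kernel is positive, so lowering the limit of integration to 0 can only increase the
integral. This is the integrable majorant for removing the cutoff in ⟨δ_x, C_Λ J⟩. -/
lemma cutoffCov_le_heatCov (hm : 0 < m) (hΛ : 0 < Λ) {x : Space d}
    (hx : IntegrableOn (fun s => heatKernel d m s x) (Set.Ioi 0)) :
    cutoffCov d m Λ x ≤ heatCov d m x := by
  rw [cutoffCov_eq_integral_heatKernel hm hΛ, heatCov]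
  refine setIntegral_mono_set hx ?_ (Set.Ioi_subset_Ioi (by positivity)).eventuallyLE
  filter_upwards [ae_restrict_mem measurableSet_Ioi] with s hs
  exact heatKernel_nonneg hs x

lemma tendsto_cutoffCov_heatCov (hm : 0 < m) {x : Space d}
    (hx : IntegrableOn (fun s => heatKernel d m s x) (Set.Ioi 0)) :
    Tendsto (fun Λ => cutoffCov d m Λ x) atTop (𝓝 (heatCov d m x)) := by
  have h0 : Tendsto (fun Λ : ℝ => 1 / Λ ^ 2) atTop (𝓝 0) := by
    simp only [one_div]
    exact (tendsto_pow_atTop (α := ℝ) two_ne_zero).inv_tendsto_atTop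
  have key : Tendsto (fun Λ : ℝ => ∫ s in Set.Ioi (0 : ℝ),
      (Set.Ioi (1 / Λ ^ 2)).indicator (fun s => heatKernel d m s x) s) atTop
      (𝓝 (heatCov d m x)) := by
    refine tendsto_integral_filter_of_dominated_convergence (fun s => ‖heatKernel d m s x‖)
      (.of_forall fun Λ => hx.aestronglyMeasurable.indicator measurableSet_Ioi)
      (.of_forall fun Λ => .of_forall fun s => norm_indicator_le_norm_self _ _) hx.norm ?_
    filter_upwards [ae_restrict_mem measurableSet_Ioi] with s hs
    refine tendsto_const_nhds.congr' ?_
    filter_upwards [h0.eventually_lt_const hs] with Λ hΛ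
    rw [Set.indicator_of_mem (Set.mem_Ioi.2 hΛ)]
  refine key.congr' ?_
  filter_upwards [eventually_gt_atTop 0] with Λ hΛ
  rw [integral_indicator measurableSet_Ioi, Measure.restrict_restrict measurableSet_Ioi,
    cutoffCov_eq_integral_heatKernel hm hΛ,
    Set.inter_eq_left.2 (Set.Ioi_subset_Ioi (by positivity))]

lemma freeCov_eq_heatCov (hm : 0 < m) {x : Space d}
    (hx : IntegrableOn (fun s => heatKernel d m s x) (Set.Ioi 0)) :
    freeCov d m x = heatCov d m x :=
  (tendsto_cutoffCov_heatCov hm hx).limUnder_eq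

lemma ae_integrableOn_heatKernel_sub (hm : 0 < m) (x : Space d) :
    ∀ᵐ y : Space d, IntegrableOn (fun s => heatKernel d m s (x - y)) (Set.Ioi 0) :=
  (Measure.measurePreserving_sub_left volume x).quasiMeasurePreserving.ae
    (ae_integrableOn_heatKernel hm)

lemma tendsto_applyCov_cutoffCov (hm : 0 < m) (J : TestFn d) (x : Space d) :
    Tendsto (fun Λ => applyCov (cutoffCov d m Λ) J x) atTop (𝓝 (applyCov (freeCov d m) J x)) := by
  set M := SchwartzMap.seminorm ℝ 0 0 J
  refine tendsto_integral_filter_of_dominated_convergence (fun y => heatCov d m (x - y) * M)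
    ?_ ?_ (((integrable_heatCov hm).comp_sub_left x).mul_const _) ?_
  · filter_upwards [eventually_gt_atTop 0] with Λ hΛ
    exact (((isCovKernel_cutoffCov hm hΛ).continuous.comp
      (continuous_const.sub continuous_id)).mul J.continuous).aestronglyMeasurable
  · filter_upwards [eventually_gt_atTop 0] with Λ hΛ
    filter_upwards [ae_integrableOn_heatKernel_sub hm x] with y hy
    rw [norm_mul, Real.norm_of_nonneg (cutoffCov_nonneg hm hΛ _)]
    exact mul_le_mul (cutoffCov_le_heatCov hm hΛ hy) (SchwartzMap.norm_le_seminorm ℝ J y)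
      (norm_nonneg _) ((cutoffCov_nonneg hm hΛ _).trans (cutoffCov_le_heatCov hm hΛ hy))
  · filter_upwards [ae_integrableOn_heatKernel_sub hm x] with y hy
    rw [freeCov_eq_heatCov hm hy]
    exact (tendsto_cutoffCov_heatCov hm hy).mul_const _

/-- At the origin the heat kernel behaves like s^(-d/2), which for d ≥ 2 dominates 1/s on (0,1].
Thus C_Λ(0) grows at least like a positive multiple of log Λ². -/
lemma tendsto_cutoffCov_zero_atTop (hd : 2 ≤ d) (hm : 0 < m) :
    Tendsto (fun Λ => cutoffCov d m Λ 0) atTop atTop := by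
  set c := 1 / (2 * Real.pi) ^ d * Real.exp (-m ^ 2) with hc
  have hc0 : 0 < c := by positivity
  have hlog : Tendsto (fun Λ : ℝ => c * Real.log (Λ ^ 2)) atTop atTop :=
    (Real.tendsto_log_atTop.comp (tendsto_pow_atTop two_ne_zero)).const_mul_atTop hc0
  refine tendsto_atTop_mono' _ ?_ hlog
  filter_upwards [eventually_ge_atTop 1] with Λ hΛ
  have hΛ0 : 0 < Λ := by linarith
  have ha0 : 0 < 1 / Λ ^ 2 := by positivity
  have ha1 : 1 / Λ ^ 2 ≤ 1 := by
    rw [div_le_one (by positivity)]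
    exact one_le_pow₀ hΛ
  -- A nonintegrable function would have integral 0 by convention, contradicting
  -- `cutoffCov_zero_pos`.
  have hI : IntegrableOn (fun s => heatKernel d m s (0 : Space d)) (Set.Ioi (1 / Λ ^ 2)) := by
    by_contra h
    have := cutoffCov_eq_integral_heatKernel (d := d) hm hΛ0 0
    rw [integral_undef h] at this
    exact (cutoffCov_zero_pos hm hΛ0).ne' this
  have h1 : c * Real.log (Λ ^ 2) = ∫ s in Set.Ioc (1 / Λ ^ 2) 1, c * (1 / s) := by
    rw [integral_const_mul, ← intervalIntegral.integral_of_le ha1,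
      integral_one_div_of_pos ha0 one_pos]
    simp
  rw [h1, cutoffCov_eq_integral_heatKernel hm hΛ0]
  refine le_trans (setIntegral_mono_on ?_ (hI.mono_set Set.Ioc_subset_Ioi_self)
    measurableSet_Ioc ?_) (setIntegral_mono_set hI ?_ Set.Ioc_subset_Ioi_self.eventuallyLE)
  · refine Integrable.const_mul ?_ c
    have := (intervalIntegral.intervalIntegrable_one_div (μ := volume) (a := 1 / Λ ^ 2) (b := 1)
      (f := id) (fun x hx => ?_) continuousOn_id).1
    · exact this
    · rw [Set.uIcc_of_le ha1] at hx
      exact (ha0.trans_le hx.1).ne'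
  · intro s hs
    have hs0 : 0 < s := ha0.trans hs.1
    unfold heatKernel
    rw [hc, mul_assoc]
    refine mul_le_mul_of_nonneg_left ?_ (by positivity)
    refine mul_le_mul ?_ ?_ (by positivity) (by positivity)
    · rw [Real.exp_le_exp]
      nlinarith [hs.2, sq_nonneg m]
    · simp only [norm_zero, ne_eq, OfNat.ofNat_ne_zero, not_false_eq_true, zero_pow, mul_zero,
        Real.exp_zero, mul_one]
      -- With a base at least 1 and an exponent d/2 at least 1, the power dominates π/s, hence 1/s.
      have h1 : 1 ≤ Real.pi / s := by
        rw [one_le_div hs0]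
        linarith [hs.2, Real.pi_gt_three]
      calc 1 / s ≤ Real.pi / s := by
            gcongr
            linarith [Real.pi_gt_three]
        _ = (Real.pi / s) ^ (1 : ℝ) := (Real.rpow_one _).symm
        _ ≤ _ := by
            refine Real.rpow_le_rpow_of_exponent_le h1 ?_
            rw [le_div_iff₀ two_pos]
            exact_mod_cast (by omega : 1 * 2 ≤ d)
  · filter_upwards [ae_restrict_mem measurableSet_Ioi] with s hs
    exact heatKernel_nonneg (ha0.trans hs) 0

end Heat

/-! ### Gaussian laws on the line and in the plane -/

section Gaussian

open ProbabilityTheory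

/-- The densities converge pointwise under a common Gaussian bound, hence in L¹. The integrands may
vary with the index and need only be measurable and uniformly bounded, which weak convergence would
not allow. -/
lemma tendsto_integral_gaussianReal_sub {ι : Type*} {l : Filter ι} [l.IsCountablyGenerated]
    {μ : ι → ℝ} {v : ι → ℝ≥0} {F : ι → ℝ → ℝ} {M : ℝ} (hμ : Tendsto μ l (𝓝 0))
    (hv : Tendsto v l (𝓝 1)) (hF : ∀ i, Measurable (F i)) (hM : ∀ i w, |F i w| ≤ M) :
    Tendsto (fun i => ∫ w, F i w ∂gaussianReal (μ i) (v i) - ∫ w, F i w ∂gaussianReal 0 1) l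
      (𝓝 0) := by
  have hv' : Tendsto (fun i => (v i : ℝ)) l (𝓝 1) := (NNReal.tendsto_coe (x := 1)).2 hv
  have hv1 : ∀ᶠ i in l, (1 / 2 : ℝ) < v i := hv'.eventually_const_lt (by norm_num)
  have hv2 : ∀ᶠ i in l, (v i : ℝ) < 2 := hv'.eventually_lt_const (by norm_num)
  have hμ1 : ∀ᶠ i in l, |μ i| < 1 := by
    have := hμ.abs
    rw [abs_zero] at this
    exact this.eventually_lt_const one_pos
  -- For 1/2 < v < 2 and |μ| < 1 the normalizing factor is at most 1. The exponent satisfies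
  -- (w-μ)²/(2v) ≥ (w-μ)²/4 ≥ w²/8 - μ²/4, the last step being (w-2μ)² ≥ 0.
  have hpdf : ∀ᶠ i in l, ∀ w, gaussianPDFReal (μ i) (v i) w ≤
      Real.exp (1 / 4) * Real.exp (-(1 / 8) * w ^ 2) := by
    filter_upwards [hv1, hv2, hμ1] with i h1 h2 h3 w
    have h0 : (0 : ℝ) < v i := by linarith
    rw [gaussianPDFReal, ← Real.exp_add]
    refine (mul_le_of_le_one_left (Real.exp_nonneg _) ?_).trans (Real.exp_le_exp.2 ?_)
    · refine inv_le_one_of_one_le₀ ?_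
      rw [Real.one_le_sqrt]
      nlinarith [Real.pi_gt_three]
    · rw [neg_div, neg_le, ← sub_nonneg]
      have h4 : (w - μ i) ^ 2 / 4 ≤ (w - μ i) ^ 2 / (2 * v i) := by
        gcongr
        linarith
      have h5 : μ i ^ 2 ≤ 1 := by
        rw [← sq_abs]
        nlinarith [abs_nonneg (μ i)]
      nlinarith [sq_nonneg (w - 2 * μ i)]
  have hpdf0 : ∀ w, gaussianPDFReal 0 1 w ≤ Real.exp (1 / 4) * Real.exp (-(1 / 8) * w ^ 2) := by
    intro w
    rw [gaussianPDFReal, ← Real.exp_add]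
    refine (mul_le_of_le_one_left (Real.exp_nonneg _) ?_).trans (Real.exp_le_exp.2 ?_)
    · refine inv_le_one_of_one_le₀ ?_
      rw [Real.one_le_sqrt]
      push_cast
      nlinarith [Real.pi_gt_three]
    · push_cast
      nlinarith [sq_nonneg w]
  have hbound : Integrable fun w : ℝ =>
      2 * (Real.exp (1 / 4) * Real.exp (-(1 / 8) * w ^ 2)) * M :=
    (((integrable_exp_neg_mul_sq (by norm_num)).const_mul _).const_mul _).mul_const _
  have key : Tendsto (fun i => ∫ w, (gaussianPDFReal (μ i) (v i) w - gaussianPDFReal 0 1 w) *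
      F i w) l (𝓝 (∫ _ : ℝ, (0 : ℝ))) := by
    refine tendsto_integral_filter_of_dominated_convergence _ (.of_forall fun i => ?_) ?_ hbound
      (.of_forall fun w => ?_)
    · exact (((measurable_gaussianPDFReal _ _).sub (measurable_gaussianPDFReal _ _)).mul
        (hF i)).aestronglyMeasurable
    · filter_upwards [hpdf] with i hi
      refine .of_forall fun w => ?_
      rw [norm_mul]
      refine mul_le_mul ?_ (hM i w) (norm_nonneg _) (by positivity)
      refine (norm_sub_le _ _).trans ?_
      rw [Real.norm_of_nonneg (gaussianPDFReal_nonneg _ _ _),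
        Real.norm_of_nonneg (gaussianPDFReal_nonneg _ _ _), two_mul]
      exact add_le_add (hi w) (hpdf0 w)
    · have h1 : Tendsto (fun i => gaussianPDFReal (μ i) (v i) w) l
          (𝓝 (gaussianPDFReal 0 1 w)) := by
        unfold gaussianPDFReal
        refine Tendsto.mul (Tendsto.inv₀ ?_ (by positivity)) ?_
        · exact ((tendsto_const_nhds.mul hv').sqrt)
        · refine (Real.continuous_exp.tendsto _).comp ?_
          refine Tendsto.div ?_ (tendsto_const_nhds.mul hv') (by norm_num)
          exact ((tendsto_const_nhds.sub hμ).pow 2).neg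
      have h2 : Tendsto (fun i => gaussianPDFReal (μ i) (v i) w - gaussianPDFReal 0 1 w) l
          (𝓝 0) := by
        simpa using h1.sub_const (gaussianPDFReal 0 1 w)
      refine squeeze_zero_norm (a := fun i =>
        |gaussianPDFReal (μ i) (v i) w - gaussianPDFReal 0 1 w| * M) (fun i => ?_) ?_
      · rw [norm_mul]
        exact mul_le_mul_of_nonneg_left (hM i w) (norm_nonneg _)
      · simpa using h2.abs.mul_const M
  rw [integral_zero] at key
  refine key.congr' ?_
  filter_upwards [hv1] with i h1
  have h0 : v i ≠ 0 := by
    rintro h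
    rw [h] at h1
    norm_num at h1
  have hb : ∀ a (b : ℝ≥0), b ≠ 0 → Integrable fun w => gaussianPDFReal a b w * F i w := fun a b _ =>
    (integrable_gaussianPDFReal a b).mul_bdd (c := M) (hF i).aestronglyMeasurable
      (.of_forall (hM i))
  rw [integral_gaussianReal_eq_integral_smul h0, integral_gaussianReal_eq_integral_smul one_ne_zero]
  simp only [smul_eq_mul]
  rw [← integral_sub (hb _ _ h0) (hb _ _ one_ne_zero)]
  simp only [sub_mul]

lemma abs_integral_le_of_abs_le {Ω : Type*} [MeasurableSpace Ω] {P : Measure Ω}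
    [IsProbabilityMeasure P] {F : Ω → ℝ} {M : ℝ} (hM : ∀ w, |F w| ≤ M) :
    |∫ w, F w ∂P| ≤ M := by
  have := norm_integral_le_of_norm_le_const (μ := P) (f := F) (C := M) (.of_forall hM)
  simpa using this

lemma integral_gaussianReal_affine (a b : ℝ) {F : ℝ → ℝ} (hF : Measurable F) :
    ∫ w, F (a + b * w) ∂gaussianReal 0 1 = ∫ w, F w ∂gaussianReal a (b ^ 2).toNNReal := by
  have h : (gaussianReal 0 1).map (fun w => a + b * w) = gaussianReal a (b ^ 2).toNNReal := by
    have := gaussianReal_map_const_mul (μ := 0) (v := 1) b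
    have h2 := gaussianReal_map_const_add (μ := b * 0) (v := NNReal.mk (b ^ 2) (sq_nonneg b) * 1) a
    rw [← this, Measure.map_map (by fun_prop) (by fun_prop)] at h2
    rw [mul_zero, zero_add, mul_one] at h2
    rw [Real.toNNReal_of_nonneg (sq_nonneg b)]
    exact h2
  rw [← h, integral_map (by fun_prop) hF.aestronglyMeasurable]

/-- Asymptotic independence of a normal pair whose correlation r tends to 0. Only the difference of
the two sides converges in general, since F and G may change with the index. -/
lemma tendsto_integral_gaussianReal_pair_sub {ι : Type*} {l : Filter ι} [l.IsCountablyGenerated]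
    {r : ι → ℝ} {F G : ι → ℝ → ℝ} {M : ℝ} (hr : Tendsto r l (𝓝 0))
    (hF : ∀ i, Measurable (F i)) (hFM : ∀ i w, |F i w| ≤ M)
    (hG : ∀ i, Measurable (G i)) (hGM : ∀ i w, |G i w| ≤ M) :
    Tendsto (fun i => ∫ g, ∫ g', F i g * G i (r i * g + √(1 - r i ^ 2) * g') ∂gaussianReal 0 1
      ∂gaussianReal 0 1 -
      (∫ w, F i w ∂gaussianReal 0 1) * ∫ w, G i w ∂gaussianReal 0 1) l (𝓝 0) := by
  set γ := gaussianReal 0 1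
  have hinner : ∀ i, Measurable fun g => ∫ g', G i (r i * g + √(1 - r i ^ 2) * g') ∂γ := by
    intro i
    refine StronglyMeasurable.measurable (StronglyMeasurable.integral_prod_right
      (f := fun g g' => G i (r i * g + √(1 - r i ^ 2) * g')) ?_)
    exact ((hG i).comp (by fun_prop :
      Measurable fun z : ℝ × ℝ => r i * z.1 + √(1 - r i ^ 2) * z.2)).stronglyMeasurable
  have key : Tendsto (fun i => ∫ g, F i g * (∫ g', G i (r i * g + √(1 - r i ^ 2) * g') ∂γ -
      ∫ w, G i w ∂γ) ∂γ) l (𝓝 (∫ _, (0 : ℝ) ∂γ)) := by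
    refine tendsto_integral_filter_of_dominated_convergence (fun _ => M * (M + M))
      (.of_forall fun i => ?_) (.of_forall fun i => .of_forall fun g => ?_) (integrable_const _)
      (.of_forall fun g => ?_)
    · exact ((hF i).mul ((hinner i).sub_const _)).aestronglyMeasurable
    · rw [norm_mul]
      refine mul_le_mul (hFM i g) ?_ (norm_nonneg _) ((abs_nonneg _).trans (hFM i 0))
      exact (norm_sub_le _ _).trans (add_le_add (abs_integral_le_of_abs_le fun w => hGM i _)
        (abs_integral_le_of_abs_le fun w => hGM i _))
    -- Given g, the second variable has mean r g and variance 1 - r², so its law tends to the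
    -- standard normal law.
    · have h1 : Tendsto (fun i => ((√(1 - r i ^ 2)) ^ 2).toNNReal) l (𝓝 1) := by
        have : Tendsto (fun i => (√(1 - r i ^ 2)) ^ 2) l (𝓝 ((√(1 - 0 ^ 2)) ^ 2)) :=
          ((tendsto_const_nhds.sub (hr.pow 2)).sqrt).pow 2
        simpa using tendsto_real_toNNReal this
      have h2 := tendsto_integral_gaussianReal_sub (by simpa using hr.mul_const g) h1 hG hGM
      have h3 : Tendsto (fun i => ∫ g', G i (r i * g + √(1 - r i ^ 2) * g') ∂γ -
          ∫ w, G i w ∂γ) l (𝓝 0) := by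
        refine h2.congr fun i => ?_
        rw [integral_gaussianReal_affine _ _ (hG i)]
      refine squeeze_zero_norm (a := fun i => M * |∫ g', G i (r i * g + √(1 - r i ^ 2) * g') ∂γ -
          ∫ w, G i w ∂γ|) (fun i => ?_) (by simpa using h3.abs.const_mul M)
      rw [norm_mul]
      exact mul_le_mul_of_nonneg_right (hFM i g) (norm_nonneg _)
  rw [integral_zero] at key
  refine key.congr fun i => ?_
  have hFi : Integrable (F i) γ := .of_bound (hF i).aestronglyMeasurable M (.of_forall (hFM i))
  rw [← integral_mul_const, ← integral_sub]
  · simp only [integral_const_mul, mul_sub]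
  · simp only [integral_const_mul]
    exact hFi.mul_bdd (c := M) (hinner i).aestronglyMeasurable
      (.of_forall fun g => abs_integral_le_of_abs_le fun w => hGM i _)
  · exact hFi.mul_const _

/-- A random variable with the moment generating function of a normal variable is normal. -/
lemma map_eq_gaussianReal_of_mgf {Ω : Type*} [MeasurableSpace Ω] {P : Measure Ω}
    [IsProbabilityMeasure P] {Y : Ω → ℝ} (hY : AEMeasurable Y P) {c : ℝ} {v : ℝ≥0}
    (h : ∀ t, mgf Y P t = Real.exp (c * t + v * t ^ 2 / 2)) :
    P.map Y = gaussianReal c v := by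
  have hmgf : mgf Y P = mgf id (gaussianReal c v) := by
    rw [mgf_id_gaussianReal]
    exact funext h
  have hset : integrableExpSet Y P = Set.univ := by
    refine Set.eq_univ_of_forall fun t => ?_
    -- Where the exponential is not integrable, `mgf` is 0 by convention, whereas the prescribed
    -- value is positive.
    by_contra hn
    have := mgf_undef hn
    rw [h] at this
    exact (Real.exp_pos _).ne' this
  have h2 : complexMGF Y P = complexMGF id (gaussianReal c v) := by
    funext z
    refine eqOn_complexMGF_of_mgf hmgf ?_
    simp [hset]
  have h3 := Measure.ext_of_complexMGF_eq hY aemeasurable_id h2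
  rwa [Measure.map_id] at h3

lemma mgf_eq_of_map_eq {Ω : Type*} [MeasurableSpace Ω] {P : Measure Ω} {T : Ω → ℝ} {q : ℝ}
    (hq : 0 ≤ q) (hT : P.map T = gaussianReal 0 q.toNNReal) :
    ∫ ω, Real.exp (T ω) ∂P = Real.exp (q / 2) := by
  have := mgf_gaussianReal hT 1
  simpa [mgf, hq] using this

lemma integrable_exp_of_map_eq {Ω : Type*} [MeasurableSpace Ω] {P : Measure Ω} {T : Ω → ℝ}
    {v : ℝ≥0} (hT : P.map T = gaussianReal 0 v) : Integrable (fun ω => Real.exp (T ω)) P := by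
  have hTm : AEMeasurable T P := aemeasurable_of_map_neZero (by rw [hT]; infer_instance)
  have h := integrable_exp_mul_gaussianReal (μ := 0) (v := v) 1
  rw [← hT, integrable_map_measure (by fun_prop) hTm] at h
  simpa [Function.comp_def] using h

/-- Exponential tilting shifts the mean of a jointly Gaussian variable by the covariance. -/
lemma map_tilted_eq_gaussianReal {Ω : Type*} [MeasurableSpace Ω] {P : Measure Ω}
    [IsProbabilityMeasure P] {T Y : Ω → ℝ} (hY : Measurable Y) {qT c qY : ℝ}
    (hq : ∀ t, 0 ≤ qT + 2 * t * c + t ^ 2 * qY) (hqY : 0 ≤ qY)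
    (h : ∀ t, P.map (fun ω => T ω + t * Y ω) =
      gaussianReal 0 (qT + 2 * t * c + t ^ 2 * qY).toNNReal) :
    (P.tilted T).map Y = gaussianReal c qY.toNNReal := by
  have hT : P.map T = gaussianReal 0 qT.toNNReal := by simpa using h 0
  have hqT : 0 ≤ qT := by simpa using hq 0
  have hTi := integrable_exp_of_map_eq hT
  have := isProbabilityMeasure_tilted hTi
  refine map_eq_gaussianReal_of_mgf hY.aemeasurable fun t => ?_
  rw [mgf, integral_tilted, mgf_eq_of_map_eq hqT hT]
  have h1 := mgf_eq_of_map_eq (hq t) (h t)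
  simp only [smul_eq_mul]
  calc ∫ ω, Real.exp (T ω) / Real.exp (qT / 2) * Real.exp (t * Y ω) ∂P
      = ∫ ω, Real.exp (T ω + t * Y ω) * (Real.exp (qT / 2))⁻¹ ∂P := by
        refine integral_congr_ae (.of_forall fun ω => ?_)
        simp only [Real.exp_add]
        ring
    _ = _ := by
        rw [integral_mul_const, h1, ← Real.exp_neg, ← Real.exp_add, Real.coe_toNNReal _ hqY]
        congr 1
        ring

/-- A pair of variables with Gaussian linear combinations, in terms of two independent standard
normal variables. -/
lemma map_prodMk_eq_of_gaussian_combinations {Ω : Type*} [MeasurableSpace Ω] {P : Measure Ω}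
    [IsProbabilityMeasure P] {X Y : Ω → ℝ} (hX : Measurable X) (hY : Measurable Y)
    {a b σ r : ℝ} (hr : r ^ 2 ≤ 1)
    (h : ∀ s t, P.map (fun ω => s * X ω + t * Y ω) =
      gaussianReal (s * a + t * b) (σ ^ 2 * (s ^ 2 + t ^ 2 + 2 * s * t * r)).toNNReal) :
    P.map (fun ω => (X ω, Y ω)) = ((gaussianReal 0 1).prod (gaussianReal 0 1)).map
      (fun g : ℝ × ℝ => (a + σ * g.1, b + σ * (r * g.1 + √(1 - r ^ 2) * g.2))) := by
  have hm : Measurable fun g : ℝ × ℝ =>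
    (a + σ * g.1, b + σ * (r * g.1 + √(1 - r ^ 2) * g.2)) := by fun_prop
  have i1 : IsProbabilityMeasure (P.map (fun ω => (X ω, Y ω))) :=
    Measure.isProbabilityMeasure_map (hX.prodMk hY).aemeasurable
  have i2 := Measure.isProbabilityMeasure_map (μ := (gaussianReal 0 1).prod (gaussianReal 0 1))
    hm.aemeasurable
  -- The Cramér–Wold device: the characteristic function at a functional L sees only the law of one
  -- linear combination sX + tY.
  refine Measure.ext_of_charFunDual (funext fun L => ?_)
  set s := L (1, 0)
  set t := L (0, 1)
  have hL : ∀ z : ℝ × ℝ, L z = s * z.1 + t * z.2 := by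
    intro z
    have : z = z.1 • ((1 : ℝ), (0 : ℝ)) + z.2 • ((0 : ℝ), (1 : ℝ)) := by ext <;> simp
    conv_lhs => rw [this]
    rw [map_add, map_smul, map_smul, smul_eq_mul, smul_eq_mul, mul_comm s, mul_comm t]
  have hLm : Measurable fun z : ℝ × ℝ => L z := L.continuous.measurable
  have e1 : charFunDual (P.map (fun ω => (X ω, Y ω))) L = Complex.exp
      ((s * a + t * b : ℝ) * Complex.I - (σ ^ 2 * (s ^ 2 + t ^ 2 + 2 * s * t * r) : ℝ) / 2) := by
    rw [charFunDual_eq_charFun_map_one, Measure.map_map hLm (hX.prodMk hY)]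
    have : (⇑L ∘ fun ω => (X ω, Y ω)) = fun ω => s * X ω + t * Y ω := by
      funext ω
      simp [hL]
    have hq : 0 ≤ σ ^ 2 * (s ^ 2 + t ^ 2 + 2 * s * t * r) := by
      refine mul_nonneg (sq_nonneg _) ?_
      nlinarith [sq_nonneg (s + t * r), mul_nonneg (sq_nonneg t) (sub_nonneg.2 hr)]
    rw [this, h, charFun_gaussianReal, Real.coe_toNNReal _ hq]
    simp
  rw [e1, charFunDual_eq_charFun_map_one, Measure.map_map hLm hm, charFun_apply_real,
    integral_map (by fun_prop) (by fun_prop)]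
  have e2 : ∀ u : ℝ, ∫ g : ℝ, Complex.exp ((u * g : ℝ) * Complex.I) ∂gaussianReal 0 1 =
      Complex.exp (-((u ^ 2 : ℝ) : ℂ) / 2) := by
    intro u
    have := charFun_gaussianReal (μ := 0) (v := 1) u
    rw [charFun_apply_real] at this
    push_cast at this ⊢
    rw [this]
    congr 1
    simp
    ring
  calc _ = Complex.exp ((s * a + t * b : ℝ) * Complex.I) *
        (Complex.exp (-(((σ * (s + t * r)) ^ 2 : ℝ) : ℂ) / 2) *
          Complex.exp (-(((σ * (t * √(1 - r ^ 2))) ^ 2 : ℝ) : ℂ) / 2)) := by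
        rw [← Complex.exp_add, ← Complex.exp_add]
        have : √(1 - r ^ 2) ^ 2 = 1 - r ^ 2 := Real.sq_sqrt (by linarith)
        rw [mul_pow, mul_pow, mul_pow, this]
        congr 1
        push_cast
        ring
    _ = ∫ g : ℝ × ℝ, Complex.exp ((s * a + t * b : ℝ) * Complex.I) *
          (Complex.exp ((σ * (s + t * r) * g.1 : ℝ) * Complex.I) *
          Complex.exp ((σ * (t * √(1 - r ^ 2)) * g.2 : ℝ) * Complex.I))
          ∂(gaussianReal 0 1).prod (gaussianReal 0 1) := by
        rw [integral_const_mul, integral_prod_mul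
          (fun g : ℝ => Complex.exp ((σ * (s + t * r) * g : ℝ) * Complex.I))
          (fun g : ℝ => Complex.exp ((σ * (t * √(1 - r ^ 2)) * g : ℝ) * Complex.I)), e2, e2]
    _ = _ := by
        refine integral_congr_ae (.of_forall fun g => ?_)
        simp only [Function.comp_apply, hL]
        rw [← Complex.exp_add, ← Complex.exp_add]
        congr 1
        push_cast
        ring

end Gaussian

/-! ### The covariance as a bilinear form -/

/-- The bilinear form `⟨f, K g⟩`. -/
noncomputable def covBil {d : ℕ} (K : Space d → ℝ) (f g : TestFn d) : ℝ :=
  ∫ x, f x * applyCov K g x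

section Bilinear

variable {d : ℕ} {K : Space d → ℝ}

lemma covBil_self (f : TestFn d) : covBil K f f = covForm K f := rfl

lemma IsCovKernel.integrable_kernel_mul (hK : IsCovKernel K) (f : TestFn d) (x : Space d) :
    Integrable fun y => K (x - y) * f y :=
  f.integrable.bdd_mul (c := K 0)
    (hK.continuous.comp (continuous_const.sub continuous_id)).aestronglyMeasurable
    (.of_forall fun _ => hK.abs_le _)

lemma IsCovKernel.continuous_applyCov (hK : IsCovKernel K) (f : TestFn d) :
    Continuous (applyCov K f) := by
  refine continuous_of_dominated (bound := fun y => K 0 * ‖f y‖) ?_ ?_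
    (f.integrable.norm.const_mul _) ?_
  · exact fun x => (hK.integrable_kernel_mul f x).aestronglyMeasurable
  · refine fun x => .of_forall fun y => ?_
    rw [norm_mul]
    exact mul_le_mul_of_nonneg_right (hK.abs_le _) (norm_nonneg _)
  · exact .of_forall fun y => (hK.continuous.comp (by fun_prop)).mul continuous_const

lemma IsCovKernel.abs_applyCov_le (hK : IsCovKernel K) (f : TestFn d) (x : Space d) :
    |applyCov K f x| ≤ K 0 * ∫ y, ‖f y‖ := by
  rw [← integral_const_mul, ← Real.norm_eq_abs]
  refine norm_integral_le_of_norm_le ((f.integrable (μ := volume)).norm.const_mul _)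
    (.of_forall fun y => ?_)
  rw [norm_mul]
  exact mul_le_mul_of_nonneg_right (hK.abs_le _) (norm_nonneg _)

lemma IsCovKernel.integrable_mul_applyCov (hK : IsCovKernel K) (f g : TestFn d) :
    Integrable fun x => f x * applyCov K g x :=
  f.integrable.mul_bdd (c := K 0 * ∫ y, ‖g y‖) (hK.continuous_applyCov g).aestronglyMeasurable
    (.of_forall fun x => hK.abs_applyCov_le g x)

lemma IsCovKernel.covBil_comm (hK : IsCovKernel K) (f g : TestFn d) :
    covBil K f g = covBil K g f := by
  have hint : Integrable (Function.uncurry fun (x y : Space d) => f x * (K (x - y) * g y))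
      (volume.prod volume) := by
    refine (((f.integrable (μ := volume)).mul_prod (g.integrable (μ := volume))).mul_bdd
      (c := K 0) (g := fun z : Space d × Space d => K (z.1 - z.2))
      (hK.continuous.comp (by fun_prop)).aestronglyMeasurable
      (.of_forall fun z => hK.abs_le _)).congr (.of_forall fun z => ?_)
    simp only [Function.uncurry]
    ring
  calc covBil K f g = ∫ x, ∫ y, f x * (K (x - y) * g y) := by
        simp only [covBil, applyCov, integral_const_mul]
    _ = ∫ y, ∫ x, f x * (K (x - y) * g y) := integral_integral_swap hint
    _ = covBil K g f := by
        simp only [covBil, applyCov, ← integral_const_mul]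
        congr with y
        congr with x
        rw [← hK.even (x - y), neg_sub]
        ring

lemma IsCovKernel.covBil_add_left (hK : IsCovKernel K) (f g h : TestFn d) :
    covBil K (f + g) h = covBil K f h + covBil K g h := by
  rw [covBil, covBil, covBil,
    ← integral_add (hK.integrable_mul_applyCov f h) (hK.integrable_mul_applyCov g h)]
  simp only [_root_.add_apply, add_mul]

lemma covBil_smul_left (c : ℝ) (f h : TestFn d) : covBil K (c • f) h = c * covBil K f h := by
  rw [covBil, covBil, ← integral_const_mul]
  congr with y
  simp only [_root_.smul_apply, smul_eq_mul]
  ring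

/-- The variance of φ(f) + a φ(g) + b φ(h). With g and h mollifiers at x and y, it tends to
`pointVar`. -/
lemma IsCovKernel.covForm_combination (hK : IsCovKernel K) (f g h : TestFn d) (a b : ℝ) :
    covForm K (f + a • g + b • h) = covForm K f + 2 * a * covBil K g f + 2 * b * covBil K h f +
      a ^ 2 * covForm K g + b ^ 2 * covForm K h + 2 * a * b * covBil K g h := by
  have add_right : ∀ f g h : TestFn d, covBil K h (f + g) = covBil K h f + covBil K h g := by
    intro f g h
    rw [hK.covBil_comm, hK.covBil_add_left, hK.covBil_comm f, hK.covBil_comm g]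
  have smul_right : ∀ (c : ℝ) (f h : TestFn d), covBil K h (c • f) = c * covBil K h f := by
    intro c f h
    rw [hK.covBil_comm, covBil_smul_left, hK.covBil_comm f]
  simp only [← covBil_self, hK.covBil_add_left, add_right, covBil_smul_left, smul_right]
  rw [hK.covBil_comm f g, hK.covBil_comm f h, hK.covBil_comm h g]
  ring

end Bilinear

/-! ### Mollifiers -/

/-- `g` is a probability density supported in the ball of radius `ε` around `x`. -/
structure IsMollifier {d : ℕ} (g : TestFn d) (x : Space d) (ε : ℝ) : Prop where
  nonneg : ∀ z, 0 ≤ g z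
  integral_eq_one : ∫ z, g z = 1
  dist_lt : ∀ z, g z ≠ 0 → dist z x < ε

section Mollifier

variable {d : ℕ} {K : Space d → ℝ}

lemma exists_isMollifier (x : Space d) {ε : ℝ} (hε : 0 < ε) :
    ∃ g : TestFn d, IsMollifier g x ε := by
  let b : ContDiffBump x := ⟨ε / 2, ε, by linarith, by linarith⟩
  refine ⟨(b.hasCompactSupport_normed (μ := volume)).toSchwartzMap b.contDiff_normed,
    fun z => b.nonneg_normed z, b.integral_normed, fun z hz => ?_⟩
  have : z ∈ Function.support (b.normed volume) := hz
  rwa [b.support_normed_eq] at this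

lemma IsMollifier.mono {g : TestFn d} {x y : Space d} {ε δ : ℝ} (h : IsMollifier g x ε)
    (hxy : dist x y + ε ≤ δ) : IsMollifier g y δ where
  nonneg := h.nonneg
  integral_eq_one := h.integral_eq_one
  dist_lt z hz := by linarith [dist_triangle z x y, h.dist_lt z hz]

lemma IsMollifier.abs_integral_mul_sub_le {g : TestFn d} {x : Space d} {ε : ℝ}
    (hg : IsMollifier g x ε) {h : Space d → ℝ} (hh : Continuous h) {a δ : ℝ}
    (hδ : ∀ z, dist z x < ε → |h z - a| ≤ δ) : |(∫ z, g z * h z) - a| ≤ δ := by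
  have hb : ∀ z, ‖g z * (h z - a)‖ ≤ δ * g z := by
    intro z
    rw [norm_mul, Real.norm_of_nonneg (hg.nonneg z), mul_comm]
    by_cases hz : g z = 0
    · simp [hz]
    · exact mul_le_mul_of_nonneg_right (hδ z (hg.dist_lt z hz)) (hg.nonneg z)
  have hi : Integrable fun z => g z * (h z - a) :=
    (g.integrable.const_mul δ).mono' (g.continuous.mul (hh.sub continuous_const)).aestronglyMeasurable
      (.of_forall hb)
  have h1 : (∫ z, g z * h z) - a = ∫ z, g z * (h z - a) := by
    have h2 : ∫ z, g z * h z = ∫ z, (g z * (h z - a) + g z * a) := by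
      congr with z
      ring
    rw [h2, integral_add hi (g.integrable.mul_const a), integral_mul_const, hg.integral_eq_one]
    ring
  rw [h1, ← Real.norm_eq_abs]
  refine (norm_integral_le_of_norm_le (g.integrable.const_mul δ) (.of_forall hb)).trans ?_
  rw [integral_const_mul, hg.integral_eq_one, mul_one]

lemma IsCovKernel.abs_covBil_mollifier_sub_le (hK : IsCovKernel K) {g g' : TestFn d}
    {x y : Space d} {ε ε' a δ : ℝ} (hg : IsMollifier g x ε) (hg' : IsMollifier g' y ε')
    (hδ : ∀ z z', dist z x < ε → dist z' y < ε' → |K (z - z') - a| ≤ δ) :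
    |covBil K g g' - a| ≤ δ := by
  refine hg.abs_integral_mul_sub_le (hK.continuous_applyCov g') fun z hz => ?_
  have := hg'.abs_integral_mul_sub_le (h := fun z' => K (z - z'))
    (hK.continuous.comp (by fun_prop)) fun z' hz' => hδ z z' hz hz'
  simpa only [applyCov, mul_comm] using this

lemma tendsto_covBil_mollifier_left (hK : IsCovKernel K) {g : ℕ → TestFn d} {x : Space d}
    {ε : ℕ → ℝ} (hε : Tendsto ε atTop (𝓝 0)) (hg : ∀ n, IsMollifier (g n) x (ε n))
    (f : TestFn d) : Tendsto (fun n => covBil K (g n) f) atTop (𝓝 (applyCov K f x)) := by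
  rw [Metric.tendsto_nhds]
  intro δ hδ
  obtain ⟨r, hr, h⟩ := Metric.continuousAt_iff.1 (hK.continuous_applyCov f).continuousAt (δ / 2)
    (half_pos hδ)
  filter_upwards [hε.eventually_lt_const hr] with n hn
  refine lt_of_le_of_lt ((hg n).abs_integral_mul_sub_le (hK.continuous_applyCov f)
    fun z hz => ?_) (half_lt_self hδ)
  exact (h (hz.trans hn)).le

lemma tendsto_covBil_mollifier (hK : IsCovKernel K) {g g' : ℕ → TestFn d} {x y : Space d}
    {ε : ℕ → ℝ} (hε : Tendsto ε atTop (𝓝 0)) (hg : ∀ n, IsMollifier (g n) x (ε n))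
    (hg' : ∀ n, IsMollifier (g' n) y (ε n)) :
    Tendsto (fun n => covBil K (g n) (g' n)) atTop (𝓝 (K (x - y))) := by
  rw [Metric.tendsto_nhds]
  intro δ hδ
  obtain ⟨r, hr, h⟩ := Metric.continuousAt_iff.1 (hK.continuous.continuousAt (x := x - y)) (δ / 2)
    (half_pos hδ)
  filter_upwards [hε.eventually_lt_const (half_pos hr)] with n hn
  refine lt_of_le_of_lt (hK.abs_covBil_mollifier_sub_le (hg n) (hg' n)
    fun z z' hz hz' => ?_) (half_lt_self hδ)
  refine (h (lt_of_le_of_lt (dist_sub_sub_le z z' x y) ?_)).le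
  linarith

/-- Measurably indexed mollifiers along which the field converges fast. -/
lemma IsCovKernel.exists_mollifiers (hK : IsCovKernel K) :
    ∃ (g : ℕ → ℕ → TestFn d) (k : ℕ → Space d → ℕ) (ε : ℕ → ℝ), (∀ n, Measurable (k n)) ∧
      Tendsto ε atTop (𝓝 0) ∧ (∀ n x, IsMollifier (g n (k n x)) x (ε n)) ∧
      ∀ n x, covForm K (g (n + 1) (k (n + 1) x) - g n (k n x)) ≤ 4 * (1 / 16) ^ n := by
  have h1 : ∀ n : ℕ, ∃ e > 0, e ≤ 1 / ((n : ℝ) + 1) ∧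
      ∀ z, ‖z‖ < e → |K z - K 0| ≤ (1 / 16) ^ n := by
    intro n
    obtain ⟨r, hr, h⟩ := Metric.continuousAt_iff.1 (hK.continuous.continuousAt (x := 0))
      ((1 / 16) ^ n) (by positivity)
    refine ⟨min r (1 / ((n : ℝ) + 1)), lt_min hr (by positivity), min_le_right _ _, fun z hz => ?_⟩
    refine (h ?_).le
    rw [dist_zero_right]
    exact hz.trans_le (min_le_left _ _)
  choose e he he1 hKe using h1
  let D := TopologicalSpace.denseSeq (Space d)
  have h2 : ∀ n x, ∃ j, dist (D j) x < e n / 4 := fun n x => by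
    obtain ⟨j, hy⟩ := (TopologicalSpace.denseRange_denseSeq (Space d)).exists_mem_open
      (Metric.isOpen_ball (x := x) (ε := e n / 4)) ⟨x, Metric.mem_ball_self (by linarith [he n])⟩
    exact ⟨j, hy⟩
  -- Centres are restricted to a dense sequence so that only countably many mollifiers occur, which
  -- gives joint measurability later. A centre within e/4 of x and a radius e/4 keep the support
  -- within e/2 of x, so two points of such supports differ by less than e.
  choose g hg using fun (n : ℕ) (j : ℕ) => exists_isMollifier (D j) (by linarith [he n] : 0 < e n / 4)
  classical
  let k : ℕ → Space d → ℕ := fun n x => Nat.find (h2 n x)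
  have hk : ∀ n x, IsMollifier (g n (k n x)) x (e n / 2) := fun n x =>
    (hg n (k n x)).mono (by linarith [Nat.find_spec (h2 n x)])
  refine ⟨g, k, fun n => e n / 2, fun n => ?_, ?_, hk, fun n x => ?_⟩
  · refine measurable_find _ fun j => ?_
    exact measurableSet_lt (by fun_prop) measurable_const
  · refine squeeze_zero (fun n => (half_pos (he n)).le) (fun n => ?_)
      tendsto_one_div_add_atTop_nhds_zero_nat
    linarith [he1 n, he n]
  · set f := g (n + 1) (k (n + 1) x)
    set f' := g n (k n x)
    have hle : ((1 : ℝ) / 16) ^ (n + 1) ≤ (1 / 16) ^ n :=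
      pow_le_pow_of_le_one (by norm_num) (by norm_num) n.le_succ
    have hcov : covForm K (f - f') = covBil K f f - 2 * covBil K f f' + covBil K f' f' := by
      have := hK.covForm_combination f f' f' (-1) 0
      simp only [neg_smul, one_smul, zero_smul, add_zero, ← sub_eq_add_neg] at this
      rw [this, hK.covBil_comm f' f]
      simp only [← covBil_self]
      ring
    have b1 : |covBil K f f - K 0| ≤ (1 / 16) ^ n := by
      refine hK.abs_covBil_mollifier_sub_le (hk (n + 1) x) (hk (n + 1) x) fun z z' hz hz' => ?_
      refine (hKe (n + 1) _ ?_).trans hle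
      rw [← dist_eq_norm]
      linarith [dist_triangle_right z z' x]
    have b2 : |covBil K f' f' - K 0| ≤ (1 / 16) ^ n := by
      refine hK.abs_covBil_mollifier_sub_le (hk n x) (hk n x) fun z z' hz hz' => ?_
      refine hKe n _ ?_
      rw [← dist_eq_norm]
      linarith [dist_triangle_right z z' x]
    have b3 : |covBil K f f' - K 0| ≤ (1 / 16) ^ n := by
      refine hK.abs_covBil_mollifier_sub_le (hk (n + 1) x) (hk n x) fun z z' hz hz' => ?_
      have hd := dist_triangle_right z z' x
      -- The radii need not decrease. The distance is below the mean of the two, hence below the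
      -- larger one, and the modulus of continuity for that index applies.
      rcases le_total (e n) (e (n + 1)) with h | h
      · refine (hKe (n + 1) _ ?_).trans hle
        rw [← dist_eq_norm]
        linarith
      · refine hKe n _ ?_
        rw [← dist_eq_norm]
        linarith
    rw [hcov]
    linarith [_root_.abs_le.1 b1, _root_.abs_le.1 b2, _root_.abs_le.1 b3]

end Mollifier

/-! ### The field at points -/

/-- The variance of `φ(f) + a φ(x) + b φ(y)`. -/
noncomputable def pointVar {d : ℕ} (K : Space d → ℝ) (f : TestFn d) (a b : ℝ) (x y : Space d) : ℝ :=
  covForm K f + 2 * a * applyCov K f x + 2 * b * applyCov K f y + a ^ 2 * K 0 + b ^ 2 * K 0 +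
    2 * a * b * K (x - y)

/-- `u φ x` is a jointly measurable version of the field at points. -/
structure IsPointField {d : ℕ} (K : Space d → ℝ) (ν : Measure (Distr d))
    (u : Distr d → Space d → ℝ) : Prop where
  measurable : Measurable (Function.uncurry u)
  map_eq : ∀ f a b x y, ν.map (fun φ => φ f + a * u φ x + b * u φ y) =
    ProbabilityTheory.gaussianReal 0 (pointVar K f a b x y).toNNReal

section PointField

open ProbabilityTheory
open scoped ENNReal

lemma integrable_sq_of_map_eq {Ω : Type*} [MeasurableSpace Ω] {P : Measure Ω} {T : Ω → ℝ}
    {v : ℝ≥0} (hT : P.map T = gaussianReal 0 v) : Integrable (fun ω => T ω ^ 2) P := by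
  have hTm : AEMeasurable T P := aemeasurable_of_map_neZero (by rw [hT]; infer_instance)
  have h := (memLp_id_gaussianReal (μ := 0) (v := v) 2).integrable_sq
  rw [← hT, integrable_map_measure (by fun_prop) hTm] at h
  exact h

lemma integral_sq_of_map_eq {Ω : Type*} [MeasurableSpace Ω] {P : Measure Ω} {T : Ω → ℝ}
    {q : ℝ} (hq : 0 ≤ q) (hT : P.map T = gaussianReal 0 q.toNNReal) :
    ∫ ω, T ω ^ 2 ∂P = q := by
  have hTm : AEMeasurable T P := aemeasurable_of_map_neZero (by rw [hT]; infer_instance)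
  have h := variance_of_integral_eq_zero (X := id) (μ := gaussianReal 0 q.toNNReal)
    aemeasurable_id integral_id_gaussianReal
  rw [variance_id_gaussianReal, Real.coe_toNNReal _ hq, ← hT,
    integral_map hTm (by fun_prop)] at h
  exact h.symm

/-- The pointwise inequality |T| ≤ (s + T²/s)/2 turns the variance bound s² into an L¹ bound s. -/
lemma lintegral_enorm_le_of_map_eq {Ω : Type*} [MeasurableSpace Ω] {P : Measure Ω}
    [IsProbabilityMeasure P] {T : Ω → ℝ} {q s : ℝ} (hq : 0 ≤ q) (hs : 0 < s) (hqs : q ≤ s ^ 2)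
    (hT : P.map T = gaussianReal 0 q.toNNReal) : ∫⁻ ω, ‖T ω‖ₑ ∂P ≤ ENNReal.ofReal s := by
  have hTm : AEMeasurable T P := aemeasurable_of_map_neZero (by rw [hT]; infer_instance)
  have hi : Integrable (fun ω => (s + T ω ^ 2 / s) / 2) P :=
    ((integrable_const s).add ((integrable_sq_of_map_eq hT).div_const s)).div_const 2
  calc ∫⁻ ω, ‖T ω‖ₑ ∂P ≤ ∫⁻ ω, ENNReal.ofReal ((s + T ω ^ 2 / s) / 2) ∂P := by
        refine lintegral_mono fun ω => ?_
        rw [← ofReal_norm]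
        refine ENNReal.ofReal_le_ofReal ?_
        rw [Real.norm_eq_abs, ← sub_nonneg]
        have : (s + T ω ^ 2 / s) / 2 - |T ω| = (|T ω| - s) ^ 2 / (2 * s) := by
          rw [← sq_abs (T ω)]
          field_simp
          ring
        rw [this]
        positivity
    _ = ENNReal.ofReal (∫ ω, (s + T ω ^ 2 / s) / 2 ∂P) :=
        (ofReal_integral_eq_lintegral_ofReal hi (.of_forall fun ω => by positivity)).symm
    _ ≤ _ := by
        refine ENNReal.ofReal_le_ofReal ?_
        rw [integral_div, integral_add (integrable_const _)
          ((integrable_sq_of_map_eq hT).div_const s), integral_div, integral_sq_of_map_eq hq hT]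
        simp only [integral_const, probReal_univ, one_smul]
        have : q / s ≤ s := by
          rw [div_le_iff₀ hs]
          nlinarith
        linarith

lemma map_eq_gaussianReal_of_ae_tendsto {Ω : Type*} [MeasurableSpace Ω] {P : Measure Ω}
    [IsProbabilityMeasure P] {Y : ℕ → Ω → ℝ} {Z : Ω → ℝ} {v : ℕ → ℝ≥0} {w : ℝ≥0}
    (hY : ∀ n, P.map (Y n) = gaussianReal 0 (v n)) (hZ : AEMeasurable Z P)
    (hYZ : ∀ᵐ ω ∂P, Tendsto (fun n => Y n ω) atTop (𝓝 (Z ω))) (hv : Tendsto v atTop (𝓝 w)) :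
    P.map Z = gaussianReal 0 w := by
  have hYm : ∀ n, AEMeasurable (Y n) P := fun n =>
    aemeasurable_of_map_neZero (by rw [hY]; infer_instance)
  have := Measure.isProbabilityMeasure_map hZ
  refine Measure.ext_of_charFun (funext fun t => ?_)
  have h1 : Tendsto (fun n => charFun (P.map (Y n)) t) atTop (𝓝 (charFun (P.map Z) t)) := by
    simp only [charFun_apply_real]
    rw [integral_map hZ (by fun_prop)]
    have : ∀ n, ∫ x, Complex.exp (t * x * Complex.I) ∂P.map (Y n) =
        ∫ ω, Complex.exp (t * Y n ω * Complex.I) ∂P := fun n =>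
      integral_map (hYm n) (by fun_prop)
    simp only [this]
    refine tendsto_integral_of_dominated_convergence (fun _ => 1) (fun n => ?_)
      (integrable_const _) (fun n => .of_forall fun ω => ?_) ?_
    · exact (Measurable.comp_aemeasurable (g := fun y : ℝ => Complex.exp (t * y * Complex.I))
        (by fun_prop) (hYm n)).aestronglyMeasurable
    · rw [← Complex.ofReal_mul, Complex.norm_exp_ofReal_mul_I]
    · filter_upwards [hYZ] with ω hω
      have hc : Continuous fun y : ℝ => Complex.exp (t * y * Complex.I) := by fun_prop
      exact (hc.tendsto _).comp hω
  have h2 : Tendsto (fun n => charFun (P.map (Y n)) t) atTop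
      (𝓝 (charFun (gaussianReal 0 w) t)) := by
    simp only [hY, charFun_gaussianReal]
    refine (Complex.continuous_exp.tendsto _).comp (tendsto_const_nhds.sub ?_)
    refine Tendsto.div_const (Tendsto.mul_const _ ?_) _
    exact (Complex.continuous_ofReal.tendsto _).comp ((NNReal.tendsto_coe).2 hv)
  exact tendsto_nhds_unique h1 h2

variable {d : ℕ} {K : Space d → ℝ} {ν : Measure (Distr d)}

lemma measurable_eval (f : TestFn d) : Measurable fun φ : Distr d => φ f :=
  measurable_iff_comap_le.2 (le_iSup (fun J : TestFn d =>
    MeasurableSpace.comap (fun φ : Distr d => φ J) inferInstance) f)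

lemma IsCovKernel.tendsto_covForm_pointVar (hK : IsCovKernel K) {g g' : ℕ → TestFn d}
    {x y : Space d} {ε : ℕ → ℝ} (hε : Tendsto ε atTop (𝓝 0)) (hg : ∀ n, IsMollifier (g n) x (ε n))
    (hg' : ∀ n, IsMollifier (g' n) y (ε n)) (f : TestFn d) (a b : ℝ) :
    Tendsto (fun n => covForm K (f + a • g n + b • g' n)) atTop (𝓝 (pointVar K f a b x y)) := by
  simp only [hK.covForm_combination, pointVar, ← covBil_self (g _), ← covBil_self (g' _)]
  have h1 := tendsto_covBil_mollifier_left hK hε hg f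
  have h2 := tendsto_covBil_mollifier_left hK hε hg' f
  have h3 := tendsto_covBil_mollifier hK hε hg hg
  have h4 := tendsto_covBil_mollifier hK hε hg' hg'
  have h5 := tendsto_covBil_mollifier hK hε hg hg'
  rw [sub_self] at h3 h4
  exact (((((tendsto_const_nhds.add (h1.const_mul _)).add (h2.const_mul _)).add
    (h3.const_mul _)).add (h4.const_mul _)).add (h5.const_mul _))

/-- A limit of variances of smeared fields. It ensures that the `toNNReal` in the laws of the point
field loses nothing. -/
lemma IsCovKernel.pointVar_nonneg (hK : IsCovKernel K) (f : TestFn d) (a b : ℝ) (x y : Space d) :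
    0 ≤ pointVar K f a b x y := by
  obtain ⟨g, k, ε, -, hε, hg, -⟩ := hK.exists_mollifiers
  exact ge_of_tendsto' (hK.tendsto_covForm_pointVar hε (fun n => hg n x) (fun n => hg n y) f a b)
    fun n => hK.covForm_nonneg _

/-- Along fast mollifiers the smeared field converges almost surely. -/
lemma ae_exists_tendsto_of_fast (hK : IsCovKernel K) (hν : IsGaussianField K ν) {f : ℕ → TestFn d}
    (hf : ∀ n, covForm K (f (n + 1) - f n) ≤ 4 * (1 / 16) ^ n) :
    ∀ᵐ φ ∂ν, ∃ l, Tendsto (fun n => φ (f n)) atTop (𝓝 l) := by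
  have := hν.isProbabilityMeasure
  have hmeas : ∀ n, Measurable fun φ : Distr d => φ (f (n + 1)) - φ (f n) := fun n =>
    (measurable_eval _).sub (measurable_eval _)
  have hsum : ∫⁻ φ, ∑' n, ‖φ (f (n + 1)) - φ (f n)‖ₑ ∂ν ≠ ∞ := by
    rw [lintegral_tsum fun n => (hmeas n).enorm.aemeasurable]
    have hb : ∀ n, ∫⁻ φ, ‖φ (f (n + 1)) - φ (f n)‖ₑ ∂ν ≤ ENNReal.ofReal (2 * (1 / 4) ^ n) := by
      intro n
      have h := hν.map_eval (f (n + 1) - f n)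
      simp only [map_sub] at h
      refine lintegral_enorm_le_of_map_eq (hK.covForm_nonneg _) (by positivity)
        ((hf n).trans (le_of_eq ?_)) h
      rw [mul_pow, ← pow_mul, mul_comm n 2, pow_mul]
      norm_num
    refine ne_top_of_le_ne_top ?_ (ENNReal.tsum_le_tsum hb)
    have hs : Summable fun n : ℕ => 2 * (1 / 4 : ℝ) ^ n :=
      (summable_geometric_of_lt_one (by norm_num) (by norm_num)).mul_left 2
    rw [← ENNReal.ofReal_tsum_of_nonneg (fun n => by positivity) hs]
    exact ENNReal.ofReal_ne_top
  filter_upwards [ae_lt_top (Measurable.tsum fun n => (hmeas n).enorm) hsum] with φ hφ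
  refine cauchySeq_tendsto_of_complete (cauchySeq_of_edist_le_of_tsum_ne_top
    (fun n => ‖φ (f (n + 1)) - φ (f n)‖ₑ) (fun n => ?_) hφ.ne)
  rw [edist_comm, edist_eq_enorm_sub]

/-- Increments along the fast mollifiers have standard deviation at most 2·(1/4)^n, so for each
fixed x the smeared fields converge almost surely. Joint Gaussianity passes to the limit through
characteristic functions. The law is thus known at every pair of points, although the exceptional
set depends on the points. -/
theorem exists_isPointField (hK : IsCovKernel K) (hν : IsGaussianField K ν) :
    ∃ u, IsPointField K ν u := by
  have := hν.isProbabilityMeasure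
  obtain ⟨g, k, ε, hk, hε, hg, hfast⟩ := hK.exists_mollifiers
  have hWm : ∀ n, Measurable fun z : Distr d × Space d => z.1 (g n (k n z.2)) := by
    intro n
    have h : Measurable fun z : Distr d × ℕ => z.1 (g n z.2) :=
      measurable_from_prod_countable_left fun j => measurable_eval (g n j)
    exact h.comp (measurable_fst.prodMk ((hk n).comp measurable_snd))
  -- The limsup is measurable in (φ, x) whether or not the sequence converges, and equals the limit
  -- wherever it does.
  obtain ⟨u, hum, hulim⟩ : ∃ u : Distr d × Space d → ℝ, Measurable u ∧
      ∀ z, u z = limsup (fun n => z.1 (g n (k n z.2))) atTop :=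
    ⟨_, Measurable.limsup hWm, fun _ => rfl⟩
  have hux : ∀ x, Measurable fun φ => u (φ, x) := fun x =>
    hum.comp (measurable_id.prodMk measurable_const)
  have hlim : ∀ x, ∀ᵐ φ ∂ν, Tendsto (fun n => φ (g n (k n x))) atTop (𝓝 (u (φ, x))) := by
    intro x
    filter_upwards [ae_exists_tendsto_of_fast hK hν (f := fun n => g n (k n x))
      fun n => hfast n x] with φ ⟨l, hl⟩
    rw [hulim, hl.limsup_eq]
    exact hl
  refine ⟨fun φ x => u (φ, x), hum, fun f a b x y => ?_⟩
  refine map_eq_gaussianReal_of_ae_tendsto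
    (Y := fun n φ => φ (f + a • g n (k n x) + b • g n (k n y)))
    (fun n => hν.map_eval _) ?_ ?_ (tendsto_real_toNNReal
      (hK.tendsto_covForm_pointVar hε (fun n => hg n x) (fun n => hg n y) f a b))
  · exact (((measurable_eval f).add ((hux x).const_mul a)).add
      ((hux y).const_mul b)).aemeasurable
  · filter_upwards [hlim x, hlim y] with φ h1 h2
    simp only [map_add, map_smul, smul_eq_mul]
    exact (tendsto_const_nhds.add (h1.const_mul a)).add (h2.const_mul b)

end PointField

/-! ### The box -/

section Box

variable {d : ℕ} {L : ℝ}

lemma isClosed_box : IsClosed (box d L) := by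
  have : box d L = ⋂ i, {x : Space d | x i ∈ Set.Icc (-(L / 2)) (L / 2)} := by
    ext x
    simp [box]
  rw [this]
  exact isClosed_iInter fun i => isClosed_Icc.preimage (by fun_prop)

lemma isCompact_box : IsCompact (box d L) := by
  have h : IsCompact (Set.univ.pi fun _ : Fin d => Set.Icc (-(L / 2)) (L / 2)) :=
    isCompact_univ_pi fun _ => isCompact_Icc
  have h2 := h.image (PiLp.continuous_toLp 2 fun _ : Fin d => ℝ)
  refine h2.of_isClosed_subset isClosed_box fun x hx => ⟨WithLp.ofLp x, fun i _ => hx i, rfl⟩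

lemma convex_box : Convex ℝ (box d L) := fun _ hx _ hy _ _ ha hb hab i =>
  convex_Icc (-(L / 2)) (L / 2) (hx i) (hy i) ha hb hab

lemma measurableSet_box : MeasurableSet (box d L) := isClosed_box.measurableSet

instance isFiniteMeasure_box : IsFiniteMeasure (volume.restrict (box d L)) :=
  isFiniteMeasure_restrict.2 isCompact_box.measure_lt_top.ne

lemma interior_box_ae_eq : (interior (box d L) : Set (Space d)) =ᵐ[volume] box d L :=
  interior_ae_eq_of_null_frontier (convex_box.addHaar_frontier volume)

end Box

/-! ### Square integrable random functions -/

lemma integral_sub_add {Ω : Type*} [MeasurableSpace Ω] {P : Measure Ω} {f g h : Ω → ℝ}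
    (hf : Integrable f P) (hg : Integrable g P) (hh : Integrable h P) :
    ∫ ω, (f ω - g ω + h ω) ∂P = ∫ ω, f ω ∂P - ∫ ω, g ω ∂P + ∫ ω, h ω ∂P := by
  rw [integral_add (f := fun ω => f ω - g ω) (hf.sub hg) hh, integral_sub hf hg]

lemma integral_sub_sub {Ω : Type*} [MeasurableSpace Ω] {P : Measure Ω} {f g h : Ω → ℝ}
    (hf : Integrable f P) (hg : Integrable g P) (hh : Integrable h P) :
    ∫ ω, (f ω - g ω - h ω) ∂P = ∫ ω, f ω ∂P - ∫ ω, g ω ∂P - ∫ ω, h ω ∂P := by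
  rw [integral_sub (f := fun ω => f ω - g ω) (hf.sub hg) hh, integral_sub hf hg]

section RandomFunction

variable {Ω X : Type*} [MeasurableSpace Ω] [MeasurableSpace X] {P : Measure Ω} {ρ : Measure X}
  [IsFiniteMeasure ρ] {u : Ω → X → ℝ} {f : X → ℝ} {M : ℝ} {Z : Ω → ℝ}

lemma integrable_mul_random (hu : Measurable (Function.uncurry u))
    (hu2 : Integrable (fun z : Ω × X => u z.1 z.2 ^ 2) (P.prod ρ)) (hf : Measurable f)
    (hM : ∀ x, |f x| ≤ M) (hZ : Measurable Z) (hZ2 : Integrable (fun ω => Z ω ^ 2) P) :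
    Integrable (fun z : Ω × X => Z z.1 * (u z.1 z.2 * f z.2)) (P.prod ρ) := by
  refine (((hZ2.comp_fst ρ).add hu2).mul_const M).mono' ?_ (.of_forall fun z => ?_)
  · exact ((hZ.comp measurable_fst).mul (hu.mul (hf.comp measurable_snd))).aestronglyMeasurable
  · rw [norm_mul, norm_mul, ← mul_assoc]
    refine mul_le_mul ?_ (hM _) (norm_nonneg _) (add_nonneg (sq_nonneg _) (sq_nonneg _))
    simp only [Real.norm_eq_abs, Pi.add_apply]
    rw [← sq_abs (Z z.1), ← sq_abs (u z.1 z.2)]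
    nlinarith [sq_nonneg (|Z z.1| - |u z.1 z.2|), sq_nonneg |Z z.1|, sq_nonneg |u z.1 z.2|]

lemma integral_mul_random_integral [IsFiniteMeasure P] (hu : Measurable (Function.uncurry u))
    (hu2 : Integrable (fun z : Ω × X => u z.1 z.2 ^ 2) (P.prod ρ)) (hf : Measurable f)
    (hM : ∀ x, |f x| ≤ M) (hZ : Measurable Z) (hZ2 : Integrable (fun ω => Z ω ^ 2) P) :
    ∫ ω, Z ω * ∫ x, u ω x * f x ∂ρ ∂P = ∫ x, f x * ∫ ω, Z ω * u ω x ∂P ∂ρ := by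
  simp only [← integral_const_mul]
  rw [integral_integral_swap (integrable_mul_random hu hu2 hf hM hZ hZ2)]
  congr with x
  congr with ω
  ring

lemma sq_integral_le {w : X → ℝ} (hw : Integrable w ρ) (hw2 : Integrable (fun x => w x ^ 2) ρ) :
    (∫ x, w x ∂ρ) ^ 2 ≤ (ρ.real Set.univ + 1) * ∫ x, w x ^ 2 ∂ρ := by
  set V := ρ.real Set.univ
  have hV : 0 ≤ V := measureReal_nonneg
  set I := ∫ x, w x ∂ρ
  -- The mean of w would be I/V; adding 1 avoids dividing by a zero total mass and costs only a
  -- constant in the bound.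
  set c := I / (V + 1) with hc
  have h0 : 0 ≤ ∫ x, (w x - c) ^ 2 ∂ρ := integral_nonneg fun x => sq_nonneg _
  have h1 : ∫ x, (w x - c) ^ 2 ∂ρ = ∫ x, w x ^ 2 ∂ρ - 2 * c * I + V * c ^ 2 := by
    have : ∀ x, (w x - c) ^ 2 = w x ^ 2 - 2 * c * w x + c ^ 2 := fun x => by ring
    simp only [this]
    rw [integral_sub_add hw2 (hw.const_mul _) (integrable_const _), integral_const_mul,
      integral_const, smul_eq_mul]
  have hI : I = c * (V + 1) := by rw [hc]; field_simp
  rw [h1, hI] at h0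
  rw [hI]
  nlinarith [sq_nonneg c, mul_nonneg (sq_nonneg c) hV]

lemma integrable_random_integral_sq [IsFiniteMeasure P] (hu : Measurable (Function.uncurry u))
    (hu2 : Integrable (fun z : Ω × X => u z.1 z.2 ^ 2) (P.prod ρ)) (hf : Measurable f)
    (hM : ∀ x, |f x| ≤ M) :
    Measurable (fun ω => ∫ x, u ω x * f x ∂ρ) ∧
      Integrable (fun ω => (∫ x, u ω x * f x ∂ρ) ^ 2) P := by
  have hm : Measurable (fun ω => ∫ x, u ω x * f x ∂ρ) :=
    (StronglyMeasurable.integral_prod_right (f := fun ω x => u ω x * f x)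
      (hu.mul (hf.comp measurable_snd)).stronglyMeasurable).measurable
  have hi : Integrable (fun z : Ω × X => u z.1 z.2 * f z.2) (P.prod ρ) := by
    have := integrable_mul_random (Z := fun _ => 1) hu hu2 hf hM measurable_const (integrable_const _)
    simpa using this
  have hi2 : Integrable (fun z : Ω × X => (u z.1 z.2 * f z.2) ^ 2) (P.prod ρ) := by
    refine (hu2.mul_const (M ^ 2)).mono' ((hu.mul
      (hf.comp measurable_snd)).pow_const 2).aestronglyMeasurable (.of_forall fun z => ?_)
    rw [mul_pow, Real.norm_of_nonneg (by positivity)]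
    refine mul_le_mul_of_nonneg_left ?_ (sq_nonneg _)
    rw [← sq_abs]
    exact pow_le_pow_left₀ (abs_nonneg _) (hM _) 2
  refine ⟨hm, (hi2.integral_prod_left.const_mul (ρ.real Set.univ + 1)).mono'
    (hm.pow_const 2).aestronglyMeasurable ?_⟩
  filter_upwards [hi.prod_right_ae, hi2.prod_right_ae] with ω h1 h2
  rw [Real.norm_of_nonneg (sq_nonneg _)]
  exact sq_integral_le h1 h2

end RandomFunction

/-! ### The field is a function on the box -/

section FunctionOnBox

variable {d : ℕ} {L : ℝ} {K : Space d → ℝ} {ν : Measure (Distr d)} {u : Distr d → Space d → ℝ}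

lemma covForm_zero : covForm K (0 : TestFn d) = 0 := by
  simp [covForm]

lemma applyCov_zero (x : Space d) : applyCov K (0 : TestFn d) x = 0 := by
  simp [applyCov]

namespace IsPointField

lemma measurable_apply (hu : IsPointField K ν u) (x : Space d) : Measurable fun φ => u φ x :=
  hu.measurable.comp (measurable_id.prodMk measurable_const)

lemma integrable_sq (hu : IsPointField K ν u) (f : TestFn d) (a b : ℝ) (x y : Space d) :
    Integrable (fun φ => (φ f + a * u φ x + b * u φ y) ^ 2) ν :=
  integrable_sq_of_map_eq (hu.map_eq f a b x y)

lemma integral_sq (hK : IsCovKernel K) (hu : IsPointField K ν u) (f : TestFn d) (a b : ℝ)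
    (x y : Space d) : ∫ φ, (φ f + a * u φ x + b * u φ y) ^ 2 ∂ν = pointVar K f a b x y :=
  integral_sq_of_map_eq (hK.pointVar_nonneg f a b x y) (hu.map_eq f a b x y)

lemma integrable_eval_sq (hu : IsPointField K ν u) (f : TestFn d) :
    Integrable (fun φ => φ f ^ 2) ν := by
  simpa using hu.integrable_sq f 0 0 0 0

lemma integral_eval_sq (hK : IsCovKernel K) (hu : IsPointField K ν u) (f : TestFn d) :
    ∫ φ, φ f ^ 2 ∂ν = covForm K f := by
  simpa [pointVar] using hu.integral_sq hK f 0 0 0 0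

lemma integrable_apply_sq (hu : IsPointField K ν u) (x : Space d) :
    Integrable (fun φ => u φ x ^ 2) ν := by
  simpa using hu.integrable_sq 0 1 0 x x

lemma integral_apply_sq (hK : IsCovKernel K) (hu : IsPointField K ν u) (x : Space d) :
    ∫ φ, u φ x ^ 2 ∂ν = K 0 := by
  simpa [pointVar, covForm_zero, applyCov_zero] using hu.integral_sq hK 0 1 0 x x

lemma integral_eval_mul_apply (hK : IsCovKernel K) (hu : IsPointField K ν u) (f : TestFn d)
    (x : Space d) : ∫ φ, φ f * u φ x ∂ν = applyCov K f x := by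
  have h1 := hu.integral_sq hK f 1 0 x x
  have h2 : ∀ φ : Distr d, φ f * u φ x =
      ((φ f + 1 * u φ x + 0 * u φ x) ^ 2 - φ f ^ 2 - u φ x ^ 2) / 2 := fun φ => by ring
  simp only [h2]
  rw [integral_div, integral_sub_sub (hu.integrable_sq f 1 0 x x) (hu.integrable_eval_sq f)
    (hu.integrable_apply_sq x), h1, hu.integral_eval_sq hK, hu.integral_apply_sq hK, pointVar]
  ring

lemma integral_apply_mul_apply (hK : IsCovKernel K) (hu : IsPointField K ν u)
    (x y : Space d) : ∫ φ, u φ x * u φ y ∂ν = K (x - y) := by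
  have h1 := hu.integral_sq hK 0 1 1 x y
  have h0 : ∀ φ : Distr d, φ 0 = 0 := fun φ => map_zero φ
  have h2 : ∀ φ : Distr d, u φ x * u φ y =
      ((φ 0 + 1 * u φ x + 1 * u φ y) ^ 2 - u φ x ^ 2 - u φ y ^ 2) / 2 := fun φ => by
    rw [h0]; ring
  simp only [h2]
  rw [integral_div, integral_sub_sub (hu.integrable_sq 0 1 1 x y) (hu.integrable_apply_sq x)
    (hu.integrable_apply_sq y), h1, hu.integral_apply_sq hK, hu.integral_apply_sq hK, pointVar,
    covForm_zero, applyCov_zero, applyCov_zero]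
  ring

lemma integrable_prod_sq [IsFiniteMeasure ν] (hK : IsCovKernel K) (hu : IsPointField K ν u) :
    Integrable (fun z : Distr d × Space d => u z.1 z.2 ^ 2)
      (ν.prod (volume.restrict (box d L))) := by
  have hm : Measurable fun z : Distr d × Space d => u z.1 z.2 ^ 2 := hu.measurable.pow_const 2
  rw [integrable_prod_iff' hm.aestronglyMeasurable]
  refine ⟨.of_forall fun x => hu.integrable_apply_sq x, ?_⟩
  refine (integrable_const (K 0)).congr (.of_forall fun x => ?_)
  simp only [norm_pow, Real.norm_eq_abs, sq_abs]
  exact (hu.integral_apply_sq hK x).symm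

lemma ae_integrableOn [IsFiniteMeasure ν] (hK : IsCovKernel K) (hu : IsPointField K ν u) :
    ∀ᵐ φ ∂ν, IntegrableOn (u φ) (box d L) := by
  have := integrable_mul_random (Z := fun _ => 1) (f := fun _ => 1) (M := 1) hu.measurable
    (hu.integrable_prod_sq (L := L) hK) measurable_const (by simp) measurable_const
    (integrable_const _)
  filter_upwards [this.prod_right_ae] with φ hφ
  simp only [one_mul, mul_one] at hφ
  exact hφ

/-- The mean square of the difference vanishes: E φ(f)², E φ(f)∫uf and E(∫uf)² are all equal to ⟨f,
Kf⟩ by Fubini, because f is supported in the box. -/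
lemma ae_eval_eq_integral [IsFiniteMeasure ν] (hK : IsCovKernel K) (hu : IsPointField K ν u)
    {f : TestFn d} (hf : tsupport f ⊆ box d L) : ∀ᵐ φ ∂ν, φ f = ∫ x in box d L, u φ x * f x := by
  have hM : ∀ x, |f x| ≤ SchwartzMap.seminorm ℝ 0 0 f := fun x => SchwartzMap.norm_le_seminorm ℝ f x
  have hfm : Measurable f := f.continuous.measurable
  have hu2 := hu.integrable_prod_sq (L := L) hK
  obtain ⟨hIm, hI2⟩ := integrable_random_integral_sq hu.measurable hu2 hfm hM
  have hout : ∀ x, x ∉ box d L → f x = 0 := fun x hx =>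
    image_eq_zero_of_notMem_tsupport fun h => hx (hf h)
  have e1 : ∫ φ, φ f * (∫ x in box d L, u φ x * f x) ∂ν = covForm K f := by
    rw [integral_mul_random_integral hu.measurable hu2 hfm hM (measurable_eval f)
      (hu.integrable_eval_sq f)]
    simp only [hu.integral_eval_mul_apply hK]
    exact setIntegral_eq_integral_of_forall_compl_eq_zero fun x hx => by rw [hout x hx, zero_mul]
  have e2 : ∫ φ, (∫ x in box d L, u φ x * f x) * (∫ x in box d L, u φ x * f x) ∂ν =
      covForm K f := by
    rw [integral_mul_random_integral hu.measurable hu2 hfm hM hIm hI2]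
    have : ∀ x, ∫ φ, (∫ y in box d L, u φ y * f y) * u φ x ∂ν = applyCov K f x := by
      intro x
      simp only [mul_comm _ (u _ x)]
      rw [integral_mul_random_integral hu.measurable hu2 hfm hM (hu.measurable_apply x)
        (hu.integrable_apply_sq x)]
      simp only [hu.integral_apply_mul_apply hK]
      rw [setIntegral_eq_integral_of_forall_compl_eq_zero fun y hy => by rw [hout y hy, zero_mul]]
      simp only [applyCov, mul_comm]
    simp only [this]
    exact setIntegral_eq_integral_of_forall_compl_eq_zero fun x hx => by rw [hout x hx, zero_mul]
  have hprod : Integrable (fun φ => φ f * (∫ x in box d L, u φ x * f x)) ν := by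
    refine ((hu.integrable_eval_sq f).add hI2).mono'
      ((measurable_eval f).mul hIm).aestronglyMeasurable (.of_forall fun φ => ?_)
    rw [Real.norm_eq_abs, Pi.add_apply, abs_le]
    constructor <;> nlinarith [sq_nonneg (φ f - ∫ x in box d L, u φ x * f x),
      sq_nonneg (φ f + ∫ x in box d L, u φ x * f x), sq_nonneg (φ f),
      sq_nonneg (∫ x in box d L, u φ x * f x)]
  have hexp : ∀ φ : Distr d, (φ f - ∫ x in box d L, u φ x * f x) ^ 2 =
      φ f ^ 2 - 2 * (φ f * ∫ x in box d L, u φ x * f x) + (∫ x in box d L, u φ x * f x) ^ 2 :=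
    fun φ => by ring
  have hint : Integrable (fun φ => (φ f - ∫ x in box d L, u φ x * f x) ^ 2) ν := by
    simp only [hexp]
    exact ((hu.integrable_eval_sq f).sub (hprod.const_mul 2)).add hI2
  have h0 : ∫ φ, (φ f - ∫ x in box d L, u φ x * f x) ^ 2 ∂ν = 0 := by
    simp only [hexp]
    rw [integral_sub_add (hu.integrable_eval_sq f) (hprod.const_mul 2) hI2, integral_const_mul, e1,
      hu.integral_eval_sq hK]
    simp only [← sq] at e2
    rw [e2]
    ring
  rw [integral_eq_zero_iff_of_nonneg (fun φ => sq_nonneg _) hint] at h0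
  filter_upwards [h0] with φ hφ
  have := pow_eq_zero_iff (two_ne_zero) |>.1 hφ
  linarith

end IsPointField

end FunctionOnBox

/-! ### Separability of the test functions supported in the box -/

section Separability

open scoped ContDiff

variable {d : ℕ} {L : ℝ}

/-- It makes the continuous maps into these finite-dimensional spaces second countable, and so every
set of derivative sequences separable. -/
instance secondCountableTopology_multilinear (n : ℕ) :
    SecondCountableTopology (Space d [×n]→L[ℝ] ℝ) := by
  have : FiniteDimensional ℝ (Space d [×n]→L[ℝ] ℝ) :=
    Module.Finite.of_injective (ContinuousMultilinearMap.toMultilinearMapLinear (R' := ℝ))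
      ContinuousMultilinearMap.toMultilinearMap_injective
  have := FiniteDimensional.proper_real (Space d [×n]→L[ℝ] ℝ)
  infer_instance

/-- All derivatives of a Schwartz function. -/
noncomputable def derivMaps (f : TestFn d) (n : ℕ) : C(Space d, Space d [×n]→L[ℝ] ℝ) :=
  ⟨iteratedFDeriv ℝ n f, (f.smooth ⊤).continuous_iteratedFDeriv (by exact_mod_cast le_top)⟩

/-- For functions supported in one compact set the weights ‖x‖^k are bounded, so the Schwartz
topology reduces to locally uniform convergence of each derivative. -/
lemma tendsto_of_tendsto_derivMaps {s : ℕ → TestFn d} {f : TestFn d}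
    (hs : ∀ n, tsupport (s n) ⊆ box d L) (hf : tsupport f ⊆ box d L)
    (h : Tendsto (fun n => derivMaps (s n)) atTop (𝓝 (derivMaps f))) :
    Tendsto s atTop (𝓝 f) := by
  obtain ⟨R, hR⟩ := (isCompact_box (d := d) (L := L)).isBounded.exists_norm_le
  rw [(schwartz_withSeminorms ℝ (Space d) ℝ).tendsto_nhds]
  rintro ⟨k, j⟩ ε hε
  have hj : Tendsto (fun n => derivMaps (s n) j) atTop (𝓝 (derivMaps f j)) :=
    (tendsto_pi_nhds.1 h) j
  rw [ContinuousMap.tendsto_iff_forall_isCompact_tendstoUniformlyOn] at hj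
  have hj := hj _ (isCompact_box (d := d) (L := L))
  rw [Metric.tendstoUniformlyOn_iff] at hj
  have hC : 0 < (|R| ^ k + 1) := by positivity
  filter_upwards [hj (ε / (2 * (|R| ^ k + 1))) (by positivity)] with n hn
  refine lt_of_le_of_lt (SchwartzMap.seminorm_le_bound ℝ k j (s n - f) (M := ε / 2)
    (by positivity) fun x => ?_) (half_lt_self hε)
  have hsub : iteratedFDeriv ℝ j (⇑(s n - f)) x =
      iteratedFDeriv ℝ j (s n) x - iteratedFDeriv ℝ j f x := by
    have := iteratedFDeriv_sub_apply (x := x) (i := j) (f := s n) (g := f)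
      ((s n).contDiffAt j) (f.contDiffAt j)
    exact this
  rw [hsub]
  by_cases hx : x ∈ box d L
  · have h1 : ‖iteratedFDeriv ℝ j (s n) x - iteratedFDeriv ℝ j f x‖ ≤
        ε / (2 * (|R| ^ k + 1)) := by
      rw [← dist_eq_norm, dist_comm]
      exact (hn x hx).le
    have h2 : ‖x‖ ^ k ≤ |R| ^ k + 1 :=
      (pow_le_pow_left₀ (norm_nonneg _) ((hR x hx).trans (le_abs_self R)) k).trans (by linarith)
    calc _ ≤ (|R| ^ k + 1) * (ε / (2 * (|R| ^ k + 1))) :=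
          mul_le_mul h2 h1 (norm_nonneg _) hC.le
      _ = ε / 2 := by field_simp
  · have h0 : ∀ g : TestFn d, tsupport g ⊆ box d L → iteratedFDeriv ℝ j g x = 0 := by
      intro g hg
      by_contra hne
      exact hx (hg (support_iteratedFDeriv_subset j hne))
    rw [h0 _ (hs n), h0 _ hf, sub_zero, norm_zero, mul_zero]
    positivity

lemma exists_countable_dense_testFn (d : ℕ) (L : ℝ) : ∃ S : Set (TestFn d), S.Countable ∧
    (∀ f ∈ S, tsupport f ⊆ box d L) ∧ ∀ f : TestFn d, tsupport f ⊆ box d L →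
      ∃ s : ℕ → TestFn d, (∀ n, s n ∈ S) ∧ Tendsto s atTop (𝓝 f) := by
  let A : Set (TestFn d) := {f | tsupport f ⊆ box d L}
  have hsep : TopologicalSpace.IsSeparable (derivMaps '' A) :=
    TopologicalSpace.IsSeparable.of_separableSpace _
  obtain ⟨t, htc, htd⟩ := TopologicalSpace.exists_countable_dense (derivMaps '' A)
  have hpre : ∀ y : derivMaps '' A, ∃ f ∈ A, derivMaps f = y := fun y => y.2
  choose F hFA hF using hpre
  refine ⟨F '' t, htc.image F, ?_, fun f hf => ?_⟩
  · rintro _ ⟨y, -, rfl⟩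
    exact hFA y
  · obtain ⟨y, hy, hlim⟩ := mem_closure_iff_seq_limit.1 (htd ⟨derivMaps f, f, hf, rfl⟩)
    refine ⟨fun n => F (y n), fun n => ⟨y n, hy n, rfl⟩,
      tendsto_of_tendsto_derivMaps (L := L) (fun n => hFA _) hf ?_⟩
    simp only [hF]
    exact (continuous_subtype_val.tendsto _).comp hlim

end Separability

/-! ### Representation of almost every distribution on the box, and uniqueness of the representative
-/

section FunctionOnBox

variable {d : ℕ} {L : ℝ} {K : Space d → ℝ} {ν : Measure (Distr d)} {u : Distr d → Space d → ℝ}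

lemma eval_eq_integral_of_tendsto {φ : Distr d} {w : Space d → ℝ}
    (hw : IntegrableOn w (box d L)) {s : ℕ → TestFn d} {f : TestFn d}
    (hs : Tendsto s atTop (𝓝 f)) (h : ∀ n, φ (s n) = ∫ x in box d L, w x * s n x) :
    φ f = ∫ x in box d L, w x * f x := by
  refine tendsto_nhds_unique ((φ.continuous.tendsto f).comp hs) ?_
  have h0 : Tendsto (fun n => SchwartzMap.seminorm ℝ 0 0 (s n - f)) atTop (𝓝 0) := by
    have := ((schwartz_withSeminorms ℝ (Space d) ℝ).continuous_seminorm (0, 0)).tendsto 0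
    rw [map_zero] at this
    refine this.comp ?_
    simpa using hs.sub_const f
  have hb : ∀ g : TestFn d, Integrable (fun x => w x * g x) (volume.restrict (box d L)) := fun g =>
    hw.mul_bdd (c := SchwartzMap.seminorm ℝ 0 0 g) g.continuous.aestronglyMeasurable
      (.of_forall fun x => SchwartzMap.norm_le_seminorm ℝ g x)
  rw [tendsto_iff_norm_sub_tendsto_zero]
  refine squeeze_zero (fun n => norm_nonneg _) (fun n => ?_)
    (by simpa using h0.const_mul (∫ x in box d L, ‖w x‖))
  simp only [Function.comp_apply]
  rw [h, ← integral_sub (hb _) (hb _), ← integral_mul_const]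
  refine norm_integral_le_of_norm_le (hw.norm.mul_const _) (.of_forall fun x => ?_)
  rw [← mul_sub, norm_mul]
  exact mul_le_mul_of_nonneg_left (SchwartzMap.norm_le_seminorm ℝ (s n - f) x) (norm_nonneg _)

/-- The null set in `IsPointField.ae_eval_eq_integral` depends on the test function. A countable
sequentially dense family yields one null set, and both sides of the identity are continuous in the
test function. -/
lemma IsPointField.ae_isFunctionOnBox [IsFiniteMeasure ν] (hK : IsCovKernel K)
    (hu : IsPointField K ν u) (L : ℝ) : ∀ᵐ φ ∂ν, IsFunctionOnBox L φ (u φ) := by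
  obtain ⟨S, hSc, hS, hdense⟩ := exists_countable_dense_testFn d L
  have hall : ∀ᵐ φ ∂ν, ∀ f ∈ S, φ f = ∫ x in box d L, u φ x * f x :=
    (ae_ball_iff hSc).2 fun f hf => hu.ae_eval_eq_integral hK (hS f hf)
  filter_upwards [hu.ae_integrableOn (L := L) hK, hall] with φ h1 h2
  refine ⟨h1, fun f hf => ?_⟩
  obtain ⟨s, hsS, hs⟩ := hdense f hf
  rw [eval_eq_integral_of_tendsto h1 hs fun n => h2 _ (hsS n)]
  refine setIntegral_eq_integral_of_forall_compl_eq_zero fun x hx => ?_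
  rw [image_eq_zero_of_notMem_tsupport fun h => hx (hf h), mul_zero]

/-- Test functions supported in the interior of the box determine the function there, and the
boundary of a convex set is null. -/
lemma IsFunctionOnBox.ae_eq {φ : Distr d} {v w : Space d → ℝ} (hv : IsFunctionOnBox L φ v)
    (hw : IsFunctionOnBox L φ w) : v =ᵐ[volume.restrict (box d L)] w := by
  have h := IsOpen.ae_eq_zero_of_integral_contDiff_smul_eq_zero (μ := volume)
    (f := fun x => v x - w x) (isOpen_interior (s := box d L))
    ((hv.1.sub hw.1).mono_set interior_subset).locallyIntegrableOn ?_
  · rw [EventuallyEq, ae_restrict_iff' measurableSet_box]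
    filter_upwards [h, interior_box_ae_eq.mem_iff] with x hx hx' hxb
    exact sub_eq_zero.1 (hx (hx'.2 hxb))
  · intro g hg hgc hgs
    set f : TestFn d := hgc.toSchwartzMap hg
    have hfg : ∀ x, f x = g x := fun x => rfl
    have hfs : tsupport f ⊆ box d L := hgs.trans interior_subset
    have e1 := (hv.2 f hfs).symm.trans (hw.2 f hfs)
    have hout : ∀ x, x ∉ box d L → f x = 0 := fun x hx =>
      image_eq_zero_of_notMem_tsupport fun h => hx (hfs h)
    have hres : ∀ w : Space d → ℝ, ∫ x, w x * f x = ∫ x in box d L, w x * f x := fun w =>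
      (setIntegral_eq_integral_of_forall_compl_eq_zero fun x hx => by
        rw [hout x hx, mul_zero]).symm
    have hb : ∀ {w : Space d → ℝ}, IntegrableOn w (box d L) →
        Integrable (fun x => w x * f x) (volume.restrict (box d L)) := fun hw =>
      hw.mul_bdd (c := SchwartzMap.seminorm ℝ 0 0 f) f.continuous.aestronglyMeasurable
        (.of_forall fun x => SchwartzMap.norm_le_seminorm ℝ f x)
    have e2 : ∀ x, g x • (v x - w x) = (v x - w x) * f x := fun x => by
      rw [hfg, smul_eq_mul, mul_comm]
    simp only [e2]
    rw [hres fun x => v x - w x]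
    simp only [sub_mul]
    rw [integral_sub (hb hv.1) (hb hw.1), ← hres, ← hres, e1, sub_self]

lemma interaction_eq (V : ℝ → ℝ) {φ : Distr d} {w : Space d → ℝ} (hw : IsFunctionOnBox L φ w) :
    interaction V L φ = ∫ x in box d L, V (w x) := by
  have h : ∃ u, IsFunctionOnBox L φ u := ⟨w, hw⟩
  rw [interaction, dif_pos h]
  refine integral_congr_ae ?_
  filter_upwards [h.choose_spec.ae_eq hw] with x hx
  rw [hx]

end FunctionOnBox

/-! ### The tilted field -/

section Tilt

open ProbabilityTheory

variable {d : ℕ} {L : ℝ} {K : Space d → ℝ} {ν : Measure (Distr d)} {u : Distr d → Space d → ℝ}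
  {V : ℝ → ℝ} {M : ℝ}

/-- The expectation of `V(φ(x))` for the field shifted by `K J`. -/
noncomputable def tiltMean (V : ℝ → ℝ) (K : Space d → ℝ) (J : TestFn d) (x : Space d) : ℝ :=
  ∫ g, V (applyCov K J x + √(K 0) * g) ∂gaussianReal 0 1

/-- The expectation of `V(φ(x)) V(φ(y))` for the field shifted by `K J`. -/
noncomputable def tiltCorr (V : ℝ → ℝ) (K : Space d → ℝ) (J : TestFn d) (x y : Space d) : ℝ :=
  ∫ g, ∫ g', V (applyCov K J x + √(K 0) * g) * V (applyCov K J y + √(K 0) *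
    (K (x - y) / K 0 * g + √(1 - (K (x - y) / K 0) ^ 2) * g')) ∂gaussianReal 0 1 ∂gaussianReal 0 1

lemma IsCovKernel.measurable_tiltMean (hK : IsCovKernel K) (hV : Measurable V) (J : TestFn d) :
    Measurable (tiltMean V K J) := by
  have hA := (hK.continuous_applyCov J).measurable
  refine StronglyMeasurable.measurable (StronglyMeasurable.integral_prod_right
    (f := fun x g => V (applyCov K J x + √(K 0) * g)) (Measurable.stronglyMeasurable ?_))
  exact hV.comp ((hA.comp measurable_fst).add (measurable_snd.const_mul _))

lemma IsCovKernel.measurable_tiltCorr (hK : IsCovKernel K) (hV : Measurable V) (J : TestFn d) :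
    Measurable (Function.uncurry (tiltCorr V K J)) := by
  have hA := (hK.continuous_applyCov J).measurable
  have hKm := hK.continuous.measurable
  have h1 : Measurable fun z : ((Space d × Space d) × ℝ) × ℝ =>
      V (applyCov K J z.1.1.1 + √(K 0) * z.1.2) * V (applyCov K J z.1.1.2 + √(K 0) *
        (K (z.1.1.1 - z.1.1.2) / K 0 * z.1.2 + √(1 - (K (z.1.1.1 - z.1.1.2) / K 0) ^ 2) * z.2)) :=
    (hV.comp (by fun_prop)).mul (hV.comp (by fun_prop))
  have h2 := StronglyMeasurable.integral_prod_right (ν := gaussianReal 0 1)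
    (f := fun (a : (Space d × Space d) × ℝ) (b : ℝ) =>
      V (applyCov K J a.1.1 + √(K 0) * a.2) * V (applyCov K J a.1.2 + √(K 0) *
        (K (a.1.1 - a.1.2) / K 0 * a.2 + √(1 - (K (a.1.1 - a.1.2) / K 0) ^ 2) * b)))
    h1.stronglyMeasurable
  have h3 := StronglyMeasurable.integral_prod_right (ν := gaussianReal 0 1)
    (f := fun (a : Space d × Space d) (g : ℝ) => ∫ g',
      V (applyCov K J a.1 + √(K 0) * g) * V (applyCov K J a.2 + √(K 0) *
        (K (a.1 - a.2) / K 0 * g + √(1 - (K (a.1 - a.2) / K 0) ^ 2) * g')) ∂gaussianReal 0 1) h2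
  exact h3.measurable

lemma abs_tiltMean_le (hM : ∀ w, |V w| ≤ M) (J : TestFn d) (x : Space d) :
    |tiltMean V K J x| ≤ M := abs_integral_le_of_abs_le fun _ => hM _

lemma abs_tiltCorr_le (hM : ∀ w, |V w| ≤ M) (J : TestFn d) (x y : Space d) :
    |tiltCorr V K J x y| ≤ M * M :=
  abs_integral_le_of_abs_le fun _ => abs_integral_le_of_abs_le fun _ => by
    rw [abs_mul]
    exact mul_le_mul (hM _) (hM _) (abs_nonneg _) ((abs_nonneg _).trans (hM 0))

/-- Every combination s u(x) + t u(y) is jointly Gaussian with φ(J), so tilting moves its mean by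
its covariance with φ(J), namely s (KJ)(x) + t (KJ)(y). The combinations then determine the law of
the pair. -/
lemma IsPointField.map_tilted_pair [IsProbabilityMeasure ν] (hK : IsCovKernel K) (hK0 : 0 < K 0)
    (hu : IsPointField K ν u) (J : TestFn d) (x y : Space d) :
    (ν.tilted fun φ => φ J).map (fun φ => (u φ x, u φ y)) =
      ((gaussianReal 0 1).prod (gaussianReal 0 1)).map (fun g : ℝ × ℝ =>
        (applyCov K J x + √(K 0) * g.1, applyCov K J y + √(K 0) *
          (K (x - y) / K 0 * g.1 + √(1 - (K (x - y) / K 0) ^ 2) * g.2))) := by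
  have hJ : ν.map (fun φ => φ J) = gaussianReal 0 (pointVar K J 0 0 x y).toNNReal := by
    simpa using hu.map_eq J 0 0 x y
  have := isProbabilityMeasure_tilted (integrable_exp_of_map_eq hJ)
  refine map_prodMk_eq_of_gaussian_combinations (hu.measurable_apply x) (hu.measurable_apply y)
    ?_ fun s t => ?_
  · rw [sq_le_one_iff_abs_le_one, abs_div, abs_of_pos hK0, div_le_one hK0]
    exact hK.abs_le _
  · set c := s * applyCov K J x + t * applyCov K J y
    have hq : √(K 0) ^ 2 * (s ^ 2 + t ^ 2 + 2 * s * t * (K (x - y) / K 0)) =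
        pointVar K 0 s t x y := by
      rw [Real.sq_sqrt hK0.le, pointVar, covForm_zero, applyCov_zero, applyCov_zero]
      field_simp
      ring
    have hvar : ∀ τ, covForm K J + 2 * τ * c + τ ^ 2 * pointVar K 0 s t x y =
        pointVar K J (τ * s) (τ * t) x y := by
      intro τ
      simp only [pointVar, covForm_zero, applyCov_zero, c]
      ring
    rw [hq]
    refine map_tilted_eq_gaussianReal (qT := covForm K J)
      (((hu.measurable_apply x).const_mul s).add ((hu.measurable_apply y).const_mul t))
      (fun τ => ?_) (hK.pointVar_nonneg 0 s t x y) fun τ => ?_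
    · rw [hvar]
      exact hK.pointVar_nonneg _ _ _ _ _
    · rw [hvar, ← hu.map_eq]
      congr with φ
      simp only [Pi.add_apply]
      ring

lemma IsPointField.integral_tilted_apply [IsProbabilityMeasure ν] (hK : IsCovKernel K)
    (hK0 : 0 < K 0) (hu : IsPointField K ν u) (hV : Measurable V) (J : TestFn d) (x : Space d) :
    ∫ φ, V (u φ x) ∂(ν.tilted fun φ => φ J) = tiltMean V K J x := by
  have hpair := hu.map_tilted_pair hK hK0 J x x
  have hm : Measurable fun g : ℝ × ℝ =>
      (applyCov K J x + √(K 0) * g.1, applyCov K J x + √(K 0) *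
        (K (x - x) / K 0 * g.1 + √(1 - (K (x - x) / K 0) ^ 2) * g.2)) := by fun_prop
  have hVf : Measurable fun z : ℝ × ℝ => V z.1 := hV.comp measurable_fst
  have h1 := integral_map (μ := ν.tilted fun φ => φ J)
    ((hu.measurable_apply x).prodMk (hu.measurable_apply x)).aemeasurable
    hVf.aestronglyMeasurable
  rw [hpair, integral_map hm.aemeasurable hVf.aestronglyMeasurable] at h1
  rw [← h1, tiltMean, integral_fun_fst (fun g => V (applyCov K J x + √(K 0) * g))]
  simp

lemma IsPointField.integral_tilted_mul [IsProbabilityMeasure ν] (hK : IsCovKernel K)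
    (hK0 : 0 < K 0) (hu : IsPointField K ν u) (hV : Measurable V) (hM : ∀ w, |V w| ≤ M)
    (J : TestFn d) (x y : Space d) :
    ∫ φ, V (u φ x) * V (u φ y) ∂(ν.tilted fun φ => φ J) = tiltCorr V K J x y := by
  have hpair := hu.map_tilted_pair hK hK0 J x y
  have hm : Measurable fun g : ℝ × ℝ =>
      (applyCov K J x + √(K 0) * g.1, applyCov K J y + √(K 0) *
        (K (x - y) / K 0 * g.1 + √(1 - (K (x - y) / K 0) ^ 2) * g.2)) := by fun_prop
  have hVf : Measurable fun z : ℝ × ℝ => V z.1 * V z.2 :=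
    (hV.comp measurable_fst).mul (hV.comp measurable_snd)
  have h1 := integral_map (μ := ν.tilted fun φ => φ J)
    ((hu.measurable_apply x).prodMk (hu.measurable_apply y)).aemeasurable
    hVf.aestronglyMeasurable
  rw [hpair, integral_map hm.aemeasurable hVf.aestronglyMeasurable] at h1
  rw [← h1, tiltCorr]
  refine integral_prod _ (Integrable.of_bound (hVf.comp hm).aestronglyMeasurable (M * M)
    (.of_forall fun g => ?_))
  rw [norm_mul]
  exact mul_le_mul (hM _) (hM _) (norm_nonneg _) ((abs_nonneg _).trans (hM 0))

/-- The interaction term in terms of the field at points. -/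
noncomputable def boxIntegral (L : ℝ) (V : ℝ → ℝ) (u : Distr d → Space d → ℝ) (φ : Distr d) : ℝ :=
  ∫ x in box d L, V (u φ x)

lemma abs_boxIntegral_le (hM : ∀ w, |V w| ≤ M) (φ : Distr d) :
    |boxIntegral L V u φ| ≤ M * volume.real (box d L) := by
  have := norm_integral_le_of_norm_le_const (μ := volume.restrict (box d L))
    (f := fun x => V (u φ x)) (C := M) (.of_forall fun x => hM _)
  simpa [boxIntegral] using this

lemma IsPointField.measurable_boxIntegral (hu : IsPointField K ν u) (hV : Measurable V) :
    Measurable (boxIntegral L V u) :=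
  (StronglyMeasurable.integral_prod_right (f := fun φ x => V (u φ x))
    (hV.comp hu.measurable).stronglyMeasurable).measurable

lemma IsPointField.integral_boxIntegral [IsProbabilityMeasure ν] (hK : IsCovKernel K)
    (hK0 : 0 < K 0) (hu : IsPointField K ν u) (hV : Measurable V) (hM : ∀ w, |V w| ≤ M)
    (J : TestFn d) (L : ℝ) : ∫ φ, boxIntegral L V u φ ∂(ν.tilted fun φ => φ J) =
      ∫ x in box d L, tiltMean V K J x := by
  have hint : Integrable (Function.uncurry fun (φ : Distr d) (x : Space d) => V (u φ x))
      ((ν.tilted fun φ => φ J).prod (volume.restrict (box d L))) :=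
    Integrable.of_bound (hV.comp hu.measurable).aestronglyMeasurable M (.of_forall fun z => hM _)
  simp only [boxIntegral]
  rw [integral_integral_swap hint]
  simp only [hu.integral_tilted_apply hK hK0 hV]

lemma IsPointField.integral_boxIntegral_sq [IsProbabilityMeasure ν] (hK : IsCovKernel K)
    (hK0 : 0 < K 0) (hu : IsPointField K ν u) (hV : Measurable V) (hM : ∀ w, |V w| ≤ M)
    (J : TestFn d) (L : ℝ) : ∫ φ, boxIntegral L V u φ ^ 2 ∂(ν.tilted fun φ => φ J) =
      ∫ x in box d L, ∫ y in box d L, tiltCorr V K J x y := by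
  have hVu : Measurable fun z : Distr d × Space d => V (u z.1 z.2) := hV.comp hu.measurable
  have hint : Integrable (Function.uncurry fun (φ : Distr d) (x : Space d) =>
      V (u φ x) * boxIntegral L V u φ)
      ((ν.tilted fun φ => φ J).prod (volume.restrict (box d L))) := by
    refine Integrable.of_bound (hVu.mul ((hu.measurable_boxIntegral hV).comp
      measurable_fst)).aestronglyMeasurable (M * (M * volume.real (box d L)))
      (.of_forall fun z => ?_)
    rw [Function.uncurry, norm_mul]
    exact mul_le_mul (hM _) (abs_boxIntegral_le hM _) (norm_nonneg _)
      ((abs_nonneg _).trans (hM 0))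
  have hint2 : ∀ x, Integrable (Function.uncurry fun (φ : Distr d) (y : Space d) =>
      V (u φ x) * V (u φ y)) ((ν.tilted fun φ => φ J).prod (volume.restrict (box d L))) := by
    intro x
    refine Integrable.of_bound (((hV.comp (hu.measurable_apply x)).comp measurable_fst).mul
      hVu).aestronglyMeasurable (M * M) (.of_forall fun z => ?_)
    rw [Function.uncurry, norm_mul]
    exact mul_le_mul (hM _) (hM _) (norm_nonneg _) ((abs_nonneg _).trans (hM 0))
  calc ∫ φ, boxIntegral L V u φ ^ 2 ∂(ν.tilted fun φ => φ J)
      = ∫ φ, (∫ x in box d L, V (u φ x) * boxIntegral L V u φ) ∂(ν.tilted fun φ => φ J) := by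
        simp only [integral_mul_const, sq, boxIntegral]
    _ = ∫ x in box d L, ∫ φ, V (u φ x) * boxIntegral L V u φ ∂(ν.tilted fun φ => φ J) :=
        integral_integral_swap hint
    _ = ∫ x in box d L, ∫ φ, (∫ y in box d L, V (u φ x) * V (u φ y)) ∂(ν.tilted fun φ => φ J) := by
        simp only [integral_const_mul, boxIntegral]
    _ = _ := by
        congr with x
        rw [integral_integral_swap (hint2 x)]
        simp only [hu.integral_tilted_mul hK hK0 hV hM]

end Tilt

/-! ### Law of large numbers -/

section LawOfLargeNumbers

open ProbabilityTheory

variable {d : ℕ} {L lam : ℝ} {V : ℝ → ℝ} {M : ℝ} {J : TestFn d}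

lemma abs_exp_sub_exp_le {a b R : ℝ} (ha : a ≤ R) (hb : b ≤ R) :
    |Real.exp a - Real.exp b| ≤ Real.exp R * |a - b| := by
  have key : ∀ {a b : ℝ}, a ≤ R → b ≤ a → Real.exp a - Real.exp b ≤ Real.exp R * (a - b) := by
    intro a b ha hab
    have h1 := Real.add_one_le_exp (b - a)
    have h2 : Real.exp b = Real.exp a * Real.exp (b - a) := by rw [← Real.exp_add]; ring_nf
    have h3 : Real.exp a ≤ Real.exp R := Real.exp_le_exp.2 ha
    rw [h2]
    nlinarith [Real.exp_pos a, mul_le_mul_of_nonneg_right h3 (sub_nonneg.2 hab)]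
  rcases le_total b a with h | h
  · rw [abs_of_nonneg (sub_nonneg.2 h), abs_of_nonneg (sub_nonneg.2 (Real.exp_le_exp.2 h))]
    exact key ha h
  · rw [abs_sub_comm, abs_sub_comm a, abs_of_nonneg (sub_nonneg.2 h),
      abs_of_nonneg (sub_nonneg.2 (Real.exp_le_exp.2 h))]
    exact key hb h

lemma IsGaussianField.integrable_exp {K : Space d → ℝ} {ν : Measure (Distr d)}
    (hν : IsGaussianField K ν) (J : TestFn d) : Integrable (fun φ => Real.exp (φ J)) ν :=
  integrable_exp_of_map_eq (hν.map_eval J)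

lemma intGen_div_freeGen (ν : Measure (Distr d)) {u : Distr d → Space d → ℝ}
    (hu : ∀ᵐ φ ∂ν, IsFunctionOnBox L φ (u φ)) :
    intGen V L lam ν J / freeGen ν J =
      ∫ φ, Real.exp (-lam * boxIntegral L V u φ) ∂(ν.tilted fun φ => φ J) := by
  rw [integral_tilted, intGen, freeGen, ← integral_div]
  refine integral_congr_ae ?_
  filter_upwards [hu] with φ hφ
  rw [interaction_eq V hφ, smul_eq_mul, boxIntegral]
  ring

/-- If the tilted correlations factorize in the limit, the interaction term concentrates at the
limit of its mean, and the connected generating functional converges. -/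
theorem tendsto_connGen {K : ℝ → Space d → ℝ} {ν : ℝ → Measure (Distr d)} {v : Space d → ℝ}
    (hV : Measurable V) (hM : ∀ w, |V w| ≤ M)
    (hK : ∀ᶠ Λ in atTop, IsCovKernel (K Λ)) (hK0 : ∀ᶠ Λ in atTop, 0 < K Λ 0)
    (hν : ∀ᶠ Λ in atTop, IsGaussianField (K Λ) (ν Λ))
    (hcorr : ∀ x, ∀ᵐ y, Tendsto (fun Λ => K Λ (x - y) / K Λ 0) atTop (𝓝 0))
    (hmean : ∀ᵐ x ∂volume.restrict (box d L),
      Tendsto (fun Λ => tiltMean V (K Λ) J x) atTop (𝓝 (v x))) :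
    Tendsto (fun Λ => connGen V L lam (ν Λ) J) atTop (𝓝 (-lam * ∫ x in box d L, v x)) := by
  set c := ∫ x in box d L, v x with hc
  have hA : Tendsto (fun Λ => ∫ x in box d L, tiltMean V (K Λ) J x) atTop (𝓝 c) := by
    refine tendsto_integral_filter_of_dominated_convergence (fun _ => M) ?_
      (.of_forall fun Λ => .of_forall fun x => abs_tiltMean_le hM J x) (integrable_const _) hmean
    filter_upwards [hK] with Λ hΛ
    exact (hΛ.measurable_tiltMean hV J).aestronglyMeasurable
  have hpt : ∀ᵐ x ∂volume.restrict (box d L), ∀ᵐ y ∂volume.restrict (box d L),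
      Tendsto (fun Λ => tiltCorr V (K Λ) J x y) atTop (𝓝 (v x * v y)) := by
    filter_upwards [hmean] with x hx
    -- Decoupling fails on the diagonal, where the correlation is 1; almost every y is enough for
    -- the double integral.
    filter_upwards [hmean, ae_restrict_of_ae (hcorr x)] with y hy hxy
    have h1 := tendsto_integral_gaussianReal_pair_sub hxy
      (F := fun Λ w => V (applyCov (K Λ) J x + √(K Λ 0) * w))
      (G := fun Λ w => V (applyCov (K Λ) J y + √(K Λ 0) * w))
      (fun Λ => hV.comp (by fun_prop)) (fun Λ w => hM _)
      (fun Λ => hV.comp (by fun_prop)) (fun Λ w => hM _)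
    have h2 := h1.add (hx.mul hy)
    rw [zero_add] at h2
    refine h2.congr fun Λ => ?_
    simp only [tiltMean, tiltCorr]
    ring
  have hinner : ∀ᵐ x ∂volume.restrict (box d L),
      Tendsto (fun Λ => ∫ y in box d L, tiltCorr V (K Λ) J x y) atTop (𝓝 (v x * c)) := by
    filter_upwards [hpt] with x hx
    rw [hc, ← integral_const_mul]
    refine tendsto_integral_filter_of_dominated_convergence (fun _ => M * M) ?_
      (.of_forall fun Λ => .of_forall fun y => abs_tiltCorr_le hM J x y) (integrable_const _) hx
    filter_upwards [hK] with Λ hΛ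
    exact ((hΛ.measurable_tiltCorr hV J).comp
      (measurable_const.prodMk measurable_id)).aestronglyMeasurable
  have hB : Tendsto (fun Λ => ∫ x in box d L, ∫ y in box d L, tiltCorr V (K Λ) J x y) atTop
      (𝓝 (c * c)) := by
    conv_rhs => rw [hc, ← integral_mul_const, ← hc]
    refine tendsto_integral_filter_of_dominated_convergence
      (fun _ => M * M * volume.real (box d L)) ?_
      (.of_forall fun Λ => .of_forall fun x => ?_) (integrable_const _) hinner
    · filter_upwards [hK] with Λ hΛ
      exact (StronglyMeasurable.integral_prod_right (f := tiltCorr V (K Λ) J)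
        (hΛ.measurable_tiltCorr hV J).stronglyMeasurable).aestronglyMeasurable
    · have := norm_integral_le_of_norm_le_const (μ := volume.restrict (box d L))
        (f := fun y => tiltCorr V (K Λ) J x y) (C := M * M)
        (.of_forall fun y => abs_tiltCorr_le hM J x y)
      simpa using this
  set R := M * volume.real (box d L) with hR
  have hcR : |c| ≤ R := by
    refine le_of_tendsto hA.abs (.of_forall fun Λ => ?_)
    have := norm_integral_le_of_norm_le_const (μ := volume.restrict (box d L))
      (f := fun x => tiltMean V (K Λ) J x) (C := M) (.of_forall fun x => abs_tiltMean_le hM J x)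
    simpa using this
  clear_value c
  have hvar : Tendsto (fun Λ => √((∫ x in box d L, ∫ y in box d L, tiltCorr V (K Λ) J x y) -
      2 * c * (∫ x in box d L, tiltMean V (K Λ) J x) + c ^ 2)) atTop (𝓝 0) := by
    have h := ((hB.sub (hA.const_mul (2 * c))).add_const (c ^ 2)).sqrt
    rwa [show c * c - 2 * c * c + c ^ 2 = 0 by ring, Real.sqrt_zero] at h
  have hratio : Tendsto (fun Λ => intGen V L lam (ν Λ) J / freeGen (ν Λ) J) atTop
      (𝓝 (Real.exp (-lam * c))) := by
    rw [tendsto_iff_norm_sub_tendsto_zero]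
    refine squeeze_zero' (.of_forall fun Λ => norm_nonneg _) ?_
      (by simpa using hvar.const_mul (Real.exp (|lam| * R) * |lam|))
    filter_upwards [hK, hK0, hν] with Λ h1 h2 h3
    have i1 := h3.isProbabilityMeasure
    obtain ⟨u, hu⟩ := exists_isPointField h1 h3
    have i2 := isProbabilityMeasure_tilted (h3.integrable_exp J)
    set P := (ν Λ).tilted fun φ => φ J
    have hUm := hu.measurable_boxIntegral (L := L) hV
    have hUb : ∀ φ, |boxIntegral L V u φ| ≤ R := fun φ => abs_boxIntegral_le hM φ
    have hUi : Integrable (boxIntegral L V u) P :=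
      .of_bound hUm.aestronglyMeasurable R (.of_forall hUb)
    have hU2 : Integrable (fun φ => boxIntegral L V u φ ^ 2) P := by
      refine .of_bound (hUm.pow_const 2).aestronglyMeasurable (R ^ 2) (.of_forall fun φ => ?_)
      rw [norm_pow]
      exact pow_le_pow_left₀ (norm_nonneg _) (hUb φ) 2
    have hR0 : 0 ≤ R := (abs_nonneg c).trans hcR
    have hlam : ∀ {a : ℝ}, |a| ≤ R → -lam * a ≤ |lam| * R := fun {a} ha =>
      (le_abs_self _).trans (by
        rw [abs_mul, abs_neg]
        exact mul_le_mul_of_nonneg_left ha (abs_nonneg _))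
    have hexpi : Integrable (fun φ => Real.exp (-lam * boxIntegral L V u φ)) P := by
      refine .of_bound (Real.measurable_exp.comp (hUm.const_mul _)).aestronglyMeasurable
        (Real.exp (|lam| * R)) (.of_forall fun φ => ?_)
      rw [Real.norm_of_nonneg (Real.exp_nonneg _)]
      exact Real.exp_le_exp.2 (hlam (hUb φ))
    have hdi : Integrable (fun φ => |boxIntegral L V u φ - c|) P :=
      (hUi.sub (integrable_const c)).abs
    rw [intGen_div_freeGen (ν Λ) (hu.ae_isFunctionOnBox h1 L)]
    have hs1 : ‖∫ φ, Real.exp (-lam * boxIntegral L V u φ) ∂P - Real.exp (-lam * c)‖ ≤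
        Real.exp (|lam| * R) * |lam| * ∫ φ, |boxIntegral L V u φ - c| ∂P := by
      have e : ∫ φ, Real.exp (-lam * boxIntegral L V u φ) ∂P - Real.exp (-lam * c) =
          ∫ φ, (Real.exp (-lam * boxIntegral L V u φ) - Real.exp (-lam * c)) ∂P := by
        rw [integral_sub hexpi (integrable_const _)]
        simp
      rw [e, ← integral_const_mul]
      refine norm_integral_le_of_norm_le
        (g := fun φ => Real.exp (|lam| * R) * |lam| * |boxIntegral L V u φ - c|)
        (hdi.const_mul _) (.of_forall fun φ => ?_)
      refine (abs_exp_sub_exp_le (hlam (hUb φ)) (hlam hcR)).trans (le_of_eq ?_)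
      rw [← mul_sub, abs_mul, abs_neg, mul_assoc]
    refine hs1.trans (mul_le_mul_of_nonneg_left (Real.le_sqrt_of_sq_le ?_) (by positivity))
    have hd2 : ∫ φ, |boxIntegral L V u φ - c| ^ 2 ∂P =
        (∫ x in box d L, ∫ y in box d L, tiltCorr V (K Λ) J x y) -
          2 * c * (∫ x in box d L, tiltMean V (K Λ) J x) + c ^ 2 := by
      rw [← hu.integral_boxIntegral_sq h1 h2 hV hM J L, ← hu.integral_boxIntegral h1 h2 hV hM J L]
      have : ∀ φ, |boxIntegral L V u φ - c| ^ 2 =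
          boxIntegral L V u φ ^ 2 - 2 * c * boxIntegral L V u φ + c ^ 2 := fun φ => by
        rw [sq_abs]; ring
      simp only [this]
      rw [integral_sub_add hU2 (hUi.const_mul _) (integrable_const _), integral_const_mul]
      simp [P]
    rw [← hd2]
    -- Jensen's inequality (E|U-c|)² ≤ E|U-c|², read off from the nonnegative variance of |U-c|.
    have h0 : 0 ≤ variance (fun φ => |boxIntegral L V u φ - c|) P := variance_nonneg _ _
    rw [variance_eq_sub (MemLp.of_bound (hUm.sub_const c).abs.aestronglyMeasurable (R + R)
      (.of_forall fun φ => ?_))] at h0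
    · simpa using h0
    · rw [norm_abs_eq_norm]
      exact (norm_sub_le _ _).trans (add_le_add (hUb φ) hcR)
  have := (Real.continuousAt_log (Real.exp_pos (-lam * c)).ne').tendsto.comp hratio
  rwa [Real.log_exp] at this

end LawOfLargeNumbers

/-! ### Limits of the tilted mean -/

section Limits

open ProbabilityTheory

variable {V : ℝ → ℝ} {M : ℝ} {Vp Vm : ℝ}

lemma measurable_real_sign : Measurable Real.sign := by
  unfold Real.sign
  exact Measurable.ite measurableSet_Iio measurable_const
    (Measurable.ite measurableSet_Ioi measurable_const measurable_const)

lemma abs_real_sign_le (r : ℝ) : |Real.sign r| ≤ 1 := by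
  rcases Real.sign_apply_eq r with h | h | h <;> simp [h]

lemma integral_sign_gaussianReal : ∫ g, Real.sign g ∂gaussianReal 0 1 = 0 := by
  have h := integral_map (μ := gaussianReal 0 1) (φ := fun x : ℝ => -x) (by fun_prop)
    (measurable_real_sign.aestronglyMeasurable (μ := _))
  rw [gaussianReal_map_neg, neg_zero] at h
  simp only [Real.sign_neg, integral_neg] at h
  linarith

lemma integral_gaussianReal_zero_one_shift (a : ℝ) {F : ℝ → ℝ} (hF : Measurable F) :
    ∫ g, F (g + a) ∂gaussianReal 0 1 =
      1 / √(2 * Real.pi) * ∫ w, F w * Real.exp (-(1 / 2) * (w - a) ^ 2) := by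
  have h := integral_gaussianReal_affine a 1 hF
  simp only [one_mul, one_pow, Real.toNNReal_one] at h
  simp only [add_comm _ a]
  rw [h, integral_gaussianReal_eq_integral_smul one_ne_zero, ← integral_const_mul]
  congr with w
  simp only [gaussianPDFReal, smul_eq_mul, NNReal.coe_one, mul_one]
  rw [show -(w - a) ^ 2 / 2 = -(1 / 2) * (w - a) ^ 2 by ring]
  ring

lemma integrable_sign_add (a : ℝ) : Integrable (fun g => Real.sign (g + a)) (gaussianReal 0 1) :=
  .of_bound (measurable_real_sign.comp (by fun_prop)).aestronglyMeasurable 1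
    (.of_forall fun g => abs_real_sign_le _)

lemma ae_add_ne_zero (a : ℝ) : ∀ᵐ g ∂gaussianReal 0 1, g + a ≠ 0 := by
  have : NullSingletonClass (gaussianReal 0 1) := nullSingletonClass_gaussianReal one_ne_zero
  filter_upwards [compl_mem_ae_iff.2 (measure_singleton (μ := gaussianReal 0 1) (-a))] with g hg
  intro h
  exact hg (eq_neg_of_add_eq_zero_left h)

/-- If the arguments of `V` approach `V`'s one-sided limit points according to the sign of
`g + a`, then the Gaussian means converge. -/
lemma tendsto_integral_of_sign {T : ℝ → ℝ → ℝ} (a : ℝ) (hV : Measurable V) (hM : ∀ w, |V w| ≤ M)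
    (hT : ∀ Λ, Measurable (T Λ))
    (hpos : ∀ g, 0 < g + a → Tendsto (fun Λ => V (T Λ g)) atTop (𝓝 Vp))
    (hneg : ∀ g, g + a < 0 → Tendsto (fun Λ => V (T Λ g)) atTop (𝓝 Vm)) :
    Tendsto (fun Λ => ∫ g, V (T Λ g) ∂gaussianReal 0 1) atTop
      (𝓝 ((Vp + Vm) / 2 + (Vp - Vm) / 2 * ∫ g, Real.sign (g + a) ∂gaussianReal 0 1)) := by
  have h : ∫ g, ((Vp + Vm) / 2 + (Vp - Vm) / 2 * Real.sign (g + a)) ∂gaussianReal 0 1 =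
      (Vp + Vm) / 2 + (Vp - Vm) / 2 * ∫ g, Real.sign (g + a) ∂gaussianReal 0 1 := by
    rw [integral_add (integrable_const _) ((integrable_sign_add a).const_mul _),
      integral_const_mul]
    simp
  rw [← h]
  refine tendsto_integral_filter_of_dominated_convergence (fun _ => M)
    (.of_forall fun Λ => (hV.comp (hT Λ)).aestronglyMeasurable)
    (.of_forall fun Λ => .of_forall fun g => hM _) (integrable_const _) ?_
  filter_upwards [ae_add_ne_zero a] with g hg
  rcases lt_or_gt_of_ne hg with h | h
  · rw [Real.sign_of_neg h]
    convert hneg g h using 2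
    ring
  · rw [Real.sign_of_pos h]
    convert hpos g h using 2
    ring

variable {σ h : ℝ → ℝ} {a : ℝ}

lemma tendsto_integral_of_scale_atTop (hV : Measurable V) (hM : ∀ w, |V w| ≤ M)
    (hp : Tendsto V atTop (𝓝 Vp)) (hm : Tendsto V atBot (𝓝 Vm))
    (hσ : Tendsto σ atTop atTop) (hh : Tendsto h atTop (𝓝 a)) :
    Tendsto (fun Λ => ∫ g, V (σ Λ * (g + h Λ)) ∂gaussianReal 0 1) atTop
      (𝓝 ((Vp + Vm) / 2 + (Vp - Vm) / 2 * ∫ g, Real.sign (g + a) ∂gaussianReal 0 1)) :=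
  tendsto_integral_of_sign a hV hM (fun Λ => by fun_prop)
    (fun g hg => hp.comp (hσ.atTop_mul_pos hg (hh.const_add g)))
    (fun g hg => hm.comp (hσ.atTop_mul_neg hg (hh.const_add g)))

/-- For g ≠ 0 the argument tends to 0 from the side given by the sign of g, so V(0) plays no role.
The two sides have equal probability. -/
lemma tendsto_integral_of_scale_zero (hV : Measurable V) (hM : ∀ w, |V w| ≤ M)
    (hp : Tendsto V (𝓝[>] 0) (𝓝 Vp)) (hm : Tendsto V (𝓝[<] 0) (𝓝 Vm))
    (hσ : Tendsto σ atTop (𝓝[>] 0)) (hh : Tendsto h atTop (𝓝 0)) :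
    Tendsto (fun Λ => ∫ g, V (σ Λ * (g + h Λ)) ∂gaussianReal 0 1) atTop
      (𝓝 ((Vp + Vm) / 2)) := by
  have hσ0 : Tendsto σ atTop (𝓝 0) := hσ.mono_right nhdsWithin_le_nhds
  have hσp : ∀ᶠ Λ in atTop, 0 < σ Λ := hσ.eventually self_mem_nhdsWithin
  have hlim : ∀ g, Tendsto (fun Λ => σ Λ * (g + h Λ)) atTop (𝓝 0) := fun g => by
    simpa using hσ0.mul (hh.const_add g)
  have hgh : ∀ g, Tendsto (fun Λ => g + h Λ) atTop (𝓝 (g + 0)) := fun g => hh.const_add g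
  have := tendsto_integral_of_sign (T := fun Λ g => σ Λ * (g + h Λ)) 0 hV hM
    (fun Λ => by fun_prop) (Vp := Vp) (Vm := Vm)
    (fun g hg => hp.comp (tendsto_nhdsWithin_iff.2 ⟨hlim g, by
      filter_upwards [hσp, (hgh g).eventually_const_lt hg] with Λ h1 h2
      exact mul_pos h1 h2⟩))
    (fun g hg => hm.comp (tendsto_nhdsWithin_iff.2 ⟨hlim g, by
      filter_upwards [hσp, (hgh g).eventually_lt_const hg] with Λ h1 h2
      exact mul_neg_of_pos_of_neg h1 h2⟩))
  simpa [integral_sign_gaussianReal] using this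

lemma tendsto_integral_of_shift_atTop (hV : Measurable V) (hM : ∀ w, |V w| ≤ M)
    (hp : Tendsto V atTop (𝓝 Vp)) (hσ : Tendsto σ atTop atTop) (hh : Tendsto h atTop atTop) :
    Tendsto (fun Λ => ∫ g, V (σ Λ * (g + h Λ)) ∂gaussianReal 0 1) atTop (𝓝 Vp) := by
  -- The argument tends to +∞ whatever the sign of g; equal limits on both sides remove the sign
  -- term.
  have := tendsto_integral_of_sign (T := fun Λ g => σ Λ * (g + h Λ)) 0 hV hM
    (fun Λ => by fun_prop) (Vp := Vp) (Vm := Vp)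
    (fun g _ => hp.comp (hσ.atTop_mul_atTop₀ (tendsto_atTop_add_const_left _ g hh)))
    (fun g _ => hp.comp (hσ.atTop_mul_atTop₀ (tendsto_atTop_add_const_left _ g hh)))
  simpa using this

lemma tendsto_integral_of_shift_atBot (hV : Measurable V) (hM : ∀ w, |V w| ≤ M)
    (hm : Tendsto V atBot (𝓝 Vm)) (hσ : Tendsto σ atTop atTop) (hh : Tendsto h atTop atBot) :
    Tendsto (fun Λ => ∫ g, V (σ Λ * (g + h Λ)) ∂gaussianReal 0 1) atTop (𝓝 Vm) := by
  have := tendsto_integral_of_sign (T := fun Λ g => σ Λ * (g + h Λ)) 0 hV hM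
    (fun Λ => by fun_prop) (Vp := Vm) (Vm := Vm)
    (fun g _ => hm.comp (hσ.atTop_mul_atBot₀ (tendsto_atBot_add_const_left _ g hh)))
    (fun g _ => hm.comp (hσ.atTop_mul_atBot₀ (tendsto_atBot_add_const_left _ g hh)))
  simpa using this

/-- V need not be continuous here, so the shift is moved from the argument of V into the Gaussian
density. -/
lemma tendsto_integral_of_shift_zero (hV : Measurable V) (hM : ∀ w, |V w| ≤ M)
    (hh : Tendsto h atTop (𝓝 0)) :
    Tendsto (fun Λ => ∫ g, V (1 * (g + h Λ)) ∂gaussianReal 0 1) atTop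
      (𝓝 (1 / √(2 * Real.pi) * ∫ w, V w * Real.exp (-(1 / 2) * w ^ 2))) := by
  have h1 := tendsto_integral_gaussianReal_sub (l := atTop) (μ := h) (v := fun _ => 1)
    (F := fun _ => V) hh tendsto_const_nhds (fun _ => hV) (fun _ => hM)
  have h2 := h1.add_const (∫ w, V w ∂gaussianReal 0 1)
  have h3 := integral_gaussianReal_zero_one_shift 0 hV
  simp only [add_zero, sub_zero] at h3
  rw [zero_add, h3] at h2
  refine h2.congr fun Λ => ?_
  have h4 := integral_gaussianReal_affine (h Λ) 1 hV
  simp only [one_mul, one_pow, Real.toNNReal_one] at h4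
  rw [← h3, sub_add_cancel, ← h4]
  simp only [one_mul, add_comm]

end Limits

/-! ### Scaling of the renormalized field and its limits for the ranges of η -/

section RenormLimits

variable {d : ℕ} {m η L lam : ℝ} {V : ℝ → ℝ} {M : ℝ} {ν : ℝ → Measure (Distr d)} {J : TestFn d}

/-- The rescaled shift `C_Λ(0)^((η-1)/2) ⟨δ_x, C_Λ J⟩`. -/
noncomputable def scaledShift (m η : ℝ) (J : TestFn d) (x : Space d) (Λ : ℝ) : ℝ :=
  cutoffCov d m Λ 0 ^ ((η - 1) / 2) * applyCov (cutoffCov d m Λ) J x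

lemma sqrt_renormCov_zero (hm : 0 < m) {Λ : ℝ} (hΛ : 0 < Λ) :
    √(renormCov d m η Λ 0) = cutoffCov d m Λ 0 ^ ((η + 1) / 2) := by
  have hc := cutoffCov_zero_pos (d := d) hm hΛ
  rw [renormCov, fieldRenorm, ← Real.rpow_add_one hc.ne', Real.sqrt_eq_rpow,
    ← Real.rpow_mul hc.le]
  ring_nf

/-- Taking the standard deviation C_Λ(0)^((η+1)/2) out of the argument of V separates the scale,
which is critical at η = -1, from the relative shift, which is critical at η = 1. -/
lemma tiltMean_renormCov (hm : 0 < m) {Λ : ℝ} (hΛ : 0 < Λ) (x : Space d) :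
    tiltMean V (renormCov d m η Λ) J x = ∫ g, V (cutoffCov d m Λ 0 ^ ((η + 1) / 2) *
      (g + scaledShift m η J x Λ)) ∂ProbabilityTheory.gaussianReal 0 1 := by
  have hc := cutoffCov_zero_pos (d := d) hm hΛ
  have h1 : applyCov (renormCov d m η Λ) J x =
      cutoffCov d m Λ 0 ^ ((η + 1) / 2) * scaledShift m η J x Λ := by
    rw [scaledShift, ← mul_assoc, ← Real.rpow_add hc]
    exact (applyCov_const_mul _ _ J x).trans (by rw [fieldRenorm]; ring_nf)
  rw [tiltMean, sqrt_renormCov_zero hm hΛ, h1]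
  congr with g
  ring_nf

lemma tendsto_connGen_renormCov (hd : 2 ≤ d) (hm : 0 < m) (hV : Measurable V)
    (hM : ∀ w, |V w| ≤ M)
    (hν : ∀ Λ : ℝ, Real.exp 1 ≤ Λ → IsGaussianField (renormCov d m η Λ) (ν Λ)) {v : Space d → ℝ}
    (hmean : ∀ᵐ x, Tendsto (fun Λ => ∫ g, V (cutoffCov d m Λ 0 ^ ((η + 1) / 2) *
      (g + scaledShift m η J x Λ)) ∂ProbabilityTheory.gaussianReal 0 1) atTop (𝓝 (v x))) :
    Tendsto (fun Λ => connGen V L lam (ν Λ) J) atTop (𝓝 (-lam * ∫ x in box d L, v x)) := by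
  refine tendsto_connGen (K := renormCov d m η) hV hM ?_ ?_ ?_ (fun x => ?_) ?_
  · filter_upwards [eventually_gt_atTop 0] with Λ hΛ
    exact isCovKernel_renormCov hm hΛ η
  · filter_upwards [eventually_gt_atTop 0] with Λ hΛ
    have hc := cutoffCov_zero_pos (d := d) hm hΛ
    exact mul_pos (Real.rpow_pos_of_pos hc η) hc
  · filter_upwards [eventually_ge_atTop (Real.exp 1)] with Λ hΛ using hν Λ hΛ
  · filter_upwards [ae_integrableOn_heatKernel_sub hm x] with y hy
    refine ((tendsto_cutoffCov_heatCov hm hy).div_atTop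
      (tendsto_cutoffCov_zero_atTop hd hm)).congr' ?_
    filter_upwards [eventually_gt_atTop 0] with Λ hΛ
    rw [renormCov, renormCov, mul_div_mul_left]
    exact (Real.rpow_pos_of_pos (cutoffCov_zero_pos hm hΛ) η).ne'
  · filter_upwards [ae_restrict_of_ae hmean] with x hx
    refine hx.congr' ?_
    filter_upwards [eventually_gt_atTop 0] with Λ hΛ
    rw [tiltMean_renormCov hm hΛ]

lemma tendsto_scaledShift_zero (hd : 2 ≤ d) (hm : 0 < m) (hη : η < 1) (J : TestFn d)
    (x : Space d) : Tendsto (scaledShift m η J x) atTop (𝓝 0) := by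
  have h := (tendsto_rpow_neg_atTop (y := (1 - η) / 2) (by linarith)).comp
    (tendsto_cutoffCov_zero_atTop hd hm)
  have h2 := h.mul (tendsto_applyCov_cutoffCov hm J x)
  rw [zero_mul] at h2
  refine h2.congr fun Λ => ?_
  simp only [Function.comp_apply, scaledShift]
  ring_nf

lemma tendsto_scaledShift_one (hm : 0 < m) (J : TestFn d) (x : Space d) :
    Tendsto (scaledShift m 1 J x) atTop (𝓝 (applyCov (freeCov d m) J x)) := by
  refine (tendsto_applyCov_cutoffCov hm J x).congr fun Λ => ?_
  simp [scaledShift]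

lemma tendsto_cutoffCov_rpow_atTop (hd : 2 ≤ d) (hm : 0 < m) (hη : -1 < η) :
    Tendsto (fun Λ => cutoffCov d m Λ 0 ^ ((η + 1) / 2)) atTop atTop :=
  (tendsto_rpow_atTop (by linarith)).comp (tendsto_cutoffCov_zero_atTop hd hm)

lemma tendsto_cutoffCov_rpow_zero (hd : 2 ≤ d) (hm : 0 < m) (hη : η < -1) :
    Tendsto (fun Λ => cutoffCov d m Λ 0 ^ ((η + 1) / 2)) atTop (𝓝[>] 0) := by
  refine tendsto_nhdsWithin_iff.2 ⟨?_, ?_⟩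
  · refine ((tendsto_rpow_neg_atTop (y := -(η + 1) / 2) (by linarith)).comp
      (tendsto_cutoffCov_zero_atTop hd hm)).congr fun Λ => ?_
    simp only [Function.comp_apply]
    ring_nf
  · filter_upwards [eventually_gt_atTop 0] with Λ hΛ
    exact Real.rpow_pos_of_pos (cutoffCov_zero_pos hm hΛ) _

lemma measurable_applyCov_freeCov (hm : 0 < m) (J : TestFn d) :
    Measurable (applyCov (freeCov d m) J) := by
  refine measurable_of_tendsto_metrizable' (f := fun (n : ℕ) =>
    applyCov (cutoffCov d m ((n : ℝ) + 1)) J) atTop (fun n => ?_) (tendsto_pi_nhds.2 fun x => ?_)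
  · exact ((isCovKernel_cutoffCov hm (by positivity)).continuous_applyCov J).measurable
  · exact (tendsto_applyCov_cutoffCov hm J x).comp
      (tendsto_atTop_add_const_right _ 1 tendsto_natCast_atTop_atTop)

end RenormLimits

/-! ### Zeros of functions analytic on lines -/

section Zeros

/-- The zeros of an analytic function that is not identically zero are isolated, hence form a null
set. -/
lemma ae_ne_zero_of_analyticOnNhd {f : ℝ → ℝ} (hf : AnalyticOnNhd ℝ f Set.univ) {t : ℝ}
    (ht : f t ≠ 0) : ∀ᵐ s, f s ≠ 0 := by
  rcases hf.eqOn_zero_or_eventually_ne_zero_of_preconnected isPreconnected_univ with h | h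
  · exact absurd (h (Set.mem_univ t)) ht
  · have := ae_restrict_le_codiscreteWithin (μ := (volume : Measure ℝ)) MeasurableSet.univ h
    rwa [Measure.restrict_univ] at this

/-- A function that is analytic on all lines through a point where it does not vanish is almost
everywhere nonzero. -/
lemma ae_ne_zero_of_analytic_on_lines {d : ℕ} {f : Space d → ℝ} (hf : Measurable f)
    {x₀ : Space d} (hx₀ : f x₀ ≠ 0)
    (ha : ∀ n, AnalyticOnNhd ℝ (fun t : ℝ => f (x₀ + t • n)) Set.univ) : ∀ᵐ x, f x ≠ 0 := by
  -- Fubini in the pair (direction, parameter) gives one t ≠ 0 such that f(x₀ + t n) ≠ 0 for almost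
  -- every n. As n ↦ x₀ + t n is an affine bijection, null sets carry over to x.
  have hmeas : MeasurableSet {z : Space d × ℝ | f (x₀ + z.2 • z.1) ≠ 0} :=
    (hf.comp (by fun_prop)) (measurableSet_singleton 0).compl
  have h1 : ∀ᵐ n : Space d, ∀ᵐ t : ℝ, f (x₀ + t • n) ≠ 0 := .of_forall fun n =>
    ae_ne_zero_of_analyticOnNhd (ha n) (t := 0) (by simpa using hx₀)
  rw [Measure.ae_ae_comm hmeas] at h1
  obtain ⟨t, ht, ht0⟩ := (h1.and (compl_mem_ae_iff.2 (measure_singleton (0 : ℝ)))).exists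
  have ht0 : t ≠ 0 := ht0
  have h2 : volume {n : Space d | ¬ f (x₀ + t • n) ≠ 0} = 0 := ht
  have h3 : {x : Space d | ¬ f x ≠ 0} = (fun x => x + -x₀) ⁻¹'
      ((fun x => t⁻¹ • x) ⁻¹' {n : Space d | ¬ f (x₀ + t • n) ≠ 0}) := by
    ext x
    simp [smul_smul, ht0]
  rw [ae_iff, h3, measure_preimage_add_right,
    Measure.addHaar_preimage_smul volume (inv_ne_zero ht0), h2, mul_zero]

end Zeros

/-! ### The free covariance applied to a band limited test function -/

section BandLimited

variable {d : ℕ} {m : ℝ}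

lemma fourier_eq_cos_sub_sin (J : TestFn d) (ξ : Space d) :
    𝓕 (fun x : Space d => ((J x : ℝ) : ℂ)) ξ =
      ((∫ y, J y * Real.cos (inner ℝ ((2 * Real.pi) • ξ) y) : ℝ) : ℂ) -
      ((∫ y, J y * Real.sin (inner ℝ ((2 * Real.pi) • ξ) y) : ℝ) : ℂ) * Complex.I := by
  rw [Real.fourier_eq', ← integral_complex_ofReal, ← integral_complex_ofReal,
    ← integral_mul_const,
    ← integral_sub (integrable_schwartz_mul_cos J _).ofReal
      ((integrable_schwartz_mul_sin J _).ofReal.mul_const _)]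
  congr with y
  rw [Complex.exp_mul_I, smul_eq_mul, inner_smul_left, real_inner_comm,
    show (-2 * Real.pi * inner ℝ ξ y : ℝ) = -(2 * Real.pi * inner ℝ ξ y) by ring]
  simp only [RCLike.conj_to_real]
  push_cast
  rw [Complex.cos_neg, Complex.sin_neg]
  ring

lemma exists_radius_of_hasCompactSupport {J : TestFn d}
    (hJ : HasCompactSupport (𝓕 (fun x : Space d => ((J x : ℝ) : ℂ)))) :
    ∃ R : ℝ, ∀ p : Space d, p ∉ Metric.closedBall 0 R →
      (∫ y, J y * Real.cos (inner ℝ p y)) = 0 ∧ (∫ y, J y * Real.sin (inner ℝ p y)) = 0 := by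
  obtain ⟨R, hR⟩ := hJ.isCompact.isBounded.exists_norm_le
  -- Mathlib's Fourier transform has the phase 2π⟨ξ, y⟩, so p = 2πξ and the radius is scaled
  -- accordingly.
  refine ⟨2 * Real.pi * R, fun p hp => ?_⟩
  set ξ := (2 * Real.pi)⁻¹ • p with hξ
  have hp' : (2 * Real.pi) • ξ = p := by
    rw [hξ, smul_smul, mul_inv_cancel₀ (by positivity), one_smul]
  have h0 : 𝓕 (fun x : Space d => ((J x : ℝ) : ℂ)) ξ = 0 := by
    refine image_eq_zero_of_notMem_tsupport fun h => hp ?_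
    rw [mem_closedBall_zero_iff, ← hp', norm_smul, Real.norm_of_nonneg (by positivity)]
    exact mul_le_mul_of_nonneg_left (hR ξ h) (by positivity)
  rw [fourier_eq_cos_sub_sin, hp'] at h0
  have hre := congrArg Complex.re h0
  have him := congrArg Complex.im h0
  simp only [Complex.sub_re, Complex.sub_im, Complex.mul_re, Complex.mul_im, Complex.ofReal_re,
    Complex.ofReal_im, Complex.I_re, Complex.I_im, Complex.zero_re, Complex.zero_im] at hre him
  constructor <;> linarith

lemma eq_zero_of_cos_sin_eq_zero {J : TestFn d}
    (h : ∀ p : Space d, (∫ y, J y * Real.cos (inner ℝ p y)) = 0 ∧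
      (∫ y, J y * Real.sin (inner ℝ p y)) = 0) : J = 0 := by
  have h0 : 𝓕 (fun x : Space d => ((J x : ℝ) : ℂ)) = 0 := by
    ext ξ
    rw [fourier_eq_cos_sub_sin, (h _).1, (h _).2]
    simp
  have hinv := Continuous.fourierInv_fourier_eq (f := fun x : Space d => ((J x : ℝ) : ℂ))
    (Complex.continuous_ofReal.comp J.continuous) (J.integrable.ofReal)
    (by rw [h0]; exact integrable_zero _ _ _)
  rw [h0] at hinv
  ext x
  have hx := congrFun hinv x
  simp only [Real.fourierInv_eq, Pi.zero_apply, smul_zero, integral_zero] at hx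
  simpa using hx.symm

/-- The spectral density of the free covariance, cut off at the radius `R`. -/
noncomputable def bandWeight (d : ℕ) (m R : ℝ) (p : Space d) : ℝ :=
  (Metric.closedBall (0 : Space d) R).indicator
    (fun p => 1 / (2 * Real.pi) ^ d * (1 / (‖p‖ ^ 2 + m ^ 2))) p

lemma integrable_bandWeight (hm : 0 < m) (R : ℝ) : Integrable (bandWeight d m R) := by
  refine IntegrableOn.integrable_indicator (ContinuousOn.integrableOn_compact
    (isCompact_closedBall _ _) (Continuous.continuousOn ?_)) Metric.isClosed_closedBall.measurableSet
  have : ∀ p : Space d, ‖p‖ ^ 2 + m ^ 2 ≠ 0 := fun p => by positivity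
  fun_prop (disch := assumption)

lemma bandWeight_of_mem {R : ℝ} {p : Space d} (hp : p ∈ Metric.closedBall 0 R) :
    bandWeight d m R p = 1 / (2 * Real.pi) ^ d * (1 / (‖p‖ ^ 2 + m ^ 2)) :=
  Set.indicator_of_mem hp _

lemma bandWeight_of_notMem {R : ℝ} {p : Space d} (hp : p ∉ Metric.closedBall 0 R) :
    bandWeight d m R p = 0 :=
  Set.indicator_of_notMem hp _

lemma bandWeight_nonneg (hm : 0 < m) (R : ℝ) (p : Space d) : 0 ≤ bandWeight d m R p :=
  Set.indicator_nonneg (fun p _ => by positivity) p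

lemma tendsto_spectralWeight (p : Space d) : Tendsto (fun Λ => spectralWeight d m Λ p) atTop
    (𝓝 (1 / (2 * Real.pi) ^ d * (1 / (‖p‖ ^ 2 + m ^ 2)))) := by
  refine Tendsto.const_mul _ (Tendsto.div_const ?_ _)
  rw [← Real.exp_zero]
  refine (Real.continuous_exp.tendsto 0).comp ?_
  exact tendsto_const_nhds.div_atTop (tendsto_pow_atTop two_ne_zero)

lemma spectralWeight_le (hm : 0 < m) (Λ : ℝ) (p : Space d) :
    spectralWeight d m Λ p ≤ 1 / (2 * Real.pi) ^ d * (1 / (‖p‖ ^ 2 + m ^ 2)) := by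
  unfold spectralWeight
  gcongr
  rw [Real.exp_le_one_iff, neg_div, neg_nonpos]
  positivity

lemma abs_cos_mul_add_sin_mul_le (J : TestFn d) (p x : Space d) :
    |Real.cos (inner ℝ p x) * (∫ y, J y * Real.cos (inner ℝ p y)) +
      Real.sin (inner ℝ p x) * (∫ y, J y * Real.sin (inner ℝ p y))| ≤
      (∫ y, ‖J y‖) + ∫ y, ‖J y‖ := by
  refine (abs_add_le _ _).trans (add_le_add ?_ ?_)
  · rw [abs_mul]
    exact (mul_le_of_le_one_left (abs_nonneg _) (Real.abs_cos_le_one _)).trans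
      (abs_integral_schwartz_cos_le J _)
  · rw [abs_mul]
    exact (mul_le_of_le_one_left (abs_nonneg _) (Real.abs_sin_le_one _)).trans
      (abs_integral_schwartz_sin_le J _)

/-- The free spectral density is not integrable for d ≥ 2, but outside the ball it meets only zeros
of the transform of J. Truncating it leaves CJ unchanged and makes the cosine transform formulas
available. -/
lemma applyCov_freeCov_eq_bandWeight (hm : 0 < m) {J : TestFn d} {R : ℝ}
    (hR : ∀ p : Space d, p ∉ Metric.closedBall 0 R →
      (∫ y, J y * Real.cos (inner ℝ p y)) = 0 ∧ (∫ y, J y * Real.sin (inner ℝ p y)) = 0)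
    (x : Space d) :
    applyCov (freeCov d m) J x = applyCov (cosKernel (bandWeight d m R)) J x := by
  refine tendsto_nhds_unique (tendsto_applyCov_cutoffCov hm J x) ?_
  rw [applyCov_cosKernel (integrable_bandWeight hm R)]
  set I := ∫ y, ‖J y‖
  have hcont : Continuous fun p : Space d => Real.cos (inner ℝ p x) *
      (∫ y, J y * Real.cos (inner ℝ p y)) + Real.sin (inner ℝ p x) *
      (∫ y, J y * Real.sin (inner ℝ p y)) := by
    have h1 := continuous_integral_schwartz_cos J
    have h2 := continuous_integral_schwartz_sin J
    fun_prop
  have key : Tendsto (fun Λ => ∫ p, spectralWeight d m Λ p * (Real.cos (inner ℝ p x) *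
      (∫ y, J y * Real.cos (inner ℝ p y)) + Real.sin (inner ℝ p x) *
      (∫ y, J y * Real.sin (inner ℝ p y)))) atTop (𝓝 (∫ p, bandWeight d m R p *
      (Real.cos (inner ℝ p x) * (∫ y, J y * Real.cos (inner ℝ p y)) + Real.sin (inner ℝ p x) *
      (∫ y, J y * Real.sin (inner ℝ p y))))) := by
    refine tendsto_integral_filter_of_dominated_convergence
      (fun p => bandWeight d m R p * (I + I))
      (.of_forall fun Λ => ((continuous_spectralWeight hm).mul hcont).aestronglyMeasurable)
      (.of_forall fun Λ => .of_forall fun p => ?_) ((integrable_bandWeight hm R).mul_const _)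
      (.of_forall fun p => ?_)
    · by_cases hp : p ∈ Metric.closedBall 0 R
      · rw [norm_mul, bandWeight_of_mem hp, Real.norm_of_nonneg (spectralWeight_pos hm p).le]
        exact mul_le_mul (spectralWeight_le hm Λ p) (abs_cos_mul_add_sin_mul_le J p x)
          (norm_nonneg _) (by positivity)
      · simp [hR p hp, bandWeight_of_notMem hp]
    · by_cases hp : p ∈ Metric.closedBall 0 R
      · rw [bandWeight_of_mem hp]
        exact (tendsto_spectralWeight p).mul_const _
      · simp [hR p hp]
  refine key.congr' ?_
  filter_upwards [eventually_gt_atTop 0] with Λ hΛ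
  rw [cutoffCov_eq_cosKernel hm hΛ, applyCov_cosKernel (integrable_spectralWeight hm hΛ)]

/-- If the truncated covariance annihilates J, then ∫ w |Ĵ|² = 0 with w positive on the ball. So Ĵ
vanishes almost everywhere, then everywhere by continuity, and J = 0 by Fourier inversion. -/
lemma exists_applyCov_ne_zero (hm : 0 < m) {J : TestFn d} {R : ℝ}
    (hR : ∀ p : Space d, p ∉ Metric.closedBall 0 R →
      (∫ y, J y * Real.cos (inner ℝ p y)) = 0 ∧ (∫ y, J y * Real.sin (inner ℝ p y)) = 0)
    (hJ : J ≠ 0) : ∃ x, applyCov (cosKernel (bandWeight d m R)) J x ≠ 0 := by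
  by_contra! hall
  refine hJ (eq_zero_of_cos_sin_eq_zero ?_)
  have h0 : covForm (cosKernel (bandWeight d m R)) J = 0 := by
    simp [covForm, hall]
  rw [covForm_cosKernel (integrable_bandWeight hm R)] at h0
  set A := fun p : Space d => ∫ y, J y * Real.cos (inner ℝ p y) with hA
  set B := fun p : Space d => ∫ y, J y * Real.sin (inner ℝ p y) with hB
  have hAc : Continuous A := continuous_integral_schwartz_cos J
  have hBc : Continuous B := continuous_integral_schwartz_sin J
  have hint : Integrable fun p => bandWeight d m R p * (A p ^ 2 + B p ^ 2) := by
    refine (integrable_bandWeight hm R).mul_bdd (c := (∫ y, ‖J y‖) ^ 2 + (∫ y, ‖J y‖) ^ 2)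
      ((hAc.pow 2).add (hBc.pow 2)).aestronglyMeasurable (.of_forall fun p => ?_)
    rw [Real.norm_of_nonneg (by positivity), ← sq_abs (A p), ← sq_abs (B p)]
    exact add_le_add (pow_le_pow_left₀ (abs_nonneg _) (abs_integral_schwartz_cos_le J p) 2)
      (pow_le_pow_left₀ (abs_nonneg _) (abs_integral_schwartz_sin_le J p) 2)
  rw [integral_eq_zero_iff_of_nonneg
    (fun p => mul_nonneg (bandWeight_nonneg hm R p) (by positivity)) hint] at h0
  have h1 : (fun p => A p ^ 2 + B p ^ 2) =ᵐ[volume] fun _ => 0 := by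
    filter_upwards [h0] with p hp
    by_cases hpR : p ∈ Metric.closedBall 0 R
    · rw [bandWeight_of_mem hpR] at hp
      have : 1 / (2 * Real.pi) ^ d * (1 / (‖p‖ ^ 2 + m ^ 2)) ≠ 0 := by positivity
      exact (mul_eq_zero.1 hp).resolve_left this
    · simp [hA, hB, hR p hpR]
  have h1' := (Continuous.ae_eq_iff_eq volume (f := fun p => A p ^ 2 + B p ^ 2)
    ((hAc.pow 2).add (hBc.pow 2)) continuous_const).1 h1
  intro p
  have h2 := congrFun h1' p
  constructor
  · have : A p ^ 2 = 0 := by nlinarith [sq_nonneg (A p), sq_nonneg (B p)]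
    exact pow_eq_zero_iff two_ne_zero |>.1 this
  · have : B p ^ 2 = 0 := by nlinarith [sq_nonneg (A p), sq_nonneg (B p)]
    exact pow_eq_zero_iff two_ne_zero |>.1 this

/-- The Fourier transform in one complex direction of an integrable function with bounded support
is entire. -/
lemma differentiable_integral_mul_cexp {G : Space d → ℂ} (hG : Integrable G) {R : ℝ}
    (hR : ∀ p, p ∉ Metric.closedBall 0 R → G p = 0) (n : Space d) :
    Differentiable ℂ fun z : ℂ => ∫ p, G p * Complex.exp (z * (inner ℝ p n : ℝ) * Complex.I) := by
  intro z₀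
  set C := |R| * ‖n‖ with hC
  have hC0 : 0 ≤ C := by positivity
  have hinner : ∀ p ∈ Metric.closedBall (0 : Space d) R, |inner ℝ p n| ≤ C := by
    intro p hp
    refine (abs_real_inner_le_norm p n).trans (mul_le_mul_of_nonneg_right ?_ (norm_nonneg _))
    exact (mem_closedBall_zero_iff.1 hp).trans (le_abs_self R)
  have hexp : ∀ z : ℂ, ‖z‖ ≤ ‖z₀‖ + 1 → ∀ p ∈ Metric.closedBall (0 : Space d) R,
      ‖Complex.exp (z * (inner ℝ p n : ℝ) * Complex.I)‖ ≤ Real.exp ((‖z₀‖ + 1) * C) := by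
    intro z hz p hp
    rw [Complex.norm_exp]
    refine Real.exp_le_exp.2 ((Complex.re_le_norm _).trans ?_)
    rw [norm_mul, norm_mul, Complex.norm_I, mul_one, Complex.norm_real]
    exact mul_le_mul hz (hinner p hp) (norm_nonneg _) (by positivity)
  have hbdd : ∀ z : ℂ, ‖z‖ ≤ ‖z₀‖ + 1 → ∀ p,
      ‖G p * Complex.exp (z * (inner ℝ p n : ℝ) * Complex.I)‖ ≤
        ‖G p‖ * Real.exp ((‖z₀‖ + 1) * C) := by
    intro z hz p
    rw [norm_mul]
    by_cases hp : p ∈ Metric.closedBall 0 R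
    · exact mul_le_mul_of_nonneg_left (hexp z hz p hp) (norm_nonneg _)
    · simp [hR p hp]
  have hmeas : ∀ z : ℂ, AEStronglyMeasurable
      (fun p => G p * Complex.exp (z * (inner ℝ p n : ℝ) * Complex.I)) volume := fun z =>
    hG.aestronglyMeasurable.mul (by fun_prop)
  refine (hasDerivAt_integral_of_dominated_loc_of_deriv_le (Metric.ball_mem_nhds z₀ one_pos)
    (F' := fun z p => G p * Complex.exp (z * (inner ℝ p n : ℝ) * Complex.I) *
      ((inner ℝ p n : ℝ) * Complex.I))
    (bound := fun p => ‖G p‖ * Real.exp ((‖z₀‖ + 1) * C) * C)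
    (.of_forall hmeas) ?_ ((hmeas z₀).mul (by fun_prop)) ?_ ?_ ?_).2.differentiableAt
  · exact (hG.norm.mul_const _).mono' (hmeas z₀) (.of_forall (hbdd z₀ (by linarith)))
  · refine .of_forall fun p z hz => ?_
    have hz' : ‖z‖ ≤ ‖z₀‖ + 1 := by
      have := norm_le_norm_add_norm_sub' z z₀
      rw [Metric.mem_ball, dist_eq_norm] at hz
      linarith
    by_cases hp : p ∈ Metric.closedBall 0 R
    · rw [norm_mul]
      refine mul_le_mul (hbdd z hz' p) ?_ (norm_nonneg _) (by positivity)
      rw [norm_mul, Complex.norm_I, mul_one, Complex.norm_real]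
      exact hinner p hp
    · simp [hR p hp]
  · exact (hG.norm.mul_const _).mul_const _
  · refine .of_forall fun p z _ => ?_
    have h1 : HasDerivAt (fun z : ℂ => z * (inner ℝ p n : ℝ) * Complex.I)
        ((inner ℝ p n : ℝ) * Complex.I) z := by
      simpa using ((hasDerivAt_id z).mul_const ((inner ℝ p n : ℝ) : ℂ)).mul_const Complex.I
    simpa [mul_assoc] using (h1.cexp).const_mul (G p)

lemma analyticOnNhd_applyCov_line (hm : 0 < m) (J : TestFn d) (R : ℝ) (x₀ n : Space d) :
    AnalyticOnNhd ℝ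
      (fun t : ℝ => applyCov (cosKernel (bandWeight d m R)) J (x₀ + t • n)) Set.univ := by
  set A := fun p : Space d => ∫ y, J y * Real.cos (inner ℝ p y) with hA
  set B := fun p : Space d => ∫ y, J y * Real.sin (inner ℝ p y) with hB
  have hAc : Continuous A := continuous_integral_schwartz_cos J
  have hBc : Continuous B := continuous_integral_schwartz_sin J
  set I := ∫ y, ‖J y‖
  set G : Space d → ℂ := fun p => (bandWeight d m R p : ℂ) *
    (((A p : ℂ) - (B p : ℂ) * Complex.I) * Complex.exp ((inner ℝ p x₀ : ℝ) * Complex.I)) with hG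
  have hGi : Integrable G := by
    refine (integrable_bandWeight hm R).ofReal.mul_bdd (c := I + I) ?_ (.of_forall fun p => ?_)
    · exact Continuous.aestronglyMeasurable (by fun_prop)
    · rw [norm_mul, Complex.norm_exp_ofReal_mul_I, mul_one]
      refine (norm_sub_le _ _).trans (add_le_add ?_ ?_)
      · rw [Complex.norm_real]
        exact abs_integral_schwartz_cos_le J p
      · rw [norm_mul, Complex.norm_I, mul_one, Complex.norm_real]
        exact abs_integral_schwartz_sin_le J p
  have hGR : ∀ p, p ∉ Metric.closedBall 0 R → G p = 0 := fun p hp => by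
    simp [hG, bandWeight_of_notMem hp]
  have hdiff := differentiable_integral_mul_cexp hGi hGR n
  -- With A and B the cosine and sine transforms, cos θ · A + sin θ · B is the real part of (A -
  -- iB)e^{iθ}. The function on the line is therefore the real part of an entire function restricted
  -- to ℝ.
  have heq : (fun t : ℝ => applyCov (cosKernel (bandWeight d m R)) J (x₀ + t • n)) =
      fun t : ℝ => (∫ p, G p * Complex.exp ((t : ℂ) * (inner ℝ p n : ℝ) * Complex.I)).re := by
    ext t
    have hint : Integrable fun p => G p * Complex.exp ((t : ℂ) * (inner ℝ p n : ℝ) * Complex.I) :=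
      hGi.mul_bdd (c := 1) (by fun_prop) (.of_forall fun p => by
        rw [← Complex.ofReal_mul, Complex.norm_exp_ofReal_mul_I])
    rw [applyCov_cosKernel (integrable_bandWeight hm R)]
    refine Eq.trans (integral_congr_ae (.of_forall fun p => ?_)) (integral_re hint)
    have h1 : G p * Complex.exp ((t : ℂ) * (inner ℝ p n : ℝ) * Complex.I) =
        (bandWeight d m R p : ℂ) * (((A p : ℂ) - (B p : ℂ) * Complex.I) *
          Complex.exp (((inner ℝ p (x₀ + t • n) : ℝ) : ℂ) * Complex.I)) := by
      rw [hG]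
      simp only
      rw [mul_assoc, mul_assoc, ← Complex.exp_add, inner_add_right, inner_smul_right]
      push_cast
      ring_nf
    simp only [h1, RCLike.re_eq_complex_re, Complex.re_ofReal_mul]
    congr 1
    rw [Complex.exp_mul_I, ← Complex.ofReal_cos, ← Complex.ofReal_sin]
    simp only [Complex.mul_re, Complex.sub_re, Complex.add_re, Complex.ofReal_re,
      Complex.ofReal_im, Complex.I_re, Complex.I_im, Complex.mul_im, Complex.sub_im,
      Complex.add_im, hA, hB]
    ring
  rw [heq]
  exact fun t _ => (hdiff.analyticAt t).re_ofReal

theorem ae_applyCov_freeCov_ne_zero (hm : 0 < m) {J : TestFn d} (hJ : J ≠ 0)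
    (hc : HasCompactSupport (𝓕 (fun x : Space d => ((J x : ℝ) : ℂ)))) :
    ∀ᵐ x, applyCov (freeCov d m) J x ≠ 0 := by
  obtain ⟨R, hR⟩ := exists_radius_of_hasCompactSupport hc
  obtain ⟨x₀, hx₀⟩ := exists_applyCov_ne_zero hm hR hJ
  have hmeas := ((isCovKernel_cosKernel (integrable_bandWeight (d := d) hm R)
    (bandWeight_nonneg hm R)).continuous_applyCov J).measurable
  filter_upwards [ae_ne_zero_of_analytic_on_lines hmeas hx₀
    fun n => analyticOnNhd_applyCov_line hm J R x₀ n] with x hx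
  rwa [applyCov_freeCov_eq_bandWeight hm hR]

end BandLimited

/-! ### The generating functionals -/

section GeneratingFunctionals

variable {d : ℕ} {m η L lam : ℝ} {V : ℝ → ℝ} {M : ℝ}

/-- The interaction is bounded by M|B| almost surely. Its measurability up to null sets comes from
the point field, since the representative chosen in its definition need not depend measurably on φ.
-/
lemma IsGaussianField.generating_functionals_wellDefined {K : Space d → ℝ}
    {ν : Measure (Distr d)} (hν : IsGaussianField K ν) (hK : IsCovKernel K) (hV : Measurable V)
    (hM : ∀ w, |V w| ≤ M) (L lam : ℝ) (J : TestFn d) :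
    (∀ᵐ φ ∂ν, ∃ u, IsFunctionOnBox L φ u) ∧
      Integrable (fun φ : Distr d => Real.exp (φ J)) ν ∧
      Integrable (fun φ : Distr d => Real.exp (φ J) * Real.exp (-lam * interaction V L φ)) ν ∧
      0 < freeGen ν J ∧ 0 < intGen V L lam ν J := by
  have := hν.isProbabilityMeasure
  obtain ⟨u, hu⟩ := exists_isPointField hK hν
  have hbox := hu.ae_isFunctionOnBox hK L
  have hexp := hν.integrable_exp J
  have hint : Integrable
      (fun φ : Distr d => Real.exp (φ J) * Real.exp (-lam * interaction V L φ)) ν := by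
    refine (hexp.mul_bdd (f := fun φ : Distr d => Real.exp (φ J))
      (g := fun φ => Real.exp (-lam * boxIntegral L V u φ))
      (c := Real.exp (|lam| * (M * volume.real (box d L)))) ?_ (.of_forall fun φ => ?_)).congr ?_
    · exact (((hu.measurable_boxIntegral hV).const_mul _).exp).aestronglyMeasurable
    · rw [Real.norm_of_nonneg (Real.exp_pos _).le, Real.exp_le_exp]
      refine (le_abs_self _).trans ?_
      rw [abs_mul, abs_neg]
      exact mul_le_mul_of_nonneg_left (abs_boxIntegral_le hM φ) (abs_nonneg _)
    · filter_upwards [hbox] with φ hφ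
      rw [interaction_eq V hφ, boxIntegral]
  refine ⟨hbox.mono fun φ hφ => ⟨_, hφ⟩, hexp, hint, integral_exp_pos hexp, ?_⟩
  simp only [← Real.exp_add] at hint
  simp only [intGen, ← Real.exp_add]
  exact integral_exp_pos hint

lemma integral_box_const_add_mul (a b : ℝ) {S : Space d → ℝ} (hS : Measurable S)
    (hS1 : ∀ x, |S x| ≤ 1) :
    ∫ x in box d L, (a + b * S x) = volume.real (box d L) * a + b * ∫ x in box d L, S x := by
  have hi : Integrable S (volume.restrict (box d L)) :=
    .of_bound hS.aestronglyMeasurable 1 (.of_forall hS1)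
  rw [integral_add (integrable_const _) (hi.const_mul _), integral_const_mul, setIntegral_const,
    smul_eq_mul]

lemma tendsto_scaledShift_atTop (hd : 2 ≤ d) (hm : 0 < m) (hη : 1 < η) {J : TestFn d}
    {x : Space d} (hx : 0 < applyCov (freeCov d m) J x) :
    Tendsto (scaledShift m η J x) atTop atTop :=
  ((tendsto_rpow_atTop (by linarith)).comp (tendsto_cutoffCov_zero_atTop hd hm)).atTop_mul_pos hx
    (tendsto_applyCov_cutoffCov hm J x)

lemma tendsto_scaledShift_atBot (hd : 2 ≤ d) (hm : 0 < m) (hη : 1 < η) {J : TestFn d}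
    {x : Space d} (hx : applyCov (freeCov d m) J x < 0) :
    Tendsto (scaledShift m η J x) atTop atBot :=
  ((tendsto_rpow_atTop (by linarith)).comp (tendsto_cutoffCov_zero_atTop hd hm)).atTop_mul_neg hx
    (tendsto_applyCov_cutoffCov hm J x)

lemma tendsto_connGen_of_tendsto_scaledShift_zero {ν : ℝ → Measure (Distr d)} {J : TestFn d}
    {Vp Vm : ℝ} (hd : 2 ≤ d) (hm : 0 < m) (hV : Measurable V) (hM : ∀ w, |V w| ≤ M)
    (hν : ∀ Λ : ℝ, Real.exp 1 ≤ Λ → IsGaussianField (renormCov d m η Λ) (ν Λ)) (hη : -1 < η)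
    (hp : Tendsto V atTop (𝓝 Vp)) (hm' : Tendsto V atBot (𝓝 Vm))
    (hs : ∀ x, Tendsto (scaledShift m η J x) atTop (𝓝 0)) :
    Tendsto (fun Λ => connGen V L lam (ν Λ) J) atTop
      (𝓝 (-lam * boxVol d L * ((Vp + Vm) / 2))) := by
  have h := tendsto_connGen_renormCov (L := L) (lam := lam) hd hm hV hM hν
    (v := fun _ => (Vp + Vm) / 2) (.of_forall fun x => by
      simpa [integral_sign_gaussianReal] using tendsto_integral_of_scale_atTop hV hM hp hm'
        (tendsto_cutoffCov_rpow_atTop hd hm hη) (hs x))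
  rwa [setIntegral_const, smul_eq_mul, ← mul_assoc] at h

end GeneratingFunctionals

end ScalarField

/-! ### The theorem -/

open ScalarField

theorem theorem1 (d : ℕ) (hd : 2 ≤ d) (m : ℝ) (hm : 0 < m) (L : ℝ) (hL : 0 < L)
    (lam η : ℝ) (V : ℝ → ℝ) (hVmeas : Measurable V) (hVbdd : ∃ M : ℝ, ∀ w, |V w| ≤ M)
    (ν : ℝ → Measure (Distr d))
    (hν : ∀ Λ : ℝ, Real.exp 1 ≤ Λ → IsGaussianField (renormCov d m η Λ) (ν Λ))
    (J : TestFn d) :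
    -- the generating functionals with cut-off are well defined and positive
    (∀ Λ : ℝ, Real.exp 1 ≤ Λ →
      (∀ᵐ φ ∂(ν Λ), ∃ u, IsFunctionOnBox L φ u) ∧
      Integrable (fun φ : Distr d => Real.exp (φ J)) (ν Λ) ∧
      Integrable (fun φ : Distr d =>
        Real.exp (φ J) * Real.exp (-lam * interaction V L φ)) (ν Λ) ∧
      0 < freeGen (ν Λ) J ∧ 0 < intGen V L lam (ν Λ) J) ∧
    -- (a)
    (η < -1 → ∀ Vzp Vzm : ℝ, Tendsto V (𝓝[>] 0) (𝓝 Vzp) → Tendsto V (𝓝[<] 0) (𝓝 Vzm) →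
      Tendsto (fun Λ : ℝ => connGen V L lam (ν Λ) J) atTop
        (𝓝 (-lam * boxVol d L * ((Vzp + Vzm) / 2)))) ∧
    -- (b)
    (η = -1 →
      Tendsto (fun Λ : ℝ => connGen V L lam (ν Λ) J) atTop
        (𝓝 (-lam * boxVol d L *
          (1 / Real.sqrt (2 * Real.pi) * ∫ w : ℝ, V w * Real.exp (-(1 / 2) * w ^ 2))))) ∧
    -- (c)
    (-1 < η → η < 1 → ∀ Vp Vm : ℝ, Tendsto V atTop (𝓝 Vp) → Tendsto V atBot (𝓝 Vm) →
      Tendsto (fun Λ : ℝ => connGen V L lam (ν Λ) J) atTop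
        (𝓝 (-lam * boxVol d L * ((Vp + Vm) / 2)))) ∧
    -- (d)
    (η = 1 → ∀ Vp Vm : ℝ, Tendsto V atTop (𝓝 Vp) → Tendsto V atBot (𝓝 Vm) →
      Tendsto (fun Λ : ℝ => connGen V L lam (ν Λ) J) atTop
        (𝓝 (-lam * boxVol d L * ((Vp + Vm) / 2) -
          lam * ((Vp - Vm) / 2) * (1 / Real.sqrt (2 * Real.pi)) *
            ∫ x in box d L, ∫ w : ℝ,
              Real.sign w * Real.exp (-(1 / 2) * (w - applyCov (freeCov d m) J x) ^ 2)))) ∧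
    -- (e)
    (1 < η → HasCompactSupport (𝓕 (fun x : Space d => ((J x : ℝ) : ℂ))) →
      ∀ Vp Vm : ℝ, Tendsto V atTop (𝓝 Vp) → Tendsto V atBot (𝓝 Vm) →
      Tendsto (fun Λ : ℝ => connGen V L lam (ν Λ) J) atTop
        (𝓝 (-lam * boxVol d L * ((Vp + Vm) / 2) -
          lam * ((Vp - Vm) / 2) * Set.indicator {J' : TestFn d | J' ≠ 0} (fun _ => (1 : ℝ)) J *
            ∫ x in box d L, Real.sign (applyCov (freeCov d m) J x)))) := by
  obtain ⟨M, hM⟩ := hVbdd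
  refine ⟨fun Λ hΛ => ?_, fun hη Vp Vm hp hm' => ?_, fun hη => ?_, fun hη1 hη2 Vp Vm hp hm' => ?_,
    fun hη Vp Vm hp hm' => ?_, fun hη hJc Vp Vm hp hm' => ?_⟩
  · exact (hν Λ hΛ).generating_functionals_wellDefined
      (isCovKernel_renormCov hm ((Real.exp_pos 1).trans_le hΛ) η) hVmeas hM L lam J
  · have h := tendsto_connGen_renormCov (L := L) (lam := lam) hd hm hVmeas hM hν
      (.of_forall fun x => tendsto_integral_of_scale_zero hVmeas hM hp hm'
        (tendsto_cutoffCov_rpow_zero hd hm hη)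
        (tendsto_scaledShift_zero hd hm (by linarith) J x))
    rwa [setIntegral_const, smul_eq_mul, ← mul_assoc] at h
  · subst hη
    have h := tendsto_connGen_renormCov (L := L) (lam := lam) hd hm hVmeas hM hν
      (v := fun _ => 1 / √(2 * Real.pi) * ∫ w, V w * Real.exp (-(1 / 2) * w ^ 2))
      -- At η = -1 the exponent (η+1)/2 is 0, so the scale is exactly 1 and only the vanishing shift
      -- remains.
      (.of_forall fun x => by
        simpa using tendsto_integral_of_shift_zero hVmeas hM
          (tendsto_scaledShift_zero hd hm (by norm_num) J x))
    rwa [setIntegral_const, smul_eq_mul, ← mul_assoc] at h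
  · exact tendsto_connGen_of_tendsto_scaledShift_zero hd hm hVmeas hM hν hη1 hp hm'
      (tendsto_scaledShift_zero hd hm hη2 J)
  · subst hη
    have h := tendsto_connGen_renormCov (L := L) (lam := lam) hd hm hVmeas hM hν
      (.of_forall fun x => tendsto_integral_of_scale_atTop hVmeas hM hp hm'
        (tendsto_cutoffCov_rpow_atTop hd hm (by norm_num)) (tendsto_scaledShift_one hm J x))
    rw [integral_box_const_add_mul _ _ (StronglyMeasurable.integral_prod_right
        (f := fun x g => Real.sign (g + applyCov (freeCov d m) J x))
        (measurable_real_sign.comp (measurable_snd.add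
          ((measurable_applyCov_freeCov hm J).comp measurable_fst))).stronglyMeasurable).measurable
      (fun x => abs_integral_le_of_abs_le fun g => abs_real_sign_le _)] at h
    simp only [integral_gaussianReal_zero_one_shift _ measurable_real_sign,
      integral_const_mul] at h
    convert h using 2
    rw [boxVol]
    ring
  -- For J = 0 the shift is identically 0, however large its prefactor, and the result is the same
  -- as for -1 < η < 1.
  · rcases eq_or_ne J 0 with rfl | hJ
    · simpa using tendsto_connGen_of_tendsto_scaledShift_zero (L := L) (lam := lam) hd hm hVmeas hM
        hν (by linarith) hp hm' (fun x => tendsto_const_nhds.congr fun Λ => by simp [scaledShift, applyCov])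
    · have h := tendsto_connGen_renormCov (L := L) (lam := lam) hd hm hVmeas hM hν
        (v := fun x => (Vp + Vm) / 2 + (Vp - Vm) / 2 * Real.sign (applyCov (freeCov d m) J x)) (by
          filter_upwards [ae_applyCov_freeCov_ne_zero hm hJ hJc] with x hx
          rcases lt_or_gt_of_ne hx with hx | hx
          · rw [Real.sign_of_neg hx, show (Vp + Vm) / 2 + (Vp - Vm) / 2 * -1 = Vm by ring]
            exact tendsto_integral_of_shift_atBot hVmeas hM hm'
              (tendsto_cutoffCov_rpow_atTop hd hm (by linarith))
              (tendsto_scaledShift_atBot hd hm hη hx)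
          · rw [Real.sign_of_pos hx, show (Vp + Vm) / 2 + (Vp - Vm) / 2 * 1 = Vp by ring]
            exact tendsto_integral_of_shift_atTop hVmeas hM hp
              (tendsto_cutoffCov_rpow_atTop hd hm (by linarith))
              (tendsto_scaledShift_atTop hd hm hη hx))
      rw [integral_box_const_add_mul _ _
        (S := fun x => Real.sign (applyCov (freeCov d m) J x))
        (measurable_real_sign.comp (measurable_applyCov_freeCov hm J))
        (fun x => abs_real_sign_le _)] at h
      convert h using 2
      rw [boxVol, Set.indicator_of_mem (by exact hJ)]
      ring
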